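/- Let $n\ge 2$, $N\ge 1$, and let $(\rho,W_\rho)$ be an irreducible algebraic representation of $\mathrm{GL}_n(\mathbb C)$ with highest weight $(k_1,\dots,k_n)\in\mathbb Z^n$, $k_1\ge\dots\ge k_n\ge 0$. Let $W_{\rho,0}\subset W_\rho$ be a $\mathbb Z$-form of $\rho$: the $\mathbb Z$-span of a $\mathbb C$-basis of $W_\rho$ such that $\rho$ comes from actions of $\mathrm{GL}_n(R)$ on $W_{\rho,0}\otimes_{\mathbb Z}R$, functorial in the commutative ring $R$ (equivalently, in this basis the matrix coefficients of $\rho$ lie in $\mathbb Z[x_{ij},\det^{-1}]$). Let $\mathfrak H_n$ be the Siegel upper half-space, and let $\Gamma(N)=\ker(\mathrm{Sp}_{2n}(\mathbb Z)\to \mathrm{Sp}_{2n}(\mathbb Z/N\mathbb Z))$. For $g=\begin{pmatrix}A&B\\C&D\end{pmatrix}\in \mathrm{GSp}_{2n}(\mathbb R)$ with similitude $\nu(g)>0$ put $gZ=(AZ+B)(CZ+D)^{-1}$. Let $M_\rho(\Gamma(N))$ be the space of holomorphic $f:\mathfrak H_n\to W_\rho$ with $\rho(CZ+D)^{-1}f(\gamma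 Z)=f(Z)$ for all $\gamma\in\Gamma(N)$. For Dirichlet characters $\chi=(\chi_1,\dots,\chi_n)$ modulo $N$, let $M_\rho(\Gamma(N),\chi)$ be the subspace of those $f$ with $\rho(CZ+D)^{-1}f(\gamma Z)=\chi_j(m)f(Z)$ whenever $1\le j\le n$, $m$ is prime to $N$, and $\gamma\in \mathrm{Sp}_{2n}(\mathbb Z)$ is congruent modulo $N$ to $\mathrm{diag}(m^{-1}1_j,1_{n-j},m1_j,1_{n-j})$. Let $\mathcal O\subset\mathbb C$ be the ring of integers of a number field containing all values of Dirichlet characters modulo $N$. Let $M_\rho(\Gamma(N),\chi,\mathcal O)$ be the $\mathcal O$-module of those $f\in M_\rho(\Gamma(N),\chi)$ for which all coefficients $a(T,f)$ of the Fourier expansion $f(Z)=\sum_T a(T,f)\exp(\frac{2\pi i}{N}\mathrm{tr}(TZ))$, where $T$ runs over the symmetric positive semidefinite half-integral $n\times n$ matrices, lie in $W_{\rho,0}(\mathcal O)=W_{\rho,0}\otimes_{\mathbb Z}\mathcal O$. For $m\ge 1$ prime to $N$ and a set $X$ of integral matrices $g\in \mathrm{GSp}_{2n}(\mathbb Q)$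 with $\nu(g)=m$ that is a finite union of cosets $\Gamma(N)g$ and satisfies $X\Gamma(N)=X$, put $$t(X)f(Z)=m^{\sum_j k_j-\frac{n(n+1)}2}\sum_{\gamma=\left(\begin{smallmatrix}A&B\\C&D\end{smallmatrix}\right)\in\Gamma(N)\backslash X}\rho(CZ+D)^{-1}f(\gamma Z).$$ For a prime $p\nmid N$ let $T(p)=t\big(\Gamma(N)\,\mathrm{diag}(1_n,p1_n)\,\Gamma(N)\big)$ and $T_{j,n-j}(p^2)=t\big(\Gamma(N)\,\mathrm{diag}(1_j,p1_{n-j},p^21_j,p1_{n-j})\,\Gamma(N)\big)$ for $0\le j\le n-1$. For $\delta\ge1$ let $T(p^\delta)=t(X)$, where $X$ is the set of all integral $g\in \mathrm{GSp}_{2n}(\mathbb Q)$ with $\nu(g)=p^\delta$ and $g\equiv \mathrm{diag}(1_n,p^\delta 1_n)\pmod N$. Put $e_1=\frac{(n-k_n)(n-k_n+1)}2$ if $k_n<n$ and $e_1=0$ otherwise, and $e_2=n(n-k_n+1)$ if $k_n\le n$ and $e_2=0$ otherwise. Then, for every prime $p\nmid N$: 1. the operators $T(p)$, $T(p^\delta)$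 ($\delta\ge 1$) and $T_{j,n-j}(p^2)$ ($0\le j\le n-1$) map $M_\rho(\Gamma(N),\chi)$ to itself; 2. $(p^{\delta})^{e_1}\,T(p^\delta)$ preserves $M_\rho(\Gamma(N),\chi,\mathcal O)$ for every $\delta\ge 1$; 3. $p^{e_2}\,T_{j,n-j}(p^2)$ preserves $M_\rho(\Gamma(N),\chi,\mathcal O)$ for every $0\le j\le n-1$. Moreover, every element of the $\mathbb Z$-subalgebra of $\mathrm{End}(M_\rho(\Gamma(N),\chi))$ generated by all $p^{e_1}T(p)$ and $p^{e_2}T_{j,n-j}(p^2)$ ($p\nmid N$ prime, $0\le j\le n-1$) preserves $M_\rho(\Gamma(N),\chi,\mathcal O)$. -/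

import Mathlib

open Matrix

noncomputable section

namespace SiegelHecke

/-! ### The Siegel upper half-space and integral symplectic similitudes -/

/-- The Siegel upper half-space of degree `n`, as a subset of `M_n(ℂ)`. -/
def upperHalfSet (n : ℕ) : Set (Matrix (Fin n) (Fin n) ℂ) :=
  {Z | Zᵀ = Z ∧ (Z.map Complex.im).PosDef}

/-- The Siegel upper half-space of degree `n`, as a type. -/
abbrev UpperHalf (n : ℕ) : Type := upperHalfSet n

/-- Integral `2n × 2n` matrices, in `n × n` blocks. -/
abbrev Mat2 (n : ℕ) : Type := Matrix (Fin n ⊕ Fin n) (Fin n ⊕ Fin n) ℤ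

/-- Integral matrices `g` in `GSp_{2n}(ℚ)` with similitude `ν(g) = m > 0`. -/
abbrev Similitude (n m : ℕ) : Type :=
  {g : Mat2 n // 0 < m ∧ gᵀ * J (Fin n) ℤ * g = (m : ℤ) • J (Fin n) ℤ}

/-- `Sp_{2n}(ℤ)`. -/
abbrev Sp (n : ℕ) : Type := symplecticGroup (Fin n) ℤ

/-- An element of `Sp_{2n}(ℤ)`, as an integral matrix of similitude `1`. -/
def Sp.toSimilitude {n : ℕ} (γ : Sp n) : Similitude n 1 :=
  ⟨γ, one_pos, by simpa using SymplecticGroup.mem_iff'.mp γ.2⟩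

/-- Reduction modulo `N` of elements of `Sp_{2n}(ℤ)`. -/
def reduceSp (n N : ℕ) : Sp n →* Matrix (Fin n ⊕ Fin n) (Fin n ⊕ Fin n) (ZMod N) :=
  ((Int.castRingHom (ZMod N)).mapMatrix (m := Fin n ⊕ Fin n)).toMonoidHom.comp
    (symplecticGroup (Fin n) ℤ).subtype

/-- The principal congruence subgroup `Γ(N)` of `Sp_{2n}(ℤ)`. -/
def Gam (n N : ℕ) : Subgroup (Sp n) := (reduceSp n N).ker

/-- `AZ + B` for `g = [A B; C D]`. -/
def numer {n : ℕ} (g : Mat2 n) (Z : Matrix (Fin n) (Fin n) ℂ) : Matrix (Fin n) (Fin n) ℂ :=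
  g.toBlocks₁₁.map (Int.cast : ℤ → ℂ) * Z + g.toBlocks₁₂.map (Int.cast : ℤ → ℂ)

/-- `CZ + D` for `g = [A B; C D]`. -/
def denom {n : ℕ} (g : Mat2 n) (Z : Matrix (Fin n) (Fin n) ℂ) : Matrix (Fin n) (Fin n) ℂ :=
  g.toBlocks₂₁.map (Int.cast : ℤ → ℂ) * Z + g.toBlocks₂₂.map (Int.cast : ℤ → ℂ)

theorem block_relations {n m : ℕ} (g : Similitude n m) (Z : Matrix (Fin n) (Fin n) ℂ)
    (Z' : Matrix (Fin n) (Fin n) ℂ) :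
    (numer g.1 Z')ᵀ * denom g.1 Z - (denom g.1 Z')ᵀ * numer g.1 Z = (m : ℂ) • (Z'ᵀ - Z) := by
  obtain ⟨g, hm, hg⟩ := g
  have h := congrArg (fun M : Mat2 n => M.map (Int.cast : ℤ → ℂ)) hg
  have h0 : (gᵀ * J (Fin n) ℤ * g).map (Int.cast : ℤ → ℂ) =
      (g.map (Int.cast : ℤ → ℂ))ᵀ * J (Fin n) ℂ * g.map (Int.cast : ℤ → ℂ) := by
    have e := (Int.castRingHom ℂ).mapMatrix.map_mul (gᵀ * J (Fin n) ℤ) g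
    have e' := (Int.castRingHom ℂ).mapMatrix.map_mul (gᵀ) (J (Fin n) ℤ)
    simp only [RingHom.mapMatrix_apply, Matrix.map_J] at e e'
    rw [e'] at e
    exact e
  have h1 : ((m : ℤ) • J (Fin n) ℤ).map (Int.cast : ℤ → ℂ) = (m : ℂ) • J (Fin n) ℂ := by
    have e := Matrix.map_J (l := Fin n) (Int.castRingHom ℂ)
    rw [← e]
    ext i j
    rw [Matrix.map_apply, Matrix.smul_apply, Matrix.smul_apply, Matrix.map_apply]
    simp
  simp only [h0, h1] at h
  have hb : g.map (Int.cast : ℤ → ℂ) = fromBlocks (g.toBlocks₁₁.map (Int.cast : ℤ → ℂ))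
      (g.toBlocks₁₂.map (Int.cast : ℤ → ℂ)) (g.toBlocks₂₁.map (Int.cast : ℤ → ℂ))
      (g.toBlocks₂₂.map (Int.cast : ℤ → ℂ)) := by
    rw [← fromBlocks_map, fromBlocks_toBlocks]
  rw [hb] at h
  simp only [numer, denom]
  generalize g.toBlocks₁₁.map (Int.cast : ℤ → ℂ) = A at *
  generalize g.toBlocks₁₂.map (Int.cast : ℤ → ℂ) = B at *
  generalize g.toBlocks₂₁.map (Int.cast : ℤ → ℂ) = C at *
  generalize g.toBlocks₂₂.map (Int.cast : ℤ → ℂ) = D at *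
  rw [J, fromBlocks_transpose, fromBlocks_multiply, fromBlocks_multiply, fromBlocks_smul,
    fromBlocks_inj] at h
  simp only [Matrix.mul_zero, Matrix.mul_one, Matrix.mul_neg, zero_add, add_zero,
    Matrix.neg_mul, smul_zero, smul_neg] at h
  obtain ⟨r1, r2, r3, r4⟩ := h
  have r1' : Cᵀ * A = Aᵀ * C := by rw [← sub_eq_zero, sub_eq_add_neg]; exact r1
  have r4' : Dᵀ * B = Bᵀ * D := by rw [← sub_eq_zero, sub_eq_add_neg]; exact r4
  have r2' : Cᵀ * B = Aᵀ * D - (m : ℂ) • 1 := by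
    have e := congrArg Neg.neg r2
    rw [neg_neg] at e
    rw [← e]; abel
  have r3' : Dᵀ * A = (m : ℂ) • 1 + Bᵀ * C := by rw [← r3]; abel
  simp only [transpose_add, transpose_mul, add_mul, mul_add, smul_sub]
  have t1 : Z'ᵀ * Cᵀ * (A * Z) = Z'ᵀ * Aᵀ * (C * Z) := by
    rw [show Z'ᵀ * Cᵀ * (A * Z) = Z'ᵀ * (Cᵀ * A) * Z by simp only [Matrix.mul_assoc], r1']
    simp only [Matrix.mul_assoc]
  have t2 : Z'ᵀ * Cᵀ * B = Z'ᵀ * Aᵀ * D - (m : ℂ) • Z'ᵀ := by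
    rw [Matrix.mul_assoc, r2', Matrix.mul_sub, Matrix.mul_smul, Matrix.mul_one, Matrix.mul_assoc]
  have t3 : Dᵀ * (A * Z) = (m : ℂ) • Z + Bᵀ * (C * Z) := by
    rw [← Matrix.mul_assoc, r3', add_mul, smul_mul_assoc, Matrix.one_mul, Matrix.mul_assoc]
  rw [t1, t2, t3, r4']
  abel

theorem re_form_pos {n : ℕ} {Y : Matrix (Fin n) (Fin n) ℝ} (hY : Y.PosDef) {u : Fin n → ℂ}
    (hu : u ≠ 0) : 0 < (star u ⬝ᵥ (Y.map Complex.ofReal) *ᵥ u).re := by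
  have key : (star u ⬝ᵥ (Y.map Complex.ofReal) *ᵥ u).re =
      (fun i => (u i).re) ⬝ᵥ Y *ᵥ (fun i => (u i).re) +
      (fun i => (u i).im) ⬝ᵥ Y *ᵥ (fun i => (u i).im) := by
    simp only [dotProduct, mulVec, Finset.mul_sum, Complex.re_sum, ← Finset.sum_add_distrib]
    refine Finset.sum_congr rfl fun i _ => Finset.sum_congr rfl fun j _ => ?_
    simp
  have nn : ∀ x : Fin n → ℝ, 0 ≤ x ⬝ᵥ Y *ᵥ x := fun x => by
    simpa using hY.posSemidef.dotProduct_mulVec_nonneg x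
  rw [key]
  by_cases h : (fun i => (u i).re) = 0
  · have h' : (fun i => (u i).im) ≠ 0 := fun h' => hu (by
      ext i
      exact Complex.ext (congrFun h i) (congrFun h' i))
    have := hY.dotProduct_mulVec_pos h'
    simp only [star_trivial] at this
    linarith [nn (fun i => (u i).re)]
  · have := hY.dotProduct_mulVec_pos h
    simp only [star_trivial] at this
    linarith [nn (fun i => (u i).im)]

theorem form_relation {n m : ℕ} (g : Similitude n m) (Z : UpperHalf n) (u : Fin n → ℂ) :
    (star (denom g.1 Z *ᵥ u) ⬝ᵥ (numer g.1 Z *ᵥ u)).im =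
      m * (star u ⬝ᵥ ((Z.1.map Complex.im).map Complex.ofReal) *ᵥ u).re := by
  obtain ⟨Z, hZ, hpos⟩ := Z
  have hc : ∀ M : Matrix (Fin n) (Fin n) ℤ,
      ((M.map (Int.cast : ℤ → ℂ)).map star) = M.map (Int.cast : ℤ → ℂ) := fun M => by
    ext i j; simp
  have hmul : ∀ M L : Matrix (Fin n) (Fin n) ℂ, (M * L).map star = M.map star * L.map star :=
    fun M L => Matrix.map_mul (f := starRingEnd ℂ)
  have hn : (numer g.1 (Z.map star))ᵀ = (numer g.1 Z)ᴴ := by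
    rw [conjTranspose, transpose_map, numer, numer, Matrix.map_add _ (by simp), hmul, hc, hc]
  have hd : (denom g.1 (Z.map star))ᵀ = (denom g.1 Z)ᴴ := by
    rw [conjTranspose, transpose_map, denom, denom, Matrix.map_add _ (by simp), hmul, hc, hc]
  have h := block_relations g Z (Z.map star)
  rw [hn, hd] at h
  have hY : (Z.map star)ᵀ - Z = (-2 * Complex.I) • (Z.map Complex.im).map Complex.ofReal := by
    rw [← transpose_map, hZ]
    ext i j
    apply Complex.ext <;> simp <;> ring
  rw [hY, smul_smul] at h
  have h2 := congrArg (fun M => (star u ⬝ᵥ M *ᵥ u).im) h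
  simp only [sub_mulVec, dotProduct_sub, Complex.sub_im, smul_mulVec, dotProduct_smul] at h2
  have e1 : star u ⬝ᵥ ((denom g.1 Z)ᴴ * numer g.1 Z) *ᵥ u =
      star (denom g.1 Z *ᵥ u) ⬝ᵥ (numer g.1 Z *ᵥ u) := by
    rw [star_mulVec, ← dotProduct_mulVec, mulVec_mulVec]
  have e2 : star u ⬝ᵥ ((numer g.1 Z)ᴴ * denom g.1 Z) *ᵥ u =
      star (star (denom g.1 Z *ᵥ u) ⬝ᵥ (numer g.1 Z *ᵥ u)) := by
    rw [← star_dotProduct_star, star_star, star_mulVec, ← dotProduct_mulVec, mulVec_mulVec]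
  rw [e1, e2] at h2
  have e3 : ∀ c : ℂ, (((m : ℂ) * (-2 * Complex.I)) • c).im = -2 * (m * c.re) := fun c => by
    simp; ring
  rw [e3] at h2
  have e4 : ∀ c : ℂ, (star c).im = - c.im := fun c => by simp
  rw [e4] at h2
  linarith

theorem denom_det_ne_zero {n m : ℕ} (g : Similitude n m) (Z : UpperHalf n) :
    (denom g.1 Z).det ≠ 0 := by
  intro h
  obtain ⟨u, hu, hu0⟩ := exists_mulVec_eq_zero_iff.mpr h
  have h1 := form_relation g Z u
  rw [hu0] at h1
  simp only [star_zero, zero_dotProduct, Complex.zero_im] at h1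
  have := mul_pos (Nat.cast_pos.mpr g.2.1 : (0 : ℝ) < m) (re_form_pos Z.2.2 hu)
  linarith

theorem moebius_mem {n m : ℕ} (g : Similitude n m) (Z : UpperHalf n) :
    numer g.1 Z * (denom g.1 Z)⁻¹ ∈ upperHalfSet n := by
  have hu : IsUnit (denom g.1 Z).det := (denom_det_ne_zero g Z).isUnit
  have hsym : (numer g.1 Z * (denom g.1 Z)⁻¹)ᵀ = numer g.1 Z * (denom g.1 Z)⁻¹ := by
    have h := block_relations g Z Z.1
    rw [Z.2.1, sub_self, smul_zero, sub_eq_zero] at h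
    have hut : IsUnit (denom g.1 Z)ᵀ.det := by rwa [det_transpose]
    rw [transpose_mul, transpose_nonsing_inv]
    calc ((denom g.1 Z)ᵀ)⁻¹ * (numer g.1 Z)ᵀ
        = ((denom g.1 Z)ᵀ)⁻¹ * ((numer g.1 Z)ᵀ * denom g.1 Z) * (denom g.1 Z)⁻¹ := by
          rw [Matrix.mul_assoc, mul_nonsing_inv_cancel_right _ _ hu]
      _ = _ := by
          rw [h, nonsing_inv_mul_cancel_left _ _ hut]
  refine ⟨hsym, ?_⟩
  refine PosDef.of_dotProduct_mulVec_pos ?_ ?_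
  · rw [IsHermitian, conjTranspose_eq_transpose_of_trivial, ← transpose_map, hsym]
  · intro v hv
    set vc : Fin n → ℂ := fun i => (v i : ℂ) with hvc
    set u : Fin n → ℂ := (denom g.1 Z)⁻¹ *ᵥ vc with hudef
    have hv' : denom g.1 Z *ᵥ u = vc := by
      rw [hudef, mulVec_mulVec, mul_nonsing_inv _ hu, one_mulVec]
    have hu0 : u ≠ 0 := by
      intro h0
      rw [h0, mulVec_zero] at hv'
      exact hv (funext fun i => by simpa [hvc] using (congrFun hv' i).symm)
    have h := form_relation g Z u
    have e : (star v ⬝ᵥ ((numer g.1 Z * (denom g.1 Z)⁻¹).map Complex.im) *ᵥ v) =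
        (star (denom g.1 Z *ᵥ u) ⬝ᵥ (numer g.1 Z *ᵥ u)).im := by
      rw [hv', hudef, mulVec_mulVec]
      simp [dotProduct, mulVec, hvc, Finset.mul_sum, Complex.im_sum]
    rw [e, h]
    exact mul_pos (Nat.cast_pos.mpr g.2.1) (re_form_pos Z.2.2 hu0)

/-- The action `gZ = (AZ + B)(CZ + D)⁻¹` on the Siegel upper half-space. -/
def moebius {n m : ℕ} (g : Similitude n m) (Z : UpperHalf n) : UpperHalf n :=
  ⟨numer g.1 Z * (denom g.1 Z)⁻¹, moebius_mem g Z⟩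

/-- The automorphy factor `CZ + D`, as an element of `GL_n(ℂ)`. -/
def autFactor {n m : ℕ} (g : Similitude n m) (Z : UpperHalf n) : GL (Fin n) ℂ :=
  GeneralLinearGroup.mkOfDetNeZero (denom g.1 Z) (denom_det_ne_zero g Z)

/-! ### The representation and its integral form -/

section Representations

variable {n : ℕ} {W : Type*} [AddCommGroup W] [Module ℂ W]

/-- The diagonal element of `GL_n(ℂ)` with entries `t`. -/
def torus (t : Fin n → ℂˣ) : GL (Fin n) ℂ :=
  Units.map (Matrix.diagonalRingHom (Fin n) ℂ).toMonoidHom (MulEquiv.piUnits.symm t)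

/-- `k` is the highest weight of `ρ`, for the Borel subgroup of upper triangular matrices:
`k₁ ≥ ⋯ ≥ kₙ`, and some nonzero vector of weight `k` is fixed by all upper triangular
unipotent matrices. -/
def HasHighestWeight (ρ : Representation ℂ (GL (Fin n) ℂ) W) (k : Fin n → ℤ) : Prop :=
  Antitone k ∧ ∃ v : W, v ≠ 0 ∧
    (∀ t : Fin n → ℂˣ, ρ (torus t) v = ((∏ i, t i ^ k i : ℂˣ) : ℂ) • v) ∧
    ∀ u : GL (Fin n) ℂ, (∀ i, u i i = 1) → (∀ i j, j < i → u i j = 0) → ρ u v = v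

/-- `W₀` is a `ℤ`-form of the `GL_n`-representation `ρ`: it is the `ℤ`-span of a `ℂ`-basis of `W`
in which the matrix coefficients of `ρ` lie in the coordinate ring `ℤ[x_ij, det⁻¹]` of the group
scheme `GL_n` over `ℤ`. Equivalently, `W₀ ⊗ ℂ = W`, and the action of `GL_n(ℂ)` comes from
actions of `GL_n(R)` on `W₀ ⊗ R`, functorial in the commutative ring `R`. In particular `ρ` is
algebraic, and `GL_n(ℤ)` preserves `W₀`. -/
def IsIntegralForm (ρ : Representation ℂ (GL (Fin n) ℂ) W) (W₀ : Submodule ℤ W) : Prop :=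
  ∃ (d : ℕ) (b : Module.Basis (Fin d) ℂ W), W₀ = Submodule.span ℤ (Set.range b) ∧
    ∃ (e : ℕ) (P : Matrix (Fin d) (Fin d) (MvPolynomial (Fin n × Fin n) ℤ)),
      ∀ (g : GL (Fin n) ℂ) (i j : Fin d),
        (g : Matrix (Fin n) (Fin n) ℂ).det ^ e * LinearMap.toMatrix b b (ρ g) i j =
          MvPolynomial.aeval (fun q : Fin n × Fin n => g q.1 q.2) (P i j)

/-- `W₀(O) = W₀ ⊗ O`, as the `O`-span of the lattice `W₀` in `W`. -/
def latticeOver (W₀ : Submodule ℤ W) (O : Subring ℂ) : Submodule O W :=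
  Submodule.span O (W₀ : Set W)

end Representations

/-- The ring of integers of a subfield `K` of `ℂ`, as a subring of `ℂ`. -/
def integersOf (K : IntermediateField ℚ ℂ) : Subring ℂ :=
  (integralClosure ℤ ℂ).toSubring ⊓ K.toSubfield.toSubring

/-! ### Vector-valued Siegel modular forms -/

section Forms

variable {n : ℕ} {W : Type*} [NormedAddCommGroup W] [NormedSpace ℂ W]

/-- `(f|_ρ γ)(Z) = ρ(CZ + D)⁻¹ f(γZ)`, without power of `ν(γ)`, as a linear operator in `f`. -/
def slash (ρ : Representation ℂ (GL (Fin n) ℂ) W) {m : ℕ} (g : Similitude n m) :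
    Module.End ℂ (UpperHalf n → W) where
  toFun f := fun Z => ρ (autFactor g Z)⁻¹ (f (moebius g Z))
  map_add' f f' := by ext Z; simp
  map_smul' c f := by ext Z; simp

/-- Holomorphy of a function on the Siegel upper half-space, an open subset of the space of
symmetric complex matrices (the extension by zero to `M_n(ℂ)` is only looked at on the half-space;
a complex linear derivative on symmetric matrices extends to `M_n(ℂ)`). -/
def IsHolomorphic (f : UpperHalf n → W) : Prop :=
  DifferentiableOn ℂ (Function.extend Subtype.val f 0) (upperHalfSet n)

theorem IsHolomorphic.add {f g : UpperHalf n → W} (hf : IsHolomorphic f) (hg : IsHolomorphic g) :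
    IsHolomorphic (f + g) := by
  let _ : NormedAddCommGroup (Matrix (Fin n) (Fin n) ℂ) := Matrix.normedAddCommGroup
  let _ : NormedSpace ℂ (Matrix (Fin n) (Fin n) ℂ) := Matrix.normedSpace
  refine (DifferentiableOn.add hf hg).congr fun Z hZ => ?_
  have h : ∀ φ : UpperHalf n → W, Function.extend Subtype.val φ 0 Z = φ ⟨Z, hZ⟩ := fun φ =>
    Subtype.val_injective.extend_apply φ 0 ⟨Z, hZ⟩
  simp [h]

theorem IsHolomorphic.smul {f : UpperHalf n → W} (c : ℂ) (hf : IsHolomorphic f) :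
    IsHolomorphic (c • f) := by
  let _ : NormedAddCommGroup (Matrix (Fin n) (Fin n) ℂ) := Matrix.normedAddCommGroup
  let _ : NormedSpace ℂ (Matrix (Fin n) (Fin n) ℂ) := Matrix.normedSpace
  refine (DifferentiableOn.const_smul hf c).congr fun Z hZ => ?_
  have h : ∀ φ : UpperHalf n → W, Function.extend Subtype.val φ 0 Z = φ ⟨Z, hZ⟩ := fun φ =>
    Subtype.val_injective.extend_apply φ 0 ⟨Z, hZ⟩
  simp [h]

theorem IsHolomorphic.zero : IsHolomorphic (0 : UpperHalf n → W) := by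
  have h := differentiableOn_const (𝕜 := ℂ) (s := upperHalfSet n) (0 : W)
  refine h.congr fun Z hZ => ?_
  exact Subtype.val_injective.extend_apply (0 : UpperHalf n → W) 0 ⟨Z, hZ⟩

/-- `M_ρ(Γ(N))`, the Siegel modular forms of type `ρ` and level `Γ(N)`. -/
def modularForms (ρ : Representation ℂ (GL (Fin n) ℂ) W) (N : ℕ) :
    Submodule ℂ (UpperHalf n → W) where
  carrier := {f | IsHolomorphic f ∧ ∀ γ ∈ Gam n N, slash ρ (Sp.toSimilitude γ) f = f}
  add_mem' hf hg := ⟨hf.1.add hg.1, fun γ hγ => by rw [map_add, hf.2 γ hγ, hg.2 γ hγ]⟩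
  zero_mem' := ⟨IsHolomorphic.zero, fun γ _ => map_zero _⟩
  smul_mem' c f hf := ⟨hf.1.smul c, fun γ hγ => by rw [map_smul, hf.2 γ hγ]⟩

/-- `γ` is congruent modulo `N` to the diagonal matrix
`diag(a⁻¹, …, a⁻¹, 1, …, 1, a, …, a, 1, …, 1)` with blocks of sizes `j, n - j, j, n - j`,
where the one-based `j` is the zero-based `j : Fin n`. -/
def IsDiagLift (N : ℕ) (j : Fin n) (a : (ZMod N)ˣ) (γ : Sp n) : Prop :=
  reduceSp n N γ = Matrix.diagonal
    (Sum.elim (fun i : Fin n => if i ≤ j then ((a⁻¹ : (ZMod N)ˣ) : ZMod N) else 1)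
      (fun i : Fin n => if i ≤ j then (a : ZMod N) else 1))

/-- `M_ρ(Γ(N), χ)`: the forms `f` in `M_ρ(Γ(N))` with `f|_ρ g_j(a) = χ_j(a) f` for all `j` and
all classes `a` prime to `N`, where `g_j(a)` is any lift to `Sp_{2n}(ℤ)` of the diagonal matrix
in `IsDiagLift` (the choice of the lift does not matter, `Γ(N)` being normal). -/
def modularFormsChar (ρ : Representation ℂ (GL (Fin n) ℂ) W) (N : ℕ)
    (χ : Fin n → DirichletCharacter ℂ N) : Submodule ℂ (UpperHalf n → W) where
  carrier := {f | f ∈ modularForms ρ N ∧ ∀ (j : Fin n) (a : (ZMod N)ˣ) (γ : Sp n),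
    IsDiagLift N j a γ → slash ρ (Sp.toSimilitude γ) f = χ j a • f}
  add_mem' hf hg := ⟨add_mem hf.1 hg.1, fun j a γ h => by
    rw [map_add, hf.2 j a γ h, hg.2 j a γ h, smul_add]⟩
  zero_mem' := ⟨zero_mem _, fun j a γ _ => by rw [map_zero, smul_zero]⟩
  smul_mem' c f hf := ⟨Submodule.smul_mem _ c hf.1, fun j a γ h => by
    rw [map_smul, hf.2 j a γ h, smul_comm]⟩

/-- The symmetric positive semidefinite half-integral `n × n` matrices. -/
def HalfIntegral (n : ℕ) : Type :=
  {T : Matrix (Fin n) (Fin n) ℝ // T.PosSemidef ∧ (∀ i, ∃ c : ℤ, T i i = c) ∧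
    ∀ i j, ∃ c : ℤ, 2 * T i j = c}

/-- `exp(2πi tr(TZ) / N)`. -/
def fourierTerm (N : ℕ) (T : HalfIntegral n) (Z : UpperHalf n) : ℂ :=
  Complex.exp (2 * Real.pi * Complex.I * (1 / N) * (T.1.map Complex.ofReal * Z.1).trace)

/-- `a` is the family of Fourier coefficients of `f` at level `N`:
`f(Z) = ∑_T a(T) exp(2πi tr(TZ) / N)` for all `Z`. -/
def HasFourierExpansion (N : ℕ) (f : UpperHalf n → W) (a : HalfIntegral n → W) : Prop :=
  ∀ Z, HasSum (fun T => fourierTerm N T Z • a T) (f Z)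

/-- `M_ρ(Γ(N), χ, O)`, the `O`-module of forms in `M_ρ(Γ(N), χ)` all of whose Fourier coefficients
lie in `W₀(O)`. -/
def integralFormsChar (ρ : Representation ℂ (GL (Fin n) ℂ) W) (N : ℕ)
    (χ : Fin n → DirichletCharacter ℂ N) (W₀ : Submodule ℤ W) (O : Subring ℂ) :
    Submodule O (UpperHalf n → W) where
  carrier := {f | f ∈ modularFormsChar ρ N χ ∧
    ∃ a : HalfIntegral n → W, HasFourierExpansion N f a ∧ ∀ T, a T ∈ latticeOver W₀ O}
  add_mem' := by
    rintro f g ⟨hf, a, ha, ha'⟩ ⟨hg, b, hb, hb'⟩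
    refine ⟨add_mem hf hg, a + b, fun Z => ?_, fun T => add_mem (ha' T) (hb' T)⟩
    simpa only [Pi.add_apply, smul_add] using (ha Z).add (hb Z)
  zero_mem' := ⟨zero_mem _, 0, fun Z => by simp, fun T => zero_mem _⟩
  smul_mem' := by
    rintro c f ⟨hf, a, ha, ha'⟩
    refine ⟨Submodule.smul_mem _ (c : ℂ) hf, fun T => c • a T, fun Z => ?_,
      fun T => Submodule.smul_mem _ c (ha' T)⟩
    have h := (ha Z).const_smul (c : ℂ)
    simp only [smul_comm (c : ℂ)] at h
    exact h

/-! ### Hecke operators -/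

/-- Left cosets `Γ(N) \ X`, for a set `X` of integral matrices of similitude `m`: `x ∼ γx` for
`γ ∈ Γ(N)`. -/
def cosetSetoid (N : ℕ) {m : ℕ} (X : Set (Similitude n m)) : Setoid X :=
  (MulAction.orbitRel (Gam n N) (Mat2 n)).comap fun x => x.1.1

/-- The operator `f ↦ m^{∑ k_j - n(n+1)/2} ∑_{γ ∈ Γ(N) \ X} ρ(CZ + D)⁻¹ f(γZ)`, for a set `X` of
integral matrices of similitude `m` that is a finite union of cosets `Γ(N)g`. On forms of level
`Γ(N)` it does not depend on the representatives. -/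
def heckeOp (ρ : Representation ℂ (GL (Fin n) ℂ) W) (k : Fin n → ℤ) (N : ℕ) {m : ℕ}
    (X : Set (Similitude n m)) : Module.End ℂ (UpperHalf n → W) :=
  ((m : ℂ) ^ ((∑ j, k j) - (n : ℤ) * (n + 1) / 2)) •
    ∑ᶠ c : Quotient (cosetSetoid N X), slash ρ c.out.1

/-- The double coset `Γ(N) g Γ(N)` of an integral matrix `g` of similitude `m`. -/
def doubleCoset (N m : ℕ) (g : Mat2 n) : Set (Similitude n m) :=
  {x | ∃ γ ∈ Gam n N, ∃ γ' ∈ Gam n N, x.1 = (γ : Mat2 n) * g * (γ' : Mat2 n)}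

/-- The set `S̄_m(N)` of the integral matrices of similitude `m` that are congruent to
`[1 0; 0 m]` modulo `N`. -/
def congruenceSet (n N m : ℕ) : Set (Similitude n m) :=
  {x | x.1.map (Int.cast : ℤ → ZMod N) =
    (fromBlocks 1 0 0 ((m : ℤ) • 1) : Mat2 n).map (Int.cast : ℤ → ZMod N)}

/-- `diag(1_n, p 1_n)`. -/
def heckeMatrix₁ (n p : ℕ) : Mat2 n :=
  Matrix.diagonal (Sum.elim (fun _ => 1) (fun _ => (p : ℤ)))

/-- `diag(1_j, p 1_{n-j}, p² 1_j, p 1_{n-j})`. -/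
def heckeMatrix₂ (n p j : ℕ) : Mat2 n :=
  Matrix.diagonal (Sum.elim (fun i : Fin n => if (i : ℕ) < j then 1 else (p : ℤ))
    (fun i : Fin n => if (i : ℕ) < j then (p : ℤ) ^ 2 else (p : ℤ)))

/-- `T(p)`. -/
def heckeT (ρ : Representation ℂ (GL (Fin n) ℂ) W) (k : Fin n → ℤ) (N p : ℕ) :
    Module.End ℂ (UpperHalf n → W) :=
  heckeOp ρ k N (doubleCoset N p (heckeMatrix₁ n p))

/-- `T(p^δ)`, the sum of the operators of all double cosets in `S̄_{p^δ}(N)`. -/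
def heckeTPow (ρ : Representation ℂ (GL (Fin n) ℂ) W) (k : Fin n → ℤ) (N p δ : ℕ) :
    Module.End ℂ (UpperHalf n → W) :=
  heckeOp ρ k N (congruenceSet n N (p ^ δ))

/-- `T_{j,n-j}(p²)`. -/
def heckeTSq (ρ : Representation ℂ (GL (Fin n) ℂ) W) (k : Fin n → ℤ) (N p j : ℕ) :
    Module.End ℂ (UpperHalf n → W) :=
  heckeOp ρ k N (doubleCoset N (p ^ 2) (heckeMatrix₂ n p j))

/-- The exponent `δ(kₙ < n) (n - kₙ)(n - kₙ + 1) / 2`. -/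
def exponent₁ (n : ℕ) (kn : ℤ) : ℤ :=
  if kn < n then (n - kn) * (n - kn + 1) / 2 else 0

/-- The exponent `δ(kₙ ≤ n) n(n - kₙ + 1)`. -/
def exponent₂ (n : ℕ) (kn : ℤ) : ℤ :=
  if kn ≤ n then n * (n - kn + 1) else 0

/-- The `ℤ`-subalgebra of `End(M_ρ(Γ(N), χ))` generated by the normalized operators `T(p)` and
`T_{j,n-j}(p²)`, for primes `p ∤ N` and `0 ≤ j ≤ n - 1`; here `kn` is the last entry of `k`. -/
def heckeAlgebra (ρ : Representation ℂ (GL (Fin n) ℂ) W) (k : Fin n → ℤ) (kn : ℤ) (N : ℕ)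
    (χ : Fin n → DirichletCharacter ℂ N) :
    Subalgebra ℤ (Module.End ℂ (modularFormsChar ρ N χ)) :=
  Algebra.adjoin ℤ
    ({φ | ∃ p : ℕ, p.Prime ∧ ¬ p ∣ N ∧ ∀ f : modularFormsChar ρ N χ,
        (φ f : UpperHalf n → W) = ((p : ℂ) ^ exponent₁ n kn) • heckeT ρ k N p f} ∪
      {φ | ∃ p : ℕ, p.Prime ∧ ¬ p ∣ N ∧ ∃ j : ℕ, j < n ∧ ∀ f : modularFormsChar ρ N χ,
        (φ f : UpperHalf n → W) = ((p : ℂ) ^ exponent₂ n kn) • heckeTSq ρ k N p j f})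

end Forms

end SiegelHecke
end

noncomputable section

namespace SiegelHecke

/-! ### Weights and integrality of the representation -/

section Weights

variable {n : ℕ} {W : Type*} [AddCommGroup W] [Module ℂ W]

/-! That the operators act on `M_ρ(Γ(N), χ)` is formal: each defining set is stable under both
translations by `Γ(N)` and under conjugation by symplectic matrices that are diagonal modulo `N`
(`IsHeckeSet`), so these only permute the cosets in the sum.

Integrality is a computation with Fourier coefficients. Let `m = p^δ`. Every coset of the Hecke set
has a representative `γh`, with `γ` diagonal modulo `N` and `h = [A NB; 0 D]`, `Aᵀ D = m`
(`exists_isUpper_lmul`). The form `f` is an eigenfunction of `γ`, with eigenvalue a unit of `O`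
depending only on `A`. Put `S = B Aᵀ`, a symmetric matrix that matters only modulo `m`. Then `hZ =
m⁻¹ (A Z Aᵀ + N S)`, and `ρ(D)⁻¹` is `m^(-∑ k_j) ρ(Aᵀ)`, because scalar matrices act through the
central character. Up to the unit, the cosets with a fixed `A` therefore send the coefficient `a(T)`
to `m^(-n(n+1)/2) (∑_S e(tr(TS)/m)) ρ(Aᵀ) a(T)`, placed at the index `m⁻¹ Aᵀ T A`. The set of the
`S` is stable under adding `A R Aᵀ` with `R` symmetric, so the sum vanishes unless this index is
half-integral.

Three facts compensate the negative power of `m`. (1) `ρ(Aᵀ)` maps the lattice into `det(A)^kₙ`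
times itself (`intGL_latticeOver`). By Smith normal form this reduces to `diag(1, …, s, …, 1)`,
whose matrix coefficients are divisible by `s^kₙ`: this holds on the orbit of the highest weight
vector, hence on all of `W`. (2) The set of the `S` modulo `m` is stable under multiplication by
units and under addition of a large subgroup `H`. Its exponential sum is then `|H|` times an integer
(`charSum_eq_card_mul`): it is zero or `|H|` times an algebraic integer, and unit stability makes it
rational. If `A` has elementary divisors `p^ε_i`, then `H` has order `p^∑(δ - max(ε_i, ε_j))` for
the set defining `T(p^δ)`, and `p^∑(δ - (ε_i + ε_j))` with truncated subtraction for the double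
cosets, the sums running over `i ≤ j`. (3) The exponents of (1), (2) and the normalizing power of
`p` together outweigh `δ n(n+1)/2` (`exponent₁_inequality`, `exponent₂_inequality`). -/

theorem eq_top_of_invariant {ρ : Representation ℂ (GL (Fin n) ℂ) W} (hρ : ρ.IsIrreducible)
    (V : Submodule ℂ W) (hV : ∀ g, ∀ w ∈ V, ρ g w ∈ V) {v : W} (hv : v ∈ V) (hv0 : v ≠ 0) :
    V = ⊤ := by
  let V' : Subrepresentation ρ := ⟨V, fun g w hw => hV g w hw⟩
  rcases hρ.eq_bot_or_eq_top V' with h | h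
  · have h' : v ∈ V' := hv
    rw [h] at h'
    exact absurd h' hv0
  · exact congrArg Subrepresentation.toSubmodule h

theorem central_acts_by_scalar [FiniteDimensional ℂ W] {ρ : Representation ℂ (GL (Fin n) ℂ) W}
    (hρ : ρ.IsIrreducible) {z : GL (Fin n) ℂ} (hz : ∀ g, g * z = z * g) {c : ℂ} {v : W}
    (hv : v ≠ 0) (hzv : ρ z v = c • v) (w : W) : ρ z w = c • w := by
  have h := eq_top_of_invariant hρ (Module.End.eigenspace (ρ z) c) (fun g w hw => by
    rw [Module.End.mem_eigenspace_iff] at hw ⊢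
    rw [← Module.End.mul_apply, ← map_mul, ← hz, map_mul, Module.End.mul_apply, hw, map_smul])
    (Module.End.mem_eigenspace_iff.mpr hzv) hv
  exact Module.End.mem_eigenspace_iff.mp (h ▸ Submodule.mem_top : w ∈ _)

@[simp] theorem coe_torus (t : Fin n → ℂˣ) :
    ((torus t : GL (Fin n) ℂ) : Matrix (Fin n) (Fin n) ℂ) =
      Matrix.diagonal fun i => (t i : ℂ) := by
  rfl

/-- The matrix coefficients of `ρ` in the basis `b` are `P / det ^ e`. -/
def HasCoefficients {d : ℕ} (ρ : Representation ℂ (GL (Fin n) ℂ) W) (b : Module.Basis (Fin d) ℂ W)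
    (e : ℕ) (P : Matrix (Fin d) (Fin d) (MvPolynomial (Fin n × Fin n) ℤ)) : Prop :=
  ∀ (g : GL (Fin n) ℂ) (i j : Fin d),
    (g : Matrix (Fin n) (Fin n) ℂ).det ^ e * LinearMap.toMatrix b b (ρ g) i j =
      MvPolynomial.aeval (fun q : Fin n × Fin n => g q.1 q.2) (P i j)

variable {d : ℕ} {ρ : Representation ℂ (GL (Fin n) ℂ) W} {b : Module.Basis (Fin d) ℂ W} {e : ℕ}
  {P : Matrix (Fin d) (Fin d) (MvPolynomial (Fin n × Fin n) ℤ)}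

theorem HasCoefficients.repr (h : HasCoefficients ρ b e P) (g : GL (Fin n) ℂ) (w : W)
    (i : Fin d) : (g : Matrix (Fin n) (Fin n) ℂ).det ^ e * b.repr (ρ g w) i =
      ∑ j, MvPolynomial.aeval (fun q : Fin n × Fin n => g q.1 q.2) (P i j) * b.repr w j := by
  have h1 : b.repr (ρ g w) i = ∑ j, LinearMap.toMatrix b b (ρ g) i j * b.repr w j := by
    rw [← LinearMap.toMatrix_mulVec_repr b b]
    rfl
  rw [h1, Finset.mul_sum]
  refine Finset.sum_congr rfl fun j _ => ?_
  rw [← h g i j, mul_assoc]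

/-- Along a polynomial family of matrices the coefficients of `ρ` become polynomials in one
variable, so that an identity valid for infinitely many parameters extends to all of them. -/
theorem HasCoefficients.polynomial (h : HasCoefficients ρ b e P)
    (M : Matrix (Fin n) (Fin n) (Polynomial ℂ)) (w : W) (i : Fin d) :
    ∃ q : Polynomial ℂ, ∀ (s : ℂ) (g : GL (Fin n) ℂ), (∀ r c, g r c = (M r c).eval s) →
      (g : Matrix (Fin n) (Fin n) ℂ).det ^ e * b.repr (ρ g w) i = q.eval s := by
  refine ⟨∑ j, MvPolynomial.aeval (fun q : Fin n × Fin n => M q.1 q.2) (P i j) *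
    Polynomial.C (b.repr w j), fun s g hg => ?_⟩
  rw [h.repr, Polynomial.eval_finsetSum]
  refine Finset.sum_congr rfl fun j _ => ?_
  rw [Polynomial.eval_mul, Polynomial.eval_C]
  congr 1
  have := MvPolynomial.map_aeval (fun q : Fin n × Fin n => M q.1 q.2)
    (Polynomial.evalRingHom s) (P i j)
  rw [Polynomial.coe_evalRingHom] at this
  rw [this, MvPolynomial.aeval_def, MvPolynomial.coe_eval₂Hom]
  congr 1
  · exact RingHom.ext_int _ _
  · funext q
    exact hg q.1 q.2

/-- The one-parameter subgroup `diag(1, …, s, …, 1)` with `s` in position `l`. -/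
abbrev coroot (l : Fin n) (s : ℂˣ) : GL (Fin n) ℂ := torus (Pi.mulSingle l s)

theorem det_coroot (l : Fin n) (s : ℂˣ) :
    (coroot l s : Matrix (Fin n) (Fin n) ℂ).det = s := by
  have h : ∀ i, ((Pi.mulSingle l s : Fin n → ℂˣ) i : ℂ) = if i = l then (s : ℂ) else 1 :=
    fun i => by
      by_cases hi : i = l
      · subst hi; simp
      · simp [hi]
  rw [coe_torus, Matrix.det_diagonal]
  simp [h]

/-- The vectors on which `coroot l s` acts by `s ^ k` times a polynomial in `s`. -/
def boundedBelow (ρ : Representation ℂ (GL (Fin n) ℂ) W) (b : Module.Basis (Fin d) ℂ W)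
    (l : Fin n) (k : ℤ) : Submodule ℂ W where
  carrier := {w | ∀ i, ∃ q : Polynomial ℂ, ∀ s : ℂˣ,
    b.repr (ρ (coroot l s) w) i = (s : ℂ) ^ k * q.eval (s : ℂ)}
  add_mem' hw hw' i := by
    obtain ⟨q, hq⟩ := hw i
    obtain ⟨q', hq'⟩ := hw' i
    exact ⟨q + q', fun s => by simp [hq, hq', mul_add]⟩
  zero_mem' i := ⟨0, fun s => by simp⟩
  smul_mem' c w hw i := by
    obtain ⟨q, hq⟩ := hw i
    exact ⟨Polynomial.C c * q, fun s => by simp [hq]; ring⟩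

variable {l : Fin n} {k : ℤ} {v : W}

/-- With `t = coroot l s`, one has `ρ(t) ρ(g) v = s^k ρ(t g t⁻¹) v`. Conjugation by `t` multiplies
row `l` off the diagonal by `s`, and column `l` off the diagonal by `s⁻¹`. The latter entries
vanish, so `t g t⁻¹` is polynomial in `s`, with constant determinant. -/
theorem mem_boundedBelow_of_col (h : HasCoefficients ρ b e P)
    (hv : ∀ s, ρ (coroot l s) v = ((s : ℂ) ^ k) • v) (g : GL (Fin n) ℂ)
    (hg : ∀ i, i ≠ l → g i l = 0) : ρ g v ∈ boundedBelow ρ b l k := by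
  intro i
  obtain ⟨q, hq⟩ := h.polynomial
    (Matrix.of fun r c => Polynomial.C (g r c) * if r = l ∧ c ≠ l then Polynomial.X else 1) v i
  have hd : (g : Matrix (Fin n) (Fin n) ℂ).det ≠ 0 := g.det.ne_zero
  refine ⟨Polynomial.C ((g : Matrix (Fin n) (Fin n) ℂ).det ^ e)⁻¹ * q, fun s => ?_⟩
  set t := coroot l s with ht
  have h1 : ρ t (ρ g v) = ((s : ℂ) ^ k) • ρ (t * g * t⁻¹) v := by
    rw [← map_smul, ← hv s, ← ht, ← Module.End.mul_apply, ← Module.End.mul_apply, ← map_mul,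
      ← map_mul, inv_mul_cancel_right]
  have hti : ((t⁻¹ : GL (Fin n) ℂ) : Matrix (Fin n) (Fin n) ℂ) =
      Matrix.diagonal fun i => (((Pi.mulSingle l s⁻¹ : Fin n → ℂˣ) i : ℂˣ) : ℂ) := by
    rw [← coe_torus]
    congr 1
    rw [ht, inv_eq_iff_mul_eq_one]
    apply Units.ext
    rw [Units.val_mul, coe_torus, coe_torus, Matrix.diagonal_mul_diagonal, Units.val_one,
      ← Matrix.diagonal_one]
    congr 1
    funext i
    rw [← Units.val_mul, ← Pi.mul_apply, ← Pi.mulSingle_mul]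
    simp
  have h2 := hq s (t * g * t⁻¹) (fun r c => by
    rw [Units.val_mul, Units.val_mul, hti, ht, coe_torus, Matrix.mul_diagonal,
      Matrix.diagonal_mul, Matrix.of_apply, Polynomial.eval_mul, Polynomial.eval_C]
    by_cases hr : r = l <;> by_cases hc : c = l
    · subst hr; subst hc; simp [mul_right_comm]
    · subst hr; simp [hc]; ring
    · subst hc; simp [hr, hg r hr]
    · simp [hr, Pi.mulSingle_eq_of_ne hc])
  have h3 : ((t * g * t⁻¹ : GL (Fin n) ℂ) : Matrix (Fin n) (Fin n) ℂ).det =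
      (g : Matrix (Fin n) (Fin n) ℂ).det := by
    have : (t * g * t⁻¹).det = g.det := by
      rw [map_mul, map_mul, mul_comm (Matrix.GeneralLinearGroup.det t), mul_assoc,
        ← map_mul, mul_inv_cancel, map_one, mul_one]
    exact congrArg Units.val this
  rw [h3] at h2
  rw [h1, map_smul, Finsupp.smul_apply, smul_eq_mul, Polynomial.eval_mul, Polynomial.eval_C, ← h2,
    inv_mul_cancel_left₀ (pow_ne_zero _ hd)]

/-- Since `u` fixes `v`, `g` may be replaced by `g u`. Taking for column `l` of `u` the normalized
column `l` of `g⁻¹` makes column `l` of `g u` vanish off the diagonal, which is the case already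
treated. -/
theorem mem_boundedBelow_of_inv (h : HasCoefficients ρ b e P)
    (hv : ∀ s, ρ (coroot l s) v = ((s : ℂ) ^ k) • v)
    (hu : ∀ u : GL (Fin n) ℂ, (∀ i, u i i = 1) → (∀ i j, i ≠ j → j ≠ l → u i j = 0) → ρ u v = v)
    (g : GL (Fin n) ℂ) (hg : (g⁻¹ : GL (Fin n) ℂ) l l ≠ 0) : ρ g v ∈ boundedBelow ρ b l k := by
  set c : Fin n → ℂ := fun i => (g⁻¹ : GL (Fin n) ℂ) i l / (g⁻¹ : GL (Fin n) ℂ) l l with hc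
  have hcl : c l = 1 := div_self hg
  have hdet : ((1 : Matrix (Fin n) (Fin n) ℂ).updateCol l c).det = 1 := by
    rw [← Matrix.cramer_apply, Matrix.cramer_one]
    exact hcl
  set u : GL (Fin n) ℂ := GeneralLinearGroup.mkOfDetNeZero _ (hdet.trans_ne one_ne_zero) with hudef
  have hu' : ∀ i j, u i j = (1 : Matrix (Fin n) (Fin n) ℂ).updateCol l c i j := fun _ _ => rfl
  have huv : ρ u v = v := by
    refine hu u (fun i => ?_) fun i j hij hj => ?_
    · rw [hu']
      by_cases hi : i = l
      · subst hi; simp [hcl]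
      · simp [hi]
    · rw [hu', Matrix.updateCol_ne hj, Matrix.one_apply_ne hij]
  rw [← huv, ← Module.End.mul_apply, ← map_mul]
  refine mem_boundedBelow_of_col h hv _ fun i hi => ?_
  have h1 : ((g * g⁻¹ : GL (Fin n) ℂ) : Matrix (Fin n) (Fin n) ℂ) i l = 0 := by
    rw [mul_inv_cancel, Units.val_one, Matrix.one_apply_ne hi]
  rw [Units.val_mul, Matrix.mul_apply] at h1 ⊢
  simp only [hu', Matrix.updateCol_self, hc, ← mul_div_assoc, ← Finset.sum_div, h1, zero_div]

/-- The nonvanishing of the `(l, l)` entry of `g⁻¹` is a dense condition. If it fails, multiply `g`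
by a transvection with parameter `x`: the condition holds for `x ≠ 0`, and a linear functional
killing `boundedBelow` gives a polynomial in `x` that vanishes for `x ≠ 0`, hence also at `0`. -/
theorem mem_boundedBelow (h : HasCoefficients ρ b e P)
    (hv : ∀ s, ρ (coroot l s) v = ((s : ℂ) ^ k) • v)
    (hu : ∀ u : GL (Fin n) ℂ, (∀ i, u i i = 1) → (∀ i j, i ≠ j → j ≠ l → u i j = 0) → ρ u v = v)
    (g : GL (Fin n) ℂ) : ρ g v ∈ boundedBelow ρ b l k := by
  by_cases hg : (g⁻¹ : GL (Fin n) ℂ) l l = 0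
  swap
  · exact mem_boundedBelow_of_inv h hv hu g hg
  obtain ⟨i, hi⟩ : ∃ i, (g⁻¹ : GL (Fin n) ℂ) l i ≠ 0 := by
    by_contra! hcon
    have h1 : ((g⁻¹ * g : GL (Fin n) ℂ) : Matrix (Fin n) (Fin n) ℂ) l l = 1 := by
      rw [inv_mul_cancel, Units.val_one, Matrix.one_apply_eq]
    rw [Units.val_mul, Matrix.mul_apply] at h1
    simp [hcon] at h1
  have hil : i ≠ l := fun h' => hi (h' ▸ hg)
  by_contra hmem
  obtain ⟨f, hf, hfV⟩ := Submodule.exists_le_ker_of_notMem hmem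
  have hdet : ∀ x : ℂ, (transvection i l x).det = 1 := fun x => det_transvection_of_ne _ _ hil x
  let τ : ℂ → GL (Fin n) ℂ := fun x =>
    GeneralLinearGroup.mkOfDetNeZero _ ((hdet x).trans_ne one_ne_zero)
  have hτ : ∀ x, (τ x : Matrix (Fin n) (Fin n) ℂ) = transvection i l x := fun _ => rfl
  have hτi : ∀ x, (τ x)⁻¹ = τ (-x) := fun x => by
    rw [inv_eq_iff_mul_eq_one]
    apply Units.ext
    rw [Units.val_mul, hτ, hτ, transvection_mul_transvection_same _ _ hil]
    simp
  have hp : ∀ j, ∃ q : Polynomial ℂ, ∀ x, b.repr (ρ (τ x) (ρ g v)) j = q.eval x := fun j => by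
    obtain ⟨q, hq⟩ := h.polynomial (1 + Matrix.single i l Polynomial.X) (ρ g v) j
    refine ⟨q, fun x => ?_⟩
    rw [← hq x (τ x) (fun r c => ?_), hτ, hdet, one_pow, one_mul]
    rw [hτ, transvection]
    simp only [Matrix.add_apply, Matrix.single_apply, Matrix.one_apply, Polynomial.eval_add]
    congr 1 <;> split_ifs <;> simp
  choose q hq using hp
  have hfp : ∀ x, f (ρ (τ x) (ρ g v)) = (∑ j, q j * Polynomial.C (f (b j))).eval x := fun x => by
    conv_lhs => rw [← b.sum_repr (ρ (τ x) (ρ g v))]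
    simp [Polynomial.eval_finsetSum, hq]
  have hz : (∑ j, q j * Polynomial.C (f (b j))) = 0 := by
    refine Polynomial.eq_zero_of_infinite_isRoot _ ?_
    refine Set.Infinite.mono (s := {0}ᶜ) (fun x hx => ?_) (Set.finite_singleton 0).infinite_compl
    rw [Set.mem_ofPred_eq, Polynomial.IsRoot, ← hfp, ← Module.End.mul_apply, ← map_mul]
    refine hfV (mem_boundedBelow_of_inv h hv hu _ ?_)
    rw [_root_.mul_inv_rev, hτi, Units.val_mul, hτ, transvection, Matrix.mul_add, Matrix.mul_one,
      Matrix.add_apply, hg, zero_add, Matrix.mul_single_apply_same]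
    exact mul_ne_zero hi (neg_ne_zero.mpr hx)
  have h0 := hfp 0
  have hτ0 : τ 0 = 1 := Units.ext (by rw [hτ]; simp)
  rw [hz, Polynomial.eval_zero, hτ0, map_one] at h0
  exact hf h0

theorem boundedBelow_eq_top (hρ : ρ.IsIrreducible) (h : HasCoefficients ρ b e P) (hv0 : v ≠ 0)
    (hv : ∀ s, ρ (coroot l s) v = ((s : ℂ) ^ k) • v)
    (hu : ∀ u : GL (Fin n) ℂ, (∀ i, u i i = 1) → (∀ i j, i ≠ j → j ≠ l → u i j = 0) → ρ u v = v) :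
    boundedBelow ρ b l k = ⊤ := by
  have h1 : Submodule.span ℂ (Set.range fun g => ρ g v) = ⊤ := by
    refine eq_top_of_invariant hρ _ (fun g w hw => ?_)
      (Submodule.subset_span (Set.mem_range.mpr ⟨1, by simp⟩)) hv0
    induction hw using Submodule.span_induction with
    | mem x hx =>
      obtain ⟨g', rfl⟩ := hx
      exact Submodule.subset_span ⟨g * g', by simp⟩
    | zero => simp
    | add x y _ _ hx hy => rw [map_add]; exact add_mem hx hy
    | smul c x _ hx => rw [map_smul]; exact Submodule.smul_mem _ _ hx
  rw [eq_top_iff, ← h1, Submodule.span_le]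
  rintro _ ⟨g, rfl⟩
  exact mem_boundedBelow h hv hu g

theorem mem_span_basis_iff (b : Module.Basis (Fin d) ℂ W) (w : W) :
    w ∈ Submodule.span ℤ (Set.range b) ↔ ∀ i, ∃ z : ℤ, b.repr w i = z := by
  rw [Module.Basis.mem_span_iff_repr_mem ℤ b w]
  simp [Set.mem_range, eq_comm]

theorem HasCoefficients.int_polynomial (h : HasCoefficients ρ b e P)
    (M : Matrix (Fin n) (Fin n) (Polynomial ℤ)) {w : W}
    (hw : w ∈ Submodule.span ℤ (Set.range b)) (i : Fin d) :
    ∃ q : Polynomial ℤ, ∀ (s : ℂ) (g : GL (Fin n) ℂ),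
      (∀ r c, g r c = Polynomial.aeval s (M r c)) →
      (g : Matrix (Fin n) (Fin n) ℂ).det ^ e * b.repr (ρ g w) i = Polynomial.aeval s q := by
  choose z hz using (mem_span_basis_iff b w).mp hw
  refine ⟨∑ j, MvPolynomial.aeval (fun q : Fin n × Fin n => M q.1 q.2) (P i j) *
    Polynomial.C (z j), fun s g hg => ?_⟩
  rw [h.repr, map_sum]
  refine Finset.sum_congr rfl fun j _ => ?_
  rw [map_mul, Polynomial.aeval_C, hz]
  congr 1
  have := MvPolynomial.map_aeval (fun q : Fin n × Fin n => M q.1 q.2)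
    (Polynomial.aeval s : Polynomial ℤ →ₐ[ℤ] ℂ).toRingHom (P i j)
  simp only [AlgHom.toRingHom_eq_coe, RingHom.coe_coe] at this
  rw [this, MvPolynomial.aeval_def, MvPolynomial.coe_eval₂Hom]
  congr 1
  · exact RingHom.ext_int _ _
  · funext q
    exact hg q.1 q.2

/-- The determinant of `U` is `±1`, so the denominator `det ^ e` is harmless. -/
theorem HasCoefficients.map_integral (h : HasCoefficients ρ b e P) (U : GL (Fin n) ℤ) {w : W}
    (hw : w ∈ Submodule.span ℤ (Set.range b)) :
    ρ (GeneralLinearGroup.map (Int.castRingHom ℂ) U) w ∈ Submodule.span ℤ (Set.range b) := by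
  rw [mem_span_basis_iff]
  intro i
  obtain ⟨q, hq⟩ := h.int_polynomial
    ((U : Matrix (Fin n) (Fin n) ℤ).map Polynomial.C) hw i
  have h1 := hq 0 (GeneralLinearGroup.map (Int.castRingHom ℂ) U) (fun r c => by simp)
  have hdet : ((GeneralLinearGroup.map (Int.castRingHom ℂ) U : GL (Fin n) ℂ) :
      Matrix (Fin n) (Fin n) ℂ).det = ((U : Matrix (Fin n) (Fin n) ℤ).det : ℂ) := by
    exact ((Int.castRingHom ℂ).map_det _).symm
  have hU : (U : Matrix (Fin n) (Fin n) ℤ).det * (U : Matrix (Fin n) (Fin n) ℤ).det = 1 :=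
    congrArg Units.val (Int.units_mul_self (Matrix.GeneralLinearGroup.det U))
  have hq0 : (Polynomial.aeval (0 : ℂ) q : ℂ) = ((q.eval 0 : ℤ) : ℂ) := by
    have := Polynomial.aeval_algebraMap_apply_eq_algebraMap_eval (A := ℂ) (0 : ℤ) q
    simpa using this
  rw [hdet, hq0] at h1
  refine ⟨(U : Matrix (Fin n) (Fin n) ℤ).det ^ e * q.eval 0, ?_⟩
  rw [Int.cast_mul, ← h1, Int.cast_pow, ← mul_assoc, ← mul_pow, ← Int.cast_mul, hU]
  simp

/-- Times `s ^ e`, a coefficient is an integral polynomial `Q(s)`; by `htop` it is also `s ^ (e +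
k)` times a complex polynomial. The low coefficients of `Q` vanish in `ℂ`, hence in `ℤ`, and the
quotient has integral coefficients. -/
theorem coroot_integral (h : HasCoefficients ρ b e P) {l : Fin n} {k : ℕ}
    (htop : boundedBelow ρ b l k = ⊤) {z : ℤ} {s : ℂˣ} (hs : (s : ℂ) = z) {w : W}
    (hw : w ∈ Submodule.span ℤ (Set.range b)) :
    ∃ w' ∈ Submodule.span ℤ (Set.range b), ρ (coroot l s) w = ((z : ℂ) ^ k) • w' := by
  have key : ∀ i, ∃ y : ℤ, b.repr (ρ (coroot l s) w) i = (z : ℂ) ^ k * y := fun i => by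
    obtain ⟨q, hq⟩ := (htop ▸ Submodule.mem_top : w ∈ boundedBelow ρ b l k) i
    obtain ⟨Q, hQ⟩ := h.int_polynomial
      (Matrix.diagonal fun i => if i = l then Polynomial.X else 1) hw i
    have hQ' : ∀ s : ℂˣ, (s : ℂ) ^ e * b.repr (ρ (coroot l s) w) i = Polynomial.aeval (s : ℂ) Q :=
      fun s => by
        rw [← hQ s (coroot l s) (fun r c => ?_), det_coroot]
        rw [coe_torus]
        by_cases hrc : r = c
        · subst hrc
          by_cases hr : r = l
          · subst hr; simp
          · simp [hr]
        · simp [hrc]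
    have heq : Q.map (Int.castRingHom ℂ) = Polynomial.X ^ (e + k) * q := by
      refine Polynomial.eq_of_infinite_eval_eq _ _ ?_
      refine Set.Infinite.mono (s := {0}ᶜ) (fun x hx => ?_)
        (Set.finite_singleton 0).infinite_compl
      have hx' : x ≠ 0 := hx
      have h1 := hQ' (Units.mk0 x hx')
      rw [hq, Units.val_mk0, zpow_natCast] at h1
      rw [Set.mem_ofPred_eq, Polynomial.eval_mul, Polynomial.eval_pow, Polynomial.eval_X, pow_add,
        mul_assoc, h1, Polynomial.eval_map, Polynomial.aeval_def]
      rfl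
    obtain ⟨R, hR⟩ : Polynomial.X ^ (e + k) ∣ Q := by
      rw [Polynomial.X_pow_dvd_iff]
      intro c hc
      have h2 : (Q.map (Int.castRingHom ℂ)).coeff c = 0 := by
        rw [heq]
        exact Polynomial.X_pow_dvd_iff.mp (dvd_mul_right _ _) c hc
      rw [Polynomial.coeff_map, eq_intCast] at h2
      exact_mod_cast h2
    refine ⟨R.eval z, ?_⟩
    have h3 := hQ' s
    have hR0 : (Polynomial.aeval (z : ℂ) R : ℂ) = ((R.eval z : ℤ) : ℂ) := by
      have := Polynomial.aeval_algebraMap_apply_eq_algebraMap_eval (A := ℂ) (z : ℤ) R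
      simpa using this
    rw [hR, map_mul, map_pow, Polynomial.aeval_X, pow_add, hs, hR0, mul_assoc] at h3
    exact mul_left_cancel₀ (pow_ne_zero _ (hs ▸ s.ne_zero)) h3
  choose y hy using key
  refine ⟨∑ i, (y i : ℂ) • b i, ?_, ?_⟩
  · rw [mem_span_basis_iff]
    intro i
    exact ⟨y i, by simp [Finsupp.single_apply]⟩
  · refine b.repr.injective (Finsupp.ext fun i => ?_)
    rw [hy]
    simp [Finsupp.single_apply]

end Weights

/-- An integral matrix with nonzero determinant, as an element of `GL_n(ℂ)`. -/
def intGL {n : ℕ} (A : Matrix (Fin n) (Fin n) ℤ) (hA : A.det ≠ 0) : GL (Fin n) ℂ :=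
  GeneralLinearGroup.mkOfDetNeZero (A.map (Int.cast : ℤ → ℂ)) (by
    have := (Int.castRingHom ℂ).map_det A
    intro h
    apply hA
    have h' : ((A.det : ℤ) : ℂ) = 0 := by
      rw [← h]; exact this
    exact_mod_cast h')

/-! ### Central character, and the smallest entry of the highest weight. -/

section HighestWeight

variable {n : ℕ} {W : Type*} [AddCommGroup W] [Module ℂ W]
  {ρ : Representation ℂ (GL (Fin n) ℂ) W} {k : Fin n → ℤ}

theorem prod_zpow_const {ι : Type*} [Fintype ι] (c : ℂˣ) (k : ι → ℤ) :
    ∏ i, c ^ k i = c ^ ∑ i, k i :=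
  (map_sum (zpowersHom ℂˣ c).toAdditiveRight k Finset.univ).symm

/-- The scalar is read off on the highest weight vector. This is what turns `ρ(D)⁻¹` into a power of
`m` times `ρ(Aᵀ)` when `Aᵀ D = m`. -/
theorem HasHighestWeight.scalar [FiniteDimensional ℂ W] (hρ : ρ.IsIrreducible)
    (hk : HasHighestWeight ρ k) {z : GL (Fin n) ℂ} {c : ℂ}
    (hz : (z : Matrix (Fin n) (Fin n) ℂ) = c • 1) (hc : c ≠ 0) (w : W) :
    ρ z w = c ^ (∑ i, k i) • w := by
  obtain ⟨-, v, hv0, hv, -⟩ := hk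
  have hzt : z = torus fun _ => Units.mk0 c hc := by
    apply Units.ext
    rw [hz, coe_torus]
    ext i j
    by_cases hij : i = j
    · subst hij; simp
    · simp [hij]
  refine central_acts_by_scalar hρ (fun g => ?_) hv0 ?_ w
  · apply Units.ext
    simp [hz]
  · rw [hzt, hv, prod_zpow_const, Units.val_zpow_eq_zpow_val, Units.val_mk0]

/-- Unipotent matrices that differ from the identity only in column `l` are upper triangular exactly
because `l` is the last index; therefore they fix the highest weight vector. -/
theorem HasHighestWeight.boundedBelow_last {d e : ℕ} {b : Module.Basis (Fin d) ℂ W}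
    {P : Matrix (Fin d) (Fin d) (MvPolynomial (Fin n × Fin n) ℤ)} (h : HasCoefficients ρ b e P)
    (hρ : ρ.IsIrreducible) (hk : HasHighestWeight ρ k) {l : Fin n} (hl : ∀ i, i ≤ l) :
    boundedBelow ρ b l (k l) = ⊤ := by
  obtain ⟨-, v, hv0, hv, hu⟩ := hk
  refine boundedBelow_eq_top hρ h hv0 (fun s => ?_) fun u h1 h2 => hu u h1 fun i j hij =>
    h2 i j hij.ne' (hij.trans_le (hl i)).ne
  rw [hv]
  congr 1
  rw [Finset.prod_eq_single l (fun i _ hi => by rw [Pi.mulSingle_eq_of_ne hi, _root_.one_zpow])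
    (fun hn => absurd (Finset.mem_univ l) hn), Pi.mulSingle_eq_same, Units.val_zpow_eq_zpow_val]

end HighestWeight

/-- The columns of `A` span a full sublattice of `ℤⁿ`. The columns of `P` form a basis of `ℤⁿ`
adapted to it, and `Q` holds the coordinates of the columns of `A` in the resulting basis of the
sublattice. -/
theorem smith_normal_form {n : ℕ} (A : Matrix (Fin n) (Fin n) ℤ) (hA : A.det ≠ 0) :
    ∃ (P Q : GL (Fin n) ℤ) (a : Fin n → ℤ), A = P * Matrix.diagonal a * Q := by
  classical
  have hinj : Function.Injective A.mulVecLin := by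
    rw [← LinearMap.ker_eq_bot, Matrix.ker_mulVecLin_eq_bot_iff]
    intro v hv
    by_contra hv0
    exact hA (Matrix.exists_mulVec_eq_zero_iff.mp ⟨v, hv0, hv⟩)
  have hrank : Module.finrank ℤ (LinearMap.range A.mulVecLin) =
      Module.finrank ℤ (Fin n → ℤ) := LinearMap.finrank_range_of_inj hinj
  obtain ⟨bM, a, bN, hab⟩ := Submodule.exists_smith_normal_form_of_rank_eq (Pi.basisFun ℤ (Fin n))
    (N := LinearMap.range A.mulVecLin) hrank
  have hmem : ∀ j, A.mulVecLin (Pi.single j 1) ∈ LinearMap.range A.mulVecLin := fun j => ⟨_, rfl⟩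
  choose x hx using fun i => (bN i).2
  let P : Matrix (Fin n) (Fin n) ℤ := Matrix.of fun r c => bM c r
  let P' : Matrix (Fin n) (Fin n) ℤ := Matrix.of fun r c => bM.repr (Pi.single c 1) r
  let Q : Matrix (Fin n) (Fin n) ℤ := Matrix.of fun r c => bN.repr ⟨_, hmem c⟩ r
  let X : Matrix (Fin n) (Fin n) ℤ := Matrix.of fun r c => x c r
  have hPP : P * P' = 1 := by
    ext r c
    have := congrFun (bM.sum_repr (Pi.single c 1)) r
    rw [Finset.sum_apply] at this
    have h1 : (1 : Matrix (Fin n) (Fin n) ℤ) r c = (Pi.single c 1 : Fin n → ℤ) r := by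
      rw [Matrix.one_apply, Pi.single_apply]
    rw [h1, Matrix.mul_apply, ← this]
    refine Finset.sum_congr rfl fun j _ => ?_
    simp [P, P', mul_comm]
  have hcol : ∀ i r, (bN i : Fin n → ℤ) r = bM i r * a i := fun i r => by
    rw [hab]; simp [mul_comm]
  have h1 : A = P * Matrix.diagonal a * Q := by
    ext r c
    have := congrArg (fun v : LinearMap.range A.mulVecLin => (v : Fin n → ℤ) r)
      (bN.sum_repr ⟨_, hmem c⟩)
    simp only [AddSubmonoidClass.coe_finsetSum, Finset.sum_apply, Submodule.coe_smul,
      Pi.smul_apply, smul_eq_mul, hcol] at this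
    rw [Matrix.mul_apply]
    simp only [Matrix.mul_diagonal]
    have h2 : A.mulVecLin (Pi.single c 1) r = A r c := by simp
    rw [← h2, ← this]
    refine Finset.sum_congr rfl fun j _ => ?_
    simp only [P, Q, Matrix.of_apply]
    ring
  have h2 : P * Matrix.diagonal a = A * X := by
    ext r c
    have := congrFun (hx c) r
    rw [Matrix.mul_diagonal, Matrix.mul_apply]
    simp only [P, Matrix.of_apply]
    rw [← hcol, ← this]
    simp [Matrix.mulVec, dotProduct, X]
  -- The columns of `X` are preimages under `A` of the adapted basis, so `A X Q = A`; the adjugate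
  -- cancels `A` over `ℤ`.
  have h3 : X * Q = 1 := by
    have h4 : A.det • (X * Q) = A.det • (1 : Matrix (Fin n) (Fin n) ℤ) := by
      have h5 : A.adjugate * (A * (X * Q)) = A.adjugate * A := by
        rw [← Matrix.mul_assoc A, ← h2, ← h1]
      rw [← Matrix.mul_assoc, Matrix.adjugate_mul, Matrix.smul_mul, Matrix.one_mul] at h5
      exact h5
    ext i j
    have := congrFun (congrFun h4 i) j
    simp only [Matrix.smul_apply, smul_eq_mul] at this
    exact mul_left_cancel₀ hA this
  exact ⟨⟨P, P', hPP, mul_eq_one_comm.mp hPP⟩,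
    ⟨Q, X, mul_eq_one_comm.mp h3, h3⟩, a, h1⟩


/-! ### Integral matrices acting on the lattice. -/

section Integrality

variable {n : ℕ} {W : Type*} [AddCommGroup W] [Module ℂ W]
  {ρ : Representation ℂ (GL (Fin n) ℂ) W} {d e : ℕ} {b : Module.Basis (Fin d) ℂ W}
  {P : Matrix (Fin d) (Fin d) (MvPolynomial (Fin n × Fin n) ℤ)}

/-- The permutation matrix of a transposition is integral and preserves the lattice, so the bound
found for the last coordinate holds for all coordinates. -/
theorem coroot_conj (i l : Fin n) (s : ℂˣ) : ∃ U : GL (Fin n) ℤ,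
    coroot i s = GeneralLinearGroup.map (Int.castRingHom ℂ) U * coroot l s *
      GeneralLinearGroup.map (Int.castRingHom ℂ) U⁻¹ := by
  let M : Matrix (Fin n) (Fin n) ℤ := (Equiv.swap i l).permMatrix ℤ
  have hM : M * M = 1 := by
    rw [← Matrix.permMatrix_mul, Equiv.swap_mul_self, Matrix.permMatrix_one]
  refine ⟨⟨M, M, hM, hM⟩, ?_⟩
  rw [map_inv, eq_mul_inv_iff_mul_eq]
  apply Units.ext
  rw [Units.val_mul, Units.val_mul, coe_torus, coe_torus]
  ext r c
  rw [Matrix.diagonal_mul, Matrix.mul_diagonal]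
  simp only [GeneralLinearGroup.map_apply, M, Equiv.Perm.permMatrix, PEquiv.toMatrix_apply,
    Equiv.toPEquiv_apply, Option.mem_def, Option.some.injEq]
  by_cases h : (Equiv.swap i l) r = c
  · have hc : (Pi.mulSingle l s : Fin n → ℂˣ) c = (Pi.mulSingle i s : Fin n → ℂˣ) r := by
      rw [← h, Pi.mulSingle_apply, Pi.mulSingle_apply]
      congr 1
      rw [Equiv.swap_apply_eq_iff, Equiv.swap_apply_right]
    rw [hc, mul_comm]
  · simp [h]

theorem coroot_integral_of_last (h : HasCoefficients ρ b e P) {l : Fin n} {k : ℕ}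
    (htop : boundedBelow ρ b l k = ⊤) (i : Fin n) {z : ℤ} {s : ℂˣ} (hs : (s : ℂ) = z) {w : W}
    (hw : w ∈ Submodule.span ℤ (Set.range b)) :
    ∃ w' ∈ Submodule.span ℤ (Set.range b), ρ (coroot i s) w = ((z : ℂ) ^ k) • w' := by
  obtain ⟨U, hU⟩ := coroot_conj i l s
  obtain ⟨w', hw', h'⟩ := coroot_integral h htop hs (h.map_integral U⁻¹ hw)
  refine ⟨_, h.map_integral U hw', ?_⟩
  rw [hU, map_mul, map_mul, Module.End.mul_apply, Module.End.mul_apply, h', map_smul]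

theorem torus_mul (t t' : Fin n → ℂˣ) : torus (t * t') = torus t * torus t' :=
  Units.ext (by simp [Matrix.diagonal_mul_diagonal])

theorem torus_integral (h : HasCoefficients ρ b e P) {l : Fin n} {k : ℕ}
    (htop : boundedBelow ρ b l k = ⊤) {a : Fin n → ℤ} {t : Fin n → ℂˣ} (ht : ∀ i, (t i : ℂ) = a i)
    {w : W} (hw : w ∈ Submodule.span ℤ (Set.range b)) :
    ∃ w' ∈ Submodule.span ℤ (Set.range b),
      ρ (torus t) w = (((∏ i, a i : ℤ) : ℂ) ^ k) • w' := by
  classical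
  have key : ∀ S : Finset (Fin n), ∃ w' ∈ Submodule.span ℤ (Set.range b),
      ρ (torus (∏ i ∈ S, Pi.mulSingle i (t i))) w = (((∏ i ∈ S, a i : ℤ) : ℂ) ^ k) • w' := by
    intro S
    induction S using Finset.induction_on with
    | empty =>
      refine ⟨w, hw, ?_⟩
      have : (torus (1 : Fin n → ℂˣ) : GL (Fin n) ℂ) = 1 := Units.ext (by simp)
      simp [this]
    | insert i S hi ih =>
      obtain ⟨w', hw', h'⟩ := ih
      obtain ⟨w'', hw'', h''⟩ := coroot_integral_of_last h htop i (ht i) hw'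
      refine ⟨w'', hw'', ?_⟩
      rw [Finset.prod_insert hi, Finset.prod_insert hi, torus_mul, map_mul, Module.End.mul_apply,
        h', map_smul, h'', smul_smul, Int.cast_mul, mul_pow, mul_comm]
  have := key Finset.univ
  rwa [Finset.univ_prod_mulSingle] at this

theorem intGL_integral (h : HasCoefficients ρ b e P) {l : Fin n} {k : ℕ}
    (htop : boundedBelow ρ b l k = ⊤) (A : Matrix (Fin n) (Fin n) ℤ) (hA : A.det ≠ 0)
    {w : W} (hw : w ∈ Submodule.span ℤ (Set.range b)) :
    ∃ w' ∈ Submodule.span ℤ (Set.range b), ρ (intGL A hA) w = ((A.det : ℂ) ^ k) • w' := by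
  obtain ⟨U, V, a, hUV⟩ := smith_normal_form A hA
  have hdet : A.det = (U : Matrix (Fin n) (Fin n) ℤ).det * (V : Matrix (Fin n) (Fin n) ℤ).det *
      ∏ i, a i := by
    rw [hUV, Matrix.det_mul, Matrix.det_mul, Matrix.det_diagonal]; ring
  have ha : ∀ i, (a i : ℂ) ≠ 0 := fun i => by
    rw [Ne, Int.cast_eq_zero]
    intro h0
    exact hA (by rw [hdet, Finset.prod_eq_zero (Finset.mem_univ i) h0, mul_zero])
  have hu : ((U : Matrix (Fin n) (Fin n) ℤ).det * (V : Matrix (Fin n) (Fin n) ℤ).det) *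
      ((U : Matrix (Fin n) (Fin n) ℤ).det * (V : Matrix (Fin n) (Fin n) ℤ).det) = 1 :=
    congrArg Units.val (Int.units_mul_self
      (Matrix.GeneralLinearGroup.det U * Matrix.GeneralLinearGroup.det V))
  have hg : intGL A hA = GeneralLinearGroup.map (Int.castRingHom ℂ) U *
      torus (fun i => Units.mk0 _ (ha i)) * GeneralLinearGroup.map (Int.castRingHom ℂ) V := by
    apply Units.ext
    have : (intGL A hA : Matrix (Fin n) (Fin n) ℂ) = A.map (Int.castRingHom ℂ) := rfl
    rw [this, hUV, Matrix.map_mul, Matrix.map_mul, Units.val_mul, Units.val_mul, coe_torus,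
      Matrix.diagonal_map (map_zero _)]
    rfl
  obtain ⟨w', hw', h'⟩ := torus_integral h htop (a := a) (t := fun i => Units.mk0 _ (ha i))
    (fun i => rfl) (h.map_integral V hw)
  set u := (U : Matrix (Fin n) (Fin n) ℤ).det * (V : Matrix (Fin n) (Fin n) ℤ).det with hudef
  -- The sign `u = det U * det V` separates `det A` from the product of the elementary divisors; it
  -- is absorbed into the lattice vector.
  refine ⟨(u ^ k) • ρ (GeneralLinearGroup.map (Int.castRingHom ℂ) U) w',
    Submodule.smul_mem _ _ (h.map_integral U hw'), ?_⟩
  rw [hg, map_mul, map_mul, Module.End.mul_apply, Module.End.mul_apply, h', map_smul, hdet,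
    ← Int.cast_smul_eq_zsmul ℂ, smul_smul, Int.cast_mul u, mul_pow, Int.cast_pow,
    mul_right_comm, ← mul_pow, ← Int.cast_mul, hu]
  simp

/-- An integral matrix `A` maps `W₀(O)` to `det(A) ^ kₙ W₀(O)`. -/
theorem intGL_latticeOver [FiniteDimensional ℂ W] (hρ : ρ.IsIrreducible) {k : Fin n → ℤ}
    (hk : HasHighestWeight ρ k) {l : Fin n} (hl : ∀ i, i ≤ l) {kn : ℕ} (hkn : k l = kn)
    {W₀ : Submodule ℤ W} (hW₀ : IsIntegralForm ρ W₀) (O : Subring ℂ)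
    (A : Matrix (Fin n) (Fin n) ℤ) (hA : A.det ≠ 0) {w : W} (hw : w ∈ latticeOver W₀ O) :
    ∃ w' ∈ latticeOver W₀ O, ρ (intGL A hA) w = ((A.det : ℂ) ^ kn) • w' := by
  obtain ⟨d, b, rfl, e, P, hP⟩ := hW₀
  have hP : HasCoefficients ρ b e P := hP
  have htop := hk.boundedBelow_last hP hρ hl
  rw [hkn] at htop
  induction hw using Submodule.span_induction with
  | mem x hx =>
    obtain ⟨w', hw', h'⟩ := intGL_integral hP htop A hA hx
    exact ⟨w', Submodule.subset_span hw', h'⟩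
  | zero => exact ⟨0, zero_mem _, by simp⟩
  | add x y _ _ hx hy =>
    obtain ⟨x', hx', h1⟩ := hx
    obtain ⟨y', hy', h2⟩ := hy
    exact ⟨x' + y', add_mem hx' hy', by rw [map_add, h1, h2, smul_add]⟩
  | smul c x _ hx =>
    obtain ⟨x', hx', h1⟩ := hx
    refine ⟨c • x', Submodule.smul_mem _ _ hx', ?_⟩
    have : ∀ y : W, c • y = (c : ℂ) • y := fun _ => rfl
    rw [this, this, map_smul, h1, smul_comm]

end Integrality

/-! ### Symplectic matrices -/

section Symplectic

variable {n : ℕ}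

theorem similitude_iff {R : Type*} [CommRing R] (A B C D : Matrix (Fin n) (Fin n) R) (m : R) :
    (fromBlocks A B C D)ᵀ * J (Fin n) R * fromBlocks A B C D = m • J (Fin n) R ↔
      Aᵀ * C = Cᵀ * A ∧ Aᵀ * D - Cᵀ * B = m • 1 ∧ Bᵀ * D = Dᵀ * B := by
  rw [J, fromBlocks_transpose, fromBlocks_multiply, fromBlocks_multiply, fromBlocks_smul,
    fromBlocks_inj]
  simp only [Matrix.mul_zero, Matrix.mul_one, Matrix.mul_neg, zero_add, add_zero,
    Matrix.neg_mul, smul_zero, smul_neg]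
  constructor
  · rintro ⟨h1, h2, h3, h4⟩
    refine ⟨?_, ?_, ?_⟩
    · rw [eq_comm, ← sub_eq_zero, sub_eq_add_neg]; exact h1
    · rw [← neg_inj, ← h2]; abel
    · rw [eq_comm, ← sub_eq_zero, sub_eq_add_neg]; exact h4
  · rintro ⟨h1, h2, h3⟩
    refine ⟨?_, ?_, ?_, ?_⟩
    · rw [h1]; abel
    · rw [← h2]; abel
    · have := congrArg Matrix.transpose h2
      simp only [transpose_sub, transpose_mul, transpose_transpose, transpose_smul,
        transpose_one] at this
      rw [← this]; abel
    · rw [h3]; abel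

/-- The similitude with the given blocks. -/
def ofBlocks {m : ℕ} (A B C D : Matrix (Fin n) (Fin n) ℤ) (hm : 0 < m) (h1 : Aᵀ * C = Cᵀ * A)
    (h2 : Aᵀ * D - Cᵀ * B = (m : ℤ) • 1) (h3 : Bᵀ * D = Dᵀ * B) : Similitude n m :=
  ⟨fromBlocks A B C D, hm, (similitude_iff A B C D m).mpr ⟨h1, h2, h3⟩⟩

/-- The element of `Sp_{2n}(ℤ)` with the given blocks. -/
def spOfBlocks (A B C D : Matrix (Fin n) (Fin n) ℤ) (h1 : Aᵀ * C = Cᵀ * A)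
    (h2 : Aᵀ * D - Cᵀ * B = 1) (h3 : Bᵀ * D = Dᵀ * B) : Sp n :=
  ⟨fromBlocks A B C D, SymplecticGroup.mem_iff'.mpr (by
    have := (similitude_iff A B C D 1).mpr ⟨h1, by rw [h2, one_smul], h3⟩
    rwa [one_smul] at this)⟩

theorem Similitude.blocks {m : ℕ} (x : Similitude n m) :
    x.1.toBlocks₁₁ᵀ * x.1.toBlocks₂₁ = x.1.toBlocks₂₁ᵀ * x.1.toBlocks₁₁ ∧
    x.1.toBlocks₁₁ᵀ * x.1.toBlocks₂₂ - x.1.toBlocks₂₁ᵀ * x.1.toBlocks₁₂ = (m : ℤ) • 1 ∧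
    x.1.toBlocks₁₂ᵀ * x.1.toBlocks₂₂ = x.1.toBlocks₂₂ᵀ * x.1.toBlocks₁₂ := by
  rw [← similitude_iff, fromBlocks_toBlocks]
  exact x.2.2

theorem Sp.blocks (γ : Sp n) :
    γ.1.toBlocks₁₁ᵀ * γ.1.toBlocks₂₁ = γ.1.toBlocks₂₁ᵀ * γ.1.toBlocks₁₁ ∧
    γ.1.toBlocks₁₁ᵀ * γ.1.toBlocks₂₂ - γ.1.toBlocks₂₁ᵀ * γ.1.toBlocks₁₂ = 1 ∧
    γ.1.toBlocks₁₂ᵀ * γ.1.toBlocks₂₂ = γ.1.toBlocks₂₂ᵀ * γ.1.toBlocks₁₂ := by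
  rw [← one_smul ℤ (1 : Matrix (Fin n) (Fin n) ℤ)]
  exact Similitude.blocks γ.toSimilitude

theorem transpose_mul_J_mul (a b : Mat2 n) (c d : ℤ)
    (ha : aᵀ * J (Fin n) ℤ * a = c • J (Fin n) ℤ) (hb : bᵀ * J (Fin n) ℤ * b = d • J (Fin n) ℤ) :
    (a * b)ᵀ * J (Fin n) ℤ * (a * b) = (c * d) • J (Fin n) ℤ := by
  calc (a * b)ᵀ * J (Fin n) ℤ * (a * b) = bᵀ * (aᵀ * J (Fin n) ℤ * a) * b := by
        rw [transpose_mul]; simp only [Matrix.mul_assoc]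
    _ = _ := by rw [ha, Matrix.mul_smul, Matrix.smul_mul, hb, smul_smul]

theorem Sp.form (γ : Sp n) : (γ : Mat2 n)ᵀ * J (Fin n) ℤ * γ = (1 : ℤ) • J (Fin n) ℤ := by
  rw [one_smul]; exact SymplecticGroup.mem_iff'.mp γ.2

/-- Left translation of a similitude by an element of `Sp_{2n}(ℤ)`. -/
def lmul {m : ℕ} (γ : Sp n) (x : Similitude n m) : Similitude n m :=
  ⟨γ * x.1, x.2.1, by
    have := transpose_mul_J_mul _ _ _ _ γ.form x.2.2
    rwa [one_mul] at this⟩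

/-- Right translation of a similitude by an element of `Sp_{2n}(ℤ)`. -/
def rmul {m : ℕ} (x : Similitude n m) (γ : Sp n) : Similitude n m :=
  ⟨x.1 * γ, x.2.1, by
    have := transpose_mul_J_mul _ _ _ _ x.2.2 γ.form
    rwa [mul_one] at this⟩

@[simp] theorem coe_lmul {m : ℕ} (γ : Sp n) (x : Similitude n m) :
    (lmul γ x).1 = (γ : Mat2 n) * x.1 := rfl

@[simp] theorem coe_rmul {m : ℕ} (γ : Sp n) (x : Similitude n m) :
    (rmul x γ).1 = x.1 * (γ : Mat2 n) := rfl

theorem lmul_mul {m : ℕ} (γ γ' : Sp n) (x : Similitude n m) :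
    lmul (γ * γ') x = lmul γ (lmul γ' x) :=
  Subtype.ext (by simp [Matrix.mul_assoc])

theorem one_lmul {m : ℕ} (x : Similitude n m) : lmul (1 : Sp n) x = x :=
  Subtype.ext (by simp)

theorem lmul_rmul {m : ℕ} (γ γ' : Sp n) (x : Similitude n m) :
    lmul γ (rmul x γ') = rmul (lmul γ x) γ' :=
  Subtype.ext (by simp [Matrix.mul_assoc])

theorem rmul_mul {m : ℕ} (γ γ' : Sp n) (x : Similitude n m) :
    rmul x (γ * γ') = rmul (rmul x γ) γ' :=
  Subtype.ext (by simp [Matrix.mul_assoc])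

theorem rmul_one {m : ℕ} (x : Similitude n m) : rmul x (1 : Sp n) = x :=
  Subtype.ext (by simp)

@[simp] theorem coe_toSimilitude (γ : Sp n) : γ.toSimilitude.1 = (γ : Mat2 n) := rfl

/-- The block diagonal embedding of `n` copies of `SL_2(ℤ)`. -/
def diagSp (M : Fin n → SpecialLinearGroup (Fin 2) ℤ) : Sp n :=
  spOfBlocks (diagonal fun i => M i 0 0) (diagonal fun i => M i 0 1)
    (diagonal fun i => M i 1 0) (diagonal fun i => M i 1 1)
    (by simp [diagonal_mul_diagonal, mul_comm])
    (by
      have h : ∀ i, M i 0 0 * M i 1 1 - M i 1 0 * M i 0 1 = 1 := fun i => by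
        have := (M i).det_coe
        rw [det_fin_two] at this
        linarith
      rw [diagonal_transpose, diagonal_transpose, diagonal_mul_diagonal, diagonal_mul_diagonal,
        diagonal_sub, ← diagonal_one]
      congr 1
      funext i
      exact h i)
    (by simp [diagonal_mul_diagonal, mul_comm])

/-- The embedding of `GL_n(ℤ)` as the Levi subgroup of the Siegel parabolic. -/
def levi (U : GL (Fin n) ℤ) : Sp n :=
  spOfBlocks U 0 0 ((U⁻¹ : GL (Fin n) ℤ) : Matrix (Fin n) (Fin n) ℤ)ᵀ (by simp)
    (by
      rw [← transpose_mul, ← Units.val_mul, inv_mul_cancel]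
      simp)
    (by simp)

/-- The translation `[1 S; 0 1]`. -/
def transl (S : Matrix (Fin n) (Fin n) ℤ) (hS : Sᵀ = S) : Sp n :=
  spOfBlocks 1 S 0 1 (by simp) (by simp) (by simp [hS])

theorem coe_diagSp (M : Fin n → SpecialLinearGroup (Fin 2) ℤ) : (diagSp M : Mat2 n) =
    fromBlocks (diagonal fun i => M i 0 0) (diagonal fun i => M i 0 1)
    (diagonal fun i => M i 1 0) (diagonal fun i => M i 1 1) := rfl

theorem coe_levi (U : GL (Fin n) ℤ) : (levi U : Mat2 n) =
    fromBlocks (U : Matrix (Fin n) (Fin n) ℤ) 0 0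
      ((U⁻¹ : GL (Fin n) ℤ) : Matrix (Fin n) (Fin n) ℤ)ᵀ := rfl

theorem coe_transl (S : Matrix (Fin n) (Fin n) ℤ) (hS : Sᵀ = S) :
    (transl S hS : Mat2 n) = fromBlocks 1 S 0 1 := rfl

/-- The bottom row is `(-c/d, a/d)` with `d = gcd(a, c)`, and Bézout coefficients complete it to
determinant `1`. -/
theorem exists_SL2_bottom_eq_zero (a c : ℤ) :
    ∃ M : SpecialLinearGroup (Fin 2) ℤ, M 1 0 * a + M 1 1 * c = 0 := by
  by_cases h : Int.gcd a c = 0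
  · obtain ⟨rfl, rfl⟩ := Int.gcd_eq_zero_iff.mp h
    exact ⟨1, by simp⟩
  have hd : (Int.gcd a c : ℤ) ≠ 0 := by exact_mod_cast h
  obtain ⟨a', ha'⟩ := Int.gcd_dvd_left a c
  obtain ⟨c', hc'⟩ := Int.gcd_dvd_right a c
  refine ⟨⟨!![Int.gcdA a c, Int.gcdB a c; -c', a'], ?_⟩, ?_⟩
  · rw [det_fin_two_of]
    refine mul_left_cancel₀ hd ?_
    have := Int.gcd_eq_gcd_ab a c
    calc (Int.gcd a c : ℤ) * (Int.gcdA a c * a' - Int.gcdB a c * -c')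
        = (Int.gcd a c * a') * Int.gcdA a c + (Int.gcd a c * c') * Int.gcdB a c := by ring
      _ = _ := by rw [← ha', ← hc', ← this, mul_one]
  · simp only [of_apply, cons_val', cons_val_zero, cons_val_one, cons_val_fin_one]
    calc -c' * a + a' * c = -c' * (Int.gcd a c * a') + a' * (Int.gcd a c * c') := by
          rw [← ha', ← hc']
      _ = 0 := by ring

/-- The embedding of `SL_2` in rows and columns `i`, `j`. -/
def embedSL2Matrix (i j : Fin n) (M : Matrix (Fin 2) (Fin 2) ℤ) : Matrix (Fin n) (Fin n) ℤ :=
  1 + single i i (M 0 0 - 1) + single i j (M 0 1) + single j i (M 1 0) + single j j (M 1 1 - 1)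

theorem embedSL2Matrix_mul {i j : Fin n} (hij : i ≠ j) (M M' : Matrix (Fin 2) (Fin 2) ℤ) :
    embedSL2Matrix i j M * embedSL2Matrix i j M' = embedSL2Matrix i j (M * M') := by
  simp only [embedSL2Matrix, Matrix.add_mul, Matrix.mul_add, Matrix.one_mul, Matrix.mul_one,
    single_mul_single_same, single_mul_single_of_ne _ _ _ _ hij,
    single_mul_single_of_ne _ _ _ _ hij.symm, Matrix.mul_apply, Fin.sum_univ_two]
  ext r c
  simp only [Matrix.add_apply, Matrix.single_apply, Matrix.zero_apply]
  split_ifs <;> ring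

/-- The embedding of `SL_2(ℤ)` in rows and columns `i`, `j`. -/
def embedSL2 {i j : Fin n} (hij : i ≠ j) (M : SpecialLinearGroup (Fin 2) ℤ) : GL (Fin n) ℤ :=
  have h1 : embedSL2Matrix i j 1 = 1 := by simp [embedSL2Matrix]
  ⟨embedSL2Matrix i j (M : Matrix (Fin 2) (Fin 2) ℤ), embedSL2Matrix i j ((M⁻¹ : SpecialLinearGroup (Fin 2) ℤ) : Matrix (Fin 2) (Fin 2) ℤ),
    by
      rw [embedSL2Matrix_mul hij]
      exact (congrArg (embedSL2Matrix i j) (congrArg Subtype.val (mul_inv_cancel M))).trans h1,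
    by
      rw [embedSL2Matrix_mul hij]
      exact (congrArg (embedSL2Matrix i j) (congrArg Subtype.val (inv_mul_cancel M))).trans h1⟩

theorem embedSL2_mulVec {i j : Fin n} (hij : i ≠ j) (M : SpecialLinearGroup (Fin 2) ℤ)
    (a : Fin n → ℤ) (r : Fin n) : ((embedSL2 hij M : Matrix (Fin n) (Fin n) ℤ) *ᵥ a) r =
      if r = i then M 0 0 * a i + M 0 1 * a j
      else if r = j then M 1 0 * a i + M 1 1 * a j else a r := by
  have h : (embedSL2 hij M : Matrix (Fin n) (Fin n) ℤ) = embedSL2Matrix i j (M : Matrix (Fin 2) (Fin 2) ℤ) := rfl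
  rw [h, embedSL2Matrix]
  simp only [add_mulVec, one_mulVec, single_mulVec, Pi.add_apply, Function.update_apply, Pi.zero_apply]
  by_cases h1 : r = i
  · subst h1; simp [hij]; ring
  · by_cases h2 : r = j
    · subst h2; simp [h1]; ring
    · simp [h1, h2]

/-- The entries below `t` are cleared one at a time by a copy of `SL_2` in rows `t` and `i`. Being
the identity in the rows and columns before `t`, the product does not spoil columns that are already
triangular. -/
theorem exists_GL_clear_column (t : Fin n) (a : Fin n → ℤ) :
    ∃ U : GL (Fin n) ℤ, (∀ r c, r < t ∨ c < t → U r c = (1 : Matrix (Fin n) (Fin n) ℤ) r c) ∧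
      ∀ i, t < i → ((U : Matrix (Fin n) (Fin n) ℤ) *ᵥ a) i = 0 := by
  classical
  have key : ∀ S : Finset (Fin n), (∀ i ∈ S, t < i) → ∃ U : GL (Fin n) ℤ,
      (∀ r c, r < t ∨ c < t → U r c = (1 : Matrix (Fin n) (Fin n) ℤ) r c) ∧
      ∀ i ∈ S, ((U : Matrix (Fin n) (Fin n) ℤ) *ᵥ a) i = 0 := by
    intro S
    induction S using Finset.induction_on with
    | empty => exact fun _ => ⟨1, fun _ _ _ => rfl, by simp⟩
    | insert i S hi ih =>
      intro hS
      obtain ⟨U, hU, hUa⟩ := ih fun j hj => hS j (Finset.mem_insert_of_mem hj)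
      have hti : t < i := hS i (Finset.mem_insert_self _ _)
      set a' := (U : Matrix (Fin n) (Fin n) ℤ) *ᵥ a with ha'
      obtain ⟨M, hM⟩ := exists_SL2_bottom_eq_zero (a' t) (a' i)
      have hE : ∀ r c, r < t ∨ c < t → (embedSL2 hti.ne M : GL (Fin n) ℤ) r c =
          (1 : Matrix (Fin n) (Fin n) ℤ) r c := fun r c hrc => by
        have h : (embedSL2 hti.ne M : Matrix (Fin n) (Fin n) ℤ) = embedSL2Matrix t i (M : Matrix (Fin 2) (Fin 2) ℤ) := rfl
        rw [h, embedSL2Matrix]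
        simp only [Matrix.add_apply, Matrix.single_apply]
        rcases hrc with h | h
        · simp [h.ne', (h.trans hti).ne']
        · simp [h.ne', (h.trans hti).ne']
      refine ⟨embedSL2 hti.ne M * U, fun r c hrc => ?_, fun j hj => ?_⟩
      · rw [Units.val_mul, Matrix.mul_apply]
        rcases hrc with h | h
        · simp only [hE r _ (Or.inl h), Matrix.one_apply, ite_mul, one_mul, zero_mul,
            Finset.sum_ite_eq, Finset.mem_univ, if_true]
          rw [hU r c (Or.inl h), Matrix.one_apply]
        · simp only [hU _ c (Or.inr h), Matrix.one_apply, mul_ite, mul_one, mul_zero,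
            Finset.sum_ite_eq', Finset.mem_univ, if_true]
          rw [hE r c (Or.inr h), Matrix.one_apply]
      · rw [Units.val_mul, ← mulVec_mulVec, ← ha', embedSL2_mulVec]
        have hjt : j ≠ t := (hS j hj).ne'
        rw [if_neg hjt]
        by_cases h : j = i
        · rw [if_pos h]; exact hM
        · rw [if_neg h]; exact hUa j (Finset.mem_of_mem_insert_of_ne hj h)
  obtain ⟨U, hU, hUa⟩ := key (Finset.univ.filter fun i => t < i) (by simp)
  exact ⟨U, hU, fun i hi => hUa i (by simp [hi])⟩

/-- Row `l` of `Aᵀ D` involves only rows up to `l` of `D`, and the rows before `l` are known by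
induction. The point is that the diagonal entries of `A` are nonzero. -/
theorem triangular_relations {A D : Matrix (Fin n) (Fin n) ℤ} {m : ℤ} (hm : m ≠ 0) {t : ℕ}
    (hA : ∀ j : Fin n, (j : ℕ) < t → ∀ i, j < i → A i j = 0)
    (h : ∀ l : Fin n, (l : ℕ) < t → ∀ j, (Aᵀ * D) l j = if l = j then m else 0) (l : Fin n) :
    (l : ℕ) < t → A l l * D l l = m ∧ ∀ j, l < j → D l j = 0 := by
  classical
  induction l using WellFoundedLT.induction with
  | ind l ih =>
  intro hl
  have key : ∀ j, l ≤ j → A l l * D l j = if l = j then m else 0 := by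
    intro j hj
    rw [← h l hl j, Matrix.mul_apply, Finset.sum_eq_single l]
    · rfl
    · intro r _ hr
      rw [transpose_apply]
      rcases lt_or_gt_of_ne hr with h' | h'
      · rw [(ih r h' (lt_trans h' hl)).2 j (h'.trans_le hj), mul_zero]
      · rw [hA l hl r h', zero_mul]
    · simp
  have h1 := key l le_rfl
  rw [if_pos rfl] at h1
  refine ⟨h1, fun j hj => ?_⟩
  have h2 := key j hj.le
  rw [if_neg hj.ne] at h2
  exact (mul_eq_zero.mp h2).resolve_left fun h0 => hm (by rw [← h1, h0, zero_mul])

/-- Entry `(l, j)` of `Cᵀ A` vanishes because column `l` of `C` does, while by induction that of `Aᵀ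
C` is `A l l * C l j`. So if the first columns of `C` vanish, the first rows do too. -/
theorem lower_left_eq_zero {A C : Matrix (Fin n) (Fin n) ℤ} (hAC : Aᵀ * C = Cᵀ * A) {t : ℕ}
    (hA : ∀ j : Fin n, (j : ℕ) < t → ∀ i, j < i → A i j = 0)
    (hA0 : ∀ j : Fin n, (j : ℕ) < t → A j j ≠ 0)
    (hC : ∀ j : Fin n, (j : ℕ) < t → ∀ i, C i j = 0) (j l : Fin n) : (l : ℕ) < t → C l j = 0 := by
  induction l using WellFoundedLT.induction with
  | ind l ih =>
  intro hl
  have h := congrFun (congrFun hAC l) j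
  rw [Matrix.mul_apply, Matrix.mul_apply, Finset.sum_eq_single l,
    Finset.sum_eq_zero (fun r _ => by rw [transpose_apply, hC l hl, zero_mul])] at h
  · exact (mul_eq_zero.mp h).resolve_left (hA0 l hl)
  · intro r _ hr
    rw [transpose_apply]
    rcases lt_or_gt_of_ne hr with h' | h'
    · rw [ih r h' (lt_trans h' hl), mul_zero]
    · rw [hA l hl r h', zero_mul]
  · simp

/-- The first `t` columns of `g` are zero below the diagonal. -/
def UpperTo (t : ℕ) (g : Mat2 n) : Prop :=
  ∀ j : Fin n, (j : ℕ) < t → (∀ i, j < i → g.toBlocks₁₁ i j = 0) ∧ ∀ i, g.toBlocks₂₁ i j = 0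

/-- Induction on the number of cleared columns. For column `t`, copies of `SL_2` pairing row `i` of
`A` with row `i` of `C` kill the column of `C`, and then an element of `GL_n(ℤ)` triangularizes the
column of `A`. -/
theorem exists_upperTo (G : Subgroup (Sp n)) (hd : ∀ M, diagSp M ∈ G) (hl : ∀ U, levi U ∈ G)
    {m : ℕ} (x : Similitude n m) {t : ℕ} (ht : t ≤ n) : ∃ γ ∈ G, UpperTo t (lmul γ x).1 := by
  classical
  induction t with
  | zero => exact ⟨1, one_mem _, fun j hj => absurd hj (Nat.not_lt_zero _)⟩
  | succ t ih =>
  obtain ⟨γ, hγ, hx⟩ := ih (Nat.le_of_succ_le ht)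
  generalize hy : lmul γ x = y at hx
  suffices h : ∃ γ' ∈ G, UpperTo (t + 1) (lmul γ' y).1 by
    obtain ⟨γ', hγ', h⟩ := h
    exact ⟨γ' * γ, mul_mem hγ' hγ, by rwa [lmul_mul, hy]⟩
  obtain ⟨b1, b2, -⟩ := y.blocks
  set A := y.1.toBlocks₁₁
  set B := y.1.toBlocks₁₂
  set C := y.1.toBlocks₂₁
  set D := y.1.toBlocks₂₂
  have hyb : y.1 = fromBlocks A B C D := (fromBlocks_toBlocks _).symm
  have hxA : ∀ j : Fin n, (j : ℕ) < t → ∀ i, j < i → A i j = 0 := fun j hj => (hx j hj).1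
  have hxC : ∀ j : Fin n, (j : ℕ) < t → ∀ i, C i j = 0 := fun j hj => (hx j hj).2
  clear_value A B C D
  have hm : (m : ℤ) ≠ 0 := by exact_mod_cast y.2.1.ne'
  have hA0 : ∀ j : Fin n, (j : ℕ) < t → A j j ≠ 0 := fun j hj h0 => by
    have := (triangular_relations (D := D) hm hxA (fun l hl j => by
      have h := congrFun (congrFun b2 l) j
      rw [Matrix.sub_apply, Matrix.mul_apply (M := Cᵀ), Finset.sum_eq_zero (fun r _ => by
        rw [transpose_apply, hxC l hl, zero_mul]), sub_zero] at h
      rw [h, Matrix.smul_apply, Matrix.one_apply]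
      simp) j hj).1
    rw [h0, zero_mul] at this
    exact hm this.symm
  let t' : Fin n := ⟨t, ht⟩
  have hC0 := lower_left_eq_zero b1 hxA hA0 hxC t'
  choose M hM using fun i => exists_SL2_bottom_eq_zero (A i t') (C i t')
  -- The first `t` rows are left alone: `hC0` already gives zero there, and mixing them with `C` is
  -- unnecessary.
  let M' : Fin n → SpecialLinearGroup (Fin 2) ℤ := fun i => if (i : ℕ) < t then 1 else M i
  let A' := diagonal (fun i => M' i 0 0) * A + diagonal (fun i => M' i 0 1) * C
  let C' := diagonal (fun i => M' i 1 0) * A + diagonal (fun i => M' i 1 1) * C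
  have hA' : ∀ i j, A' i j = M' i 0 0 * A i j + M' i 0 1 * C i j := fun i j => by
    simp [A', diagonal_mul]
  have hC' : ∀ i j, C' i j = M' i 1 0 * A i j + M' i 1 1 * C i j := fun i j => by
    simp [C', diagonal_mul]
  have hC't : ∀ j : Fin n, (j : ℕ) < t + 1 → ∀ i, C' i j = 0 := fun j hj i => by
    rw [hC']
    rcases Nat.lt_succ_iff_lt_or_eq.mp hj with h | h
    · rw [hxC j h, mul_zero, add_zero]
      by_cases hi : (i : ℕ) < t
      · simp [M', hi]
      · rw [hxA j h i (Fin.lt_def.mpr (lt_of_lt_of_le h (not_lt.mp hi))), mul_zero]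
    · have hj' : j = t' := Fin.ext h
      subst hj'
      by_cases hi : (i : ℕ) < t
      · rw [hC0 i hi]; simp [M', hi]
      · simp only [M', if_neg hi]; exact hM i
  have hA't : ∀ j : Fin n, (j : ℕ) < t → ∀ i, j < i → A' i j = 0 := fun j hj i hi => by
    rw [hA', hxA j hj i hi, hxC j hj, mul_zero, mul_zero, add_zero]
  obtain ⟨U, hU, hUa⟩ := exists_GL_clear_column t' (fun i => A' i t')
  refine ⟨levi U * diagSp M', mul_mem (hl _) (hd _), ?_⟩
  have hz : ∃ B'' D'', (lmul (levi U * diagSp M') y).1 =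
      fromBlocks ((U : Matrix (Fin n) (Fin n) ℤ) * A') B''
        (((U⁻¹ : GL (Fin n) ℤ) : Matrix (Fin n) (Fin n) ℤ)ᵀ * C') D'' := by
    refine ⟨(U : Matrix (Fin n) (Fin n) ℤ) *
        (diagonal (fun i => M' i 0 0) * B + diagonal (fun i => M' i 0 1) * D),
      ((U⁻¹ : GL (Fin n) ℤ) : Matrix (Fin n) (Fin n) ℤ)ᵀ *
        (diagonal (fun i => M' i 1 0) * B + diagonal (fun i => M' i 1 1) * D), ?_⟩
    rw [lmul_mul, coe_lmul, coe_lmul, coe_levi, coe_diagSp, hyb, fromBlocks_multiply,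
      fromBlocks_multiply]
    simp only [Matrix.zero_mul, add_zero, zero_add]
    rfl
  obtain ⟨B'', D'', hz⟩ := hz
  rw [hz]
  intro j hj
  rw [toBlocks_fromBlocks₁₁, toBlocks_fromBlocks₂₁]
  refine ⟨fun i hi => ?_, fun i => ?_⟩
  · rcases Nat.lt_succ_iff_lt_or_eq.mp hj with h | h
    · rw [Matrix.mul_apply]
      by_cases hit : i < t'
      · simp only [hU i _ (Or.inl hit), Matrix.one_apply, ite_mul, one_mul, zero_mul,
          Finset.sum_ite_eq, Finset.mem_univ, if_true]
        exact hA't j h i hi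
      · refine Finset.sum_eq_zero fun r _ => ?_
        by_cases hr : r < t'
        · rw [hU i r (Or.inr hr), Matrix.one_apply_ne (fun h' => hit (lt_of_eq_of_lt h' hr)), zero_mul]
        · rw [hA't j h r (lt_of_lt_of_le h (not_lt.mp hr)), mul_zero]
    · have hj' : j = t' := Fin.ext h
      subst hj'
      exact hUa i hi
  · rw [Matrix.mul_apply]
    exact Finset.sum_eq_zero fun r _ => by rw [hC't j hj, mul_zero]

theorem exists_upper (G : Subgroup (Sp n)) (hd : ∀ M, diagSp M ∈ G) (hl : ∀ U, levi U ∈ G)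
    {m : ℕ} (x : Similitude n m) : ∃ γ ∈ G, (lmul γ x).1.toBlocks₂₁ = 0 ∧
      ∀ i j, j < i → (lmul γ x).1.toBlocks₁₁ i j = 0 := by
  obtain ⟨γ, hγ, h⟩ := exists_upperTo G hd hl x le_rfl
  exact ⟨γ, hγ, by ext i j; exact (h j j.2).2 i, fun i j hij => (h j j.2).1 i hij⟩

/-- `Sp_{2n}(ℤ)` is generated by copies of `SL_2(ℤ)`, `GL_n(ℤ)` and the translations. -/
theorem eq_top_of_generators (G : Subgroup (Sp n)) (hd : ∀ M, diagSp M ∈ G)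
    (hl : ∀ U, levi U ∈ G) (ht : ∀ S hS, transl S hS ∈ G) : G = ⊤ := by
  rw [Subgroup.eq_top_iff']
  intro γ
  obtain ⟨δ, hδ, hC, -⟩ := exists_upper G hd hl γ.toSimilitude
  rw [coe_lmul, coe_toSimilitude, ← Submonoid.coe_mul] at hC
  suffices h : δ * γ ∈ G by
    have := mul_mem (inv_mem hδ) h
    rwa [inv_mul_cancel_left] at this
  generalize δ * γ = g at hC
  obtain ⟨-, b2, b3⟩ := g.blocks
  have hg : g.1 = fromBlocks g.1.toBlocks₁₁ g.1.toBlocks₁₂ g.1.toBlocks₂₁ g.1.toBlocks₂₂ :=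
    (fromBlocks_toBlocks _).symm
  rw [hC] at b2 hg
  generalize g.1.toBlocks₁₁ = A at *
  generalize g.1.toBlocks₁₂ = B at *
  generalize g.1.toBlocks₂₂ = D at *
  rw [transpose_zero, Matrix.zero_mul, sub_zero] at b2
  have b2' : Dᵀ * A = 1 := by
    have := congrArg transpose b2
    rwa [transpose_mul, transpose_transpose, transpose_one] at this
  -- With `C = 0` the matrix lies in the Siegel parabolic and splits as a Levi element times a
  -- translation.
  let U : GL (Fin n) ℤ := ⟨A, Dᵀ, mul_eq_one_comm.mp b2', b2'⟩
  have hS : (Dᵀ * B)ᵀ = Dᵀ * B := by rw [transpose_mul, transpose_transpose, b3]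
  have : g = levi U * transl (Dᵀ * B) hS := by
    apply Subtype.ext
    rw [hg, Submonoid.coe_mul, coe_levi, coe_transl, fromBlocks_multiply]
    have h1 : (U : Matrix (Fin n) (Fin n) ℤ) = A := rfl
    have h2 : ((U⁻¹ : GL (Fin n) ℤ) : Matrix (Fin n) (Fin n) ℤ) = Dᵀ := rfl
    rw [h1, h2, ← Matrix.mul_assoc, mul_eq_one_comm.mp b2']
    simp
  rw [this]
  exact mul_mem (hl _) (ht _ _)

end Symplectic

/-! ### Reduction of symplectic matrices and conjugation by `diag(u, 1)` -/

section Reduction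

variable {n : ℕ}

/-- Reduction modulo `M` of integral matrices. -/
abbrev red (M : ℕ) (x : Mat2 n) : Matrix (Fin n ⊕ Fin n) (Fin n ⊕ Fin n) (ZMod M) :=
  x.map (Int.cast : ℤ → ZMod M)

theorem red_mul (M : ℕ) (x y : Mat2 n) : red M (x * y) = red M x * red M y :=
  Matrix.map_mul (f := Int.castRingHom (ZMod M))

theorem red_one (M : ℕ) : red M (1 : Mat2 n) = 1 :=
  Matrix.map_one (Int.castRingHom (ZMod M)) (map_zero _) (map_one _)

theorem reduceSp_apply (M : ℕ) (γ : Sp n) : reduceSp n M γ = red M (γ : Mat2 n) := rfl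

theorem mem_Gam_iff {M : ℕ} {γ : Sp n} : γ ∈ Gam n M ↔ red M (γ : Mat2 n) = 1 := Iff.rfl

theorem red_inv_mul (M : ℕ) (γ : Sp n) :
    red M ((γ⁻¹ : Sp n) : Mat2 n) * red M (γ : Mat2 n) = 1 := by
  rw [← red_mul, ← Submonoid.coe_mul, inv_mul_cancel, Submonoid.coe_one, red_one]

theorem red_mul_inv (M : ℕ) (γ : Sp n) :
    red M (γ : Mat2 n) * red M ((γ⁻¹ : Sp n) : Mat2 n) = 1 := by
  rw [← red_mul, ← Submonoid.coe_mul, mul_inv_cancel, Submonoid.coe_one, red_one]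

theorem mul_inv_mem_Gam {M : ℕ} {γ γ' : Sp n} (h : red M (γ : Mat2 n) = red M (γ' : Mat2 n)) :
    γ * γ'⁻¹ ∈ Gam n M := by
  rw [mem_Gam_iff, Submonoid.coe_mul, red_mul, h, red_mul_inv]

/-- The matrix `diag(u, 1)` over `ℤ/M`. -/
def epsMatrix (n M : ℕ) (u : ZMod M) : Matrix (Fin n ⊕ Fin n) (Fin n ⊕ Fin n) (ZMod M) :=
  fromBlocks (u • 1) 0 0 1

theorem epsMatrix_mul (M : ℕ) (u v : ZMod M) :
    epsMatrix n M u * epsMatrix n M v = epsMatrix n M (u * v) := by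
  simp [epsMatrix, fromBlocks_multiply, smul_smul, mul_comm]

theorem epsMatrix_one (M : ℕ) : epsMatrix n M 1 = 1 := by
  simp [epsMatrix]

/-- The elements of `Sp_{2n}(ℤ)` whose conjugate by `diag(u, 1)` modulo `M` lifts to
`Sp_{2n}(ℤ)`. -/
def epsLiftable (n M : ℕ) (u : (ZMod M)ˣ) : Subgroup (Sp n) where
  carrier := {γ | ∃ γ' : Sp n, red M (γ' : Mat2 n) * epsMatrix n M u =
    epsMatrix n M u * red M (γ : Mat2 n)}
  mul_mem' := by
    rintro γ δ ⟨γ', h⟩ ⟨δ', h'⟩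
    refine ⟨γ' * δ', ?_⟩
    rw [Submonoid.coe_mul, Submonoid.coe_mul, red_mul, red_mul, Matrix.mul_assoc, h',
      ← Matrix.mul_assoc, h, Matrix.mul_assoc]
  one_mem' := ⟨1, by simp⟩
  inv_mem' := by
    rintro γ ⟨γ', h⟩
    refine ⟨γ'⁻¹, ?_⟩
    calc red M ((γ'⁻¹ : Sp n) : Mat2 n) * epsMatrix n M u
        = red M ((γ'⁻¹ : Sp n) : Mat2 n) * (epsMatrix n M u * red M (γ : Mat2 n)) *
          red M ((γ⁻¹ : Sp n) : Mat2 n) := by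
          rw [Matrix.mul_assoc, Matrix.mul_assoc, red_mul_inv, Matrix.mul_one]
      _ = _ := by rw [← h, ← Matrix.mul_assoc, red_inv_mul, Matrix.one_mul]

/-- The liftable elements are closed under products and inverses, so it suffices to treat the
generators `S` and `T` of `SL_2(ℤ)`. -/
theorem exists_SL2_lift (M : ℕ) (u : (ZMod M)ˣ) (g : SpecialLinearGroup (Fin 2) ℤ) :
    ∃ g' : SpecialLinearGroup (Fin 2) ℤ, ((g' 0 0 : ℤ) : ZMod M) = g 0 0 ∧
      ((g' 0 1 : ℤ) : ZMod M) = u * g 0 1 ∧ ((g' 1 0 : ℤ) : ZMod M) * u = g 1 0 ∧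
      ((g' 1 1 : ℤ) : ZMod M) = g 1 1 := by
  obtain ⟨a, ha⟩ := ZMod.intCast_surjective (u : ZMod M)
  obtain ⟨c, hc⟩ := ZMod.intCast_surjective ((u⁻¹ : (ZMod M)ˣ) : ZMod M)
  have hac : ((a * c : ℤ) : ZMod M) = 1 := by push_cast; rw [ha, hc, Units.mul_inv]
  have hcu : (c : ZMod M) * u = 1 := by rw [hc, Units.inv_mul]
  have hS : ∃ g' : SpecialLinearGroup (Fin 2) ℤ, ((g' 0 0 : ℤ) : ZMod M) = 0 ∧
      ((g' 0 1 : ℤ) : ZMod M) = - u ∧ ((g' 1 0 : ℤ) : ZMod M) * u = 1 ∧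
      ((g' 1 1 : ℤ) : ZMod M) = 0 := by
    -- The determinant is identically `1`, and since `a * c ≡ 1` the matrix reduces to `[0 -u; u⁻¹
    -- 0]`, the conjugate of `S` by `diag(u, 1)`.
    refine ⟨⟨!![1 - a * c, -a * (1 - a * c) - a; c, 1 - a * c], ?_⟩, ?_, ?_, ?_, ?_⟩
    · rw [det_fin_two_of]; ring
    · have h : ((1 - a * c : ℤ) : ZMod M) = 0 := by rw [Int.cast_sub, hac]; simp
      exact h
    · have h : ((-a * (1 - a * c) - a : ℤ) : ZMod M) = - u := by
        have : -a * (1 - a * c) - a = -a * (1 - (a * c : ℤ)) - a := rfl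
        rw [this, Int.cast_sub, Int.cast_mul, Int.cast_sub, hac, ha]
        simp
      exact h
    · simp [hcu]
    · have h : ((1 - a * c : ℤ) : ZMod M) = 0 := by rw [Int.cast_sub, hac]; simp
      exact h
  have hmem : g ∈ Subgroup.closure {ModularGroup.S, ModularGroup.T} := by
    rw [SpecialLinearGroup.SL2Z_generators]; trivial
  induction hmem using Subgroup.closure_induction with
  | mem x hx =>
    rcases hx with rfl | rfl
    · obtain ⟨g', h1, h2, h3, h4⟩ := hS
      exact ⟨g', by simp [h1, ModularGroup.S], by simp [h2, ModularGroup.S],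
        by simp [h3, ModularGroup.S], by simp [h4, ModularGroup.S]⟩
    · exact ⟨⟨!![1, a; 0, 1], by simp⟩, by simp [ModularGroup.T], by simp [ModularGroup.T, ha],
        by simp [ModularGroup.T], by simp [ModularGroup.T]⟩
  | one => exact ⟨1, by simp, by simp, by simp, by simp⟩
  | mul x y _ _ hx hy =>
    obtain ⟨x', a1, a2, a3, a4⟩ := hx
    obtain ⟨y', b1, b2, b3, b4⟩ := hy
    have hm : ∀ (g h : SpecialLinearGroup (Fin 2) ℤ) i j,
        (g * h) i j = g i 0 * h 0 j + g i 1 * h 1 j := fun g h i j => by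
      rw [← Fin.sum_univ_two fun k => g i k * h k j]; rfl
    refine ⟨x' * y', ?_, ?_, ?_, ?_⟩ <;> simp only [hm, Int.cast_add, Int.cast_mul]
    · rw [a1, b1, a2, ← b3]
      ring
    · rw [a1, b2, a2, b4]; ring
    · rw [add_mul, mul_right_comm, a3, b1, mul_assoc, b3, a4]
    · rw [b2, ← mul_assoc, a3, a4, b4]
  | inv x _ hx =>
    obtain ⟨x', a1, a2, a3, a4⟩ := hx
    refine ⟨x'⁻¹, ?_, ?_, ?_, ?_⟩ <;> simp [SpecialLinearGroup.SL2_inv_expl, a1, a2, a3, a4]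

/-- The matrix `diag(u, 1)` is a symplectic similitude modulo `M` and normalizes the symplectic
group. Checking generators of `Sp_{2n}(ℤ)` shows that conjugates of reductions are reductions again.
This is used for the stability of double cosets under `S ↦ c S`. -/
theorem epsLiftable_eq_top (n M : ℕ) (u : (ZMod M)ˣ) : epsLiftable n M u = ⊤ := by
  have hr : ∀ A B C D : Matrix (Fin n) (Fin n) ℤ, red M (fromBlocks A B C D) =
      fromBlocks (A.map Int.cast) (B.map Int.cast) (C.map Int.cast) (D.map Int.cast) :=
    fun A B C D => fromBlocks_map A B C D _
  refine eq_top_of_generators _ (fun g => ?_) (fun U => ?_) fun S hS => ?_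
  · choose g' h1 h2 h3 h4 using fun i => exists_SL2_lift M u (g i)
    refine ⟨diagSp g', ?_⟩
    rw [coe_diagSp, coe_diagSp, hr, hr, epsMatrix, fromBlocks_multiply, fromBlocks_multiply]
    simp only [diagonal_map Int.cast_zero]
    simp only [Matrix.mul_smul, Matrix.mul_one, Matrix.mul_zero, add_zero, zero_add,
      Matrix.smul_mul, Matrix.one_mul, Matrix.zero_mul]
    congr 1
    · simp [h1]
    · rw [← diagonal_smul]; congr 1; funext i; exact h2 i
    · rw [← diagonal_smul]; congr 1; funext i; rw [← h3 i, mul_comm]; rfl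
    · simp [h4]
  · refine ⟨levi U, ?_⟩
    rw [coe_levi, hr, epsMatrix, fromBlocks_multiply, fromBlocks_multiply]
    simp
  · obtain ⟨a, ha⟩ := ZMod.intCast_surjective (u : ZMod M)
    refine ⟨transl (a • S) (by rw [transpose_smul, hS]), ?_⟩
    rw [coe_transl, coe_transl, hr, hr, epsMatrix, fromBlocks_multiply, fromBlocks_multiply]
    have h1 : (a • S).map (Int.cast : ℤ → ZMod M) = (u : ZMod M) • S.map Int.cast := by
      ext i j
      rw [Matrix.map_apply, Matrix.smul_apply, smul_eq_mul, Int.cast_mul, ha]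
      rfl
    rw [h1]
    simp

theorem exists_eps_lift (M : ℕ) (u : (ZMod M)ˣ) (γ : Sp n) :
    ∃ γ' : Sp n, red M (γ' : Mat2 n) * epsMatrix n M u =
      epsMatrix n M u * red M (γ : Mat2 n) :=
  (epsLiftable_eq_top n M u ▸ Subgroup.mem_top γ : γ ∈ epsLiftable n M u)

/-- Two similitudes that agree modulo `N m` lie in the same left coset of `Γ(N)`. -/
theorem exists_Gam_of_red_eq {N m : ℕ} (x y : Similitude n m)
    (h : red (N * m) x.1 = red (N * m) y.1) : ∃ γ ∈ Gam n N, y = lmul γ x := by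
  have hm : (m : ℤ) ≠ 0 := by exact_mod_cast x.2.1.ne'
  obtain ⟨E, hE⟩ : ∃ E : Mat2 n, y.1 = x.1 + ((N * m : ℕ) : ℤ) • E := by
    have : ∀ i j, ∃ e : ℤ, y.1 i j = x.1 i j + ((N * m : ℕ) : ℤ) * e := fun i j => by
      have h1 := congrFun (congrFun h i) j
      simp only [Matrix.map_apply] at h1
      obtain ⟨e, he⟩ := (ZMod.intCast_eq_intCast_iff_dvd_sub _ _ _).mp h1
      exact ⟨e, by rw [← he]; ring⟩
    choose E hE using this
    exact ⟨Matrix.of E, by ext i j; simp [hE]⟩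
  have hJJ : J (Fin n) ℤ * J (Fin n) ℤ = -1 := J_squared _ _
  -- `x⁻¹ = -m⁻¹ J xᵀ J`
  have hx1 : (-(J (Fin n) ℤ * x.1ᵀ * J (Fin n) ℤ)) * x.1 = (m : ℤ) • 1 := by
    rw [Matrix.neg_mul, Matrix.mul_assoc, Matrix.mul_assoc, ← Matrix.mul_assoc x.1ᵀ, x.2.2,
      Matrix.mul_smul, hJJ]
    simp
  have hcancel : ∀ {Y Z : Mat2 n}, (m : ℤ) • Y = (m : ℤ) • Z → Y = Z := fun {Y Z} h => by
    ext i j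
    have := congrFun (congrFun h i) j
    simp only [Matrix.smul_apply, smul_eq_mul] at this
    exact mul_left_cancel₀ hm this
  have hx2 : x.1 * (-(J (Fin n) ℤ * x.1ᵀ * J (Fin n) ℤ)) = (m : ℤ) • 1 := by
    set x' := -(J (Fin n) ℤ * x.1ᵀ * J (Fin n) ℤ)
    have hdet : x'.det * x.1.det ≠ 0 := by
      rw [← det_mul, hx1, det_smul, det_one, mul_one]
      exact pow_ne_zero _ hm
    have h3 : x' * (x.1 * x') = x' * ((m : ℤ) • 1) := by
      rw [← Matrix.mul_assoc, hx1, Matrix.smul_mul, Matrix.mul_smul, Matrix.one_mul,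
        Matrix.mul_one]
    have h4 := congrArg (fun Y => x'.adjugate * Y) h3
    simp only [← Matrix.mul_assoc, adjugate_mul] at h4
    rw [Matrix.mul_assoc (x'.det • 1), Matrix.smul_mul, Matrix.one_mul, Matrix.smul_mul,
      Matrix.one_mul] at h4
    ext i j
    have := congrFun (congrFun h4 i) j
    simp only [Matrix.smul_apply, smul_eq_mul] at this
    simpa using mul_left_cancel₀ (left_ne_zero_of_mul hdet) this
  set x' := -(J (Fin n) ℤ * x.1ᵀ * J (Fin n) ℤ) with hx'
  -- This is `y x⁻¹`: here `y = x + N m E`, and `x' = m x⁻¹` is integral, so the denominator `m`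
  -- disappears and a multiple of `N` remains.
  let γ₀ : Mat2 n := 1 + (N : ℤ) • (E * x')
  have hγx : γ₀ * x.1 = y.1 := by
    rw [Matrix.add_mul, Matrix.one_mul, Matrix.smul_mul, Matrix.mul_assoc, hx1, hE,
      Matrix.mul_smul, Matrix.mul_one, smul_smul, Nat.cast_mul]
  have hform : γ₀ᵀ * J (Fin n) ℤ * γ₀ = J (Fin n) ℤ := by
    have h1 : x.1ᵀ * (γ₀ᵀ * J (Fin n) ℤ * γ₀) * x.1 = x.1ᵀ * J (Fin n) ℤ * x.1 := by
      refine Eq.trans ?_ (y.2.2.trans x.2.2.symm)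
      rw [← hγx, transpose_mul]
      simp only [Matrix.mul_assoc]
    have h2 := congrArg (fun Y => x'ᵀ * Y * x') h1
    have h3 : ∀ Y : Mat2 n, x'ᵀ * (x.1ᵀ * Y * x.1) * x' = (m : ℤ) • (m : ℤ) • Y := fun Y => by
      calc x'ᵀ * (x.1ᵀ * Y * x.1) * x' = (x.1 * x')ᵀ * Y * (x.1 * x') := by
            rw [transpose_mul]; simp only [Matrix.mul_assoc]
        _ = _ := by
            rw [hx2, transpose_smul, transpose_one, Matrix.smul_mul, Matrix.one_mul,
              Matrix.mul_smul, Matrix.mul_one]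
    simp only [h3] at h2
    exact hcancel (hcancel h2)
  refine ⟨⟨γ₀, SymplecticGroup.mem_iff'.mpr hform⟩, ?_, Subtype.ext hγx.symm⟩
  rw [mem_Gam_iff]
  ext i j
  simp only [γ₀, Matrix.map_apply, Matrix.add_apply, Matrix.smul_apply, smul_eq_mul, Int.cast_add,
    Int.cast_mul, Int.cast_natCast, ZMod.natCast_self, zero_mul, add_zero, Matrix.one_apply]
  split_ifs <;> simp

end Reduction

/-! ### The slash action -/

section Slash

variable {n : ℕ}

theorem numer_mul (x y : Mat2 n) (Z : Matrix (Fin n) (Fin n) ℂ) :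
    numer (x * y) Z = x.toBlocks₁₁.map (Int.cast : ℤ → ℂ) * numer y Z +
      x.toBlocks₁₂.map (Int.cast : ℤ → ℂ) * denom y Z ∧
    denom (x * y) Z = x.toBlocks₂₁.map (Int.cast : ℤ → ℂ) * numer y Z +
      x.toBlocks₂₂.map (Int.cast : ℤ → ℂ) * denom y Z := by
  have hmul : ∀ A B : Matrix (Fin n) (Fin n) ℤ, (A * B).map (Int.cast : ℤ → ℂ) =
      A.map Int.cast * B.map Int.cast := fun A B => Matrix.map_mul (f := Int.castRingHom ℂ)
  have hadd : ∀ A B : Matrix (Fin n) (Fin n) ℤ, (A + B).map (Int.cast : ℤ → ℂ) =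
      A.map Int.cast + B.map Int.cast := fun A B => Matrix.map_add _ (by simp) _ _
  have hxy : x * y = fromBlocks
      (x.toBlocks₁₁ * y.toBlocks₁₁ + x.toBlocks₁₂ * y.toBlocks₂₁)
      (x.toBlocks₁₁ * y.toBlocks₁₂ + x.toBlocks₁₂ * y.toBlocks₂₂)
      (x.toBlocks₂₁ * y.toBlocks₁₁ + x.toBlocks₂₂ * y.toBlocks₂₁)
      (x.toBlocks₂₁ * y.toBlocks₁₂ + x.toBlocks₂₂ * y.toBlocks₂₂) := by
    rw [← fromBlocks_multiply, fromBlocks_toBlocks, fromBlocks_toBlocks]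
  constructor
  · rw [numer, hxy, toBlocks_fromBlocks₁₁, toBlocks_fromBlocks₁₂, numer, denom]
    simp only [hadd, hmul, Matrix.mul_add, Matrix.add_mul, Matrix.mul_assoc]
    abel
  · rw [denom, hxy, toBlocks_fromBlocks₂₁, toBlocks_fromBlocks₂₂, numer, denom]
    simp only [hadd, hmul, Matrix.mul_add, Matrix.add_mul, Matrix.mul_assoc]
    abel

variable {m m' m'' : ℕ} {x : Similitude n m} {y : Similitude n m'} {z : Similitude n m''}

theorem moebius_coe (Z : UpperHalf n) : (moebius x Z : Matrix (Fin n) (Fin n) ℂ) =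
    numer x.1 Z * (denom x.1 Z)⁻¹ := rfl

theorem numer_denom_of_eq_mul (h : z.1 = x.1 * y.1) (Z : UpperHalf n) :
    numer z.1 Z = numer x.1 (moebius y Z) * denom y.1 Z ∧
    denom z.1 Z = denom x.1 (moebius y Z) * denom y.1 Z := by
  have hu : IsUnit (denom y.1 Z).det := (denom_det_ne_zero y Z).isUnit
  obtain ⟨h1, h2⟩ := numer_mul x.1 y.1 (Z : Matrix (Fin n) (Fin n) ℂ)
  have key : ∀ A B : Matrix (Fin n) (Fin n) ℂ,
      A * numer y.1 Z + B * denom y.1 Z = (A * moebius y Z + B) * denom y.1 Z := fun A B => by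
    rw [moebius_coe, Matrix.add_mul, Matrix.mul_assoc A, nonsing_inv_mul_cancel_right _ _ hu]
  rw [h, h1, h2]
  exact ⟨key _ _, key _ _⟩

theorem moebius_of_eq_mul (h : z.1 = x.1 * y.1) (Z : UpperHalf n) :
    moebius z Z = moebius x (moebius y Z) := by
  have hu : IsUnit (denom y.1 Z).det := (denom_det_ne_zero y Z).isUnit
  obtain ⟨h1, h2⟩ := numer_denom_of_eq_mul h Z
  apply Subtype.ext
  rw [moebius_coe, h1, h2, Matrix.mul_inv_rev, Matrix.mul_assoc, mul_nonsing_inv_cancel_left _ _ hu]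
  rfl

theorem autFactor_of_eq_mul (h : z.1 = x.1 * y.1) (Z : UpperHalf n) :
    autFactor z Z = autFactor x (moebius y Z) * autFactor y Z :=
  Units.ext (numer_denom_of_eq_mul h Z).2

variable {W : Type*} [NormedAddCommGroup W] [NormedSpace ℂ W]
  (ρ : Representation ℂ (GL (Fin n) ℂ) W)

theorem slash_apply (f : UpperHalf n → W) (Z : UpperHalf n) :
    slash ρ x f Z = ρ (autFactor x Z)⁻¹ (f (moebius x Z)) := rfl

theorem slash_of_eq_mul (h : z.1 = x.1 * y.1) (f : UpperHalf n → W) :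
    slash ρ z f = slash ρ y (slash ρ x f) := by
  funext Z
  rw [slash_apply, slash_apply, slash_apply, autFactor_of_eq_mul h, moebius_of_eq_mul h,
    _root_.mul_inv_rev, map_mul, Module.End.mul_apply]

theorem slash_one (f : UpperHalf n → W) : slash ρ (1 : Sp n).toSimilitude f = f := by
  funext Z
  have h1 : numer (1 : Sp n).toSimilitude.1 Z = Z := by
    rw [coe_toSimilitude, Submonoid.coe_one, numer, ← fromBlocks_one, toBlocks_fromBlocks₁₁,
      toBlocks_fromBlocks₁₂]
    simp
  have h2 : denom (1 : Sp n).toSimilitude.1 Z = 1 := by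
    rw [coe_toSimilitude, Submonoid.coe_one, denom, ← fromBlocks_one, toBlocks_fromBlocks₂₁,
      toBlocks_fromBlocks₂₂]
    simp
  have h3 : moebius (1 : Sp n).toSimilitude Z = Z := by
    apply Subtype.ext
    rw [moebius_coe, h1, h2, inv_one, Matrix.mul_one]
  have h4 : autFactor (1 : Sp n).toSimilitude Z = 1 := Units.ext h2
  rw [slash_apply, h3, h4, inv_one, map_one]
  rfl

theorem slash_mul (γ δ : Sp n) (f : UpperHalf n → W) :
    slash ρ (γ * δ).toSimilitude f = slash ρ δ.toSimilitude (slash ρ γ.toSimilitude f) :=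
  slash_of_eq_mul ρ rfl f

theorem slash_lmul (γ : Sp n) (x : Similitude n m) (f : UpperHalf n → W) :
    slash ρ (lmul γ x) f = slash ρ x (slash ρ γ.toSimilitude f) :=
  slash_of_eq_mul ρ rfl f

theorem slash_rmul (γ : Sp n) (x : Similitude n m) (f : UpperHalf n → W) :
    slash ρ (rmul x γ) f = slash ρ γ.toSimilitude (slash ρ x f) :=
  slash_of_eq_mul ρ rfl f

/-! ### Holomorphy -/

section Holomorphy

variable {E : Type*} [NormedAddCommGroup E] [NormedSpace ℂ E] {s : Set E}

theorem differentiableOn_aeval {σ : Type*} (p : MvPolynomial σ ℤ) {v : σ → E → ℂ}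
    (hv : ∀ i, DifferentiableOn ℂ (v i) s) :
    DifferentiableOn ℂ (fun x => MvPolynomial.aeval (fun i => v i x) p) s := by
  induction p using MvPolynomial.induction_on with
  | C a => simp
  | add p q hp hq => simpa using hp.fun_add hq
  | mul_X p i hp => simpa using hp.fun_mul (hv i)

theorem differentiableOn_det {ι : Type*} [Fintype ι] [DecidableEq ι] {v : ι → ι → E → ℂ}
    (hv : ∀ i j, DifferentiableOn ℂ (v i j) s) :
    DifferentiableOn ℂ (fun x => (Matrix.of fun i j => v i j x).det) s := by
  simp only [det_apply', of_apply]
  refine DifferentiableOn.fun_sum fun τ _ => DifferentiableOn.const_mul ?_ _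
  exact fun x hx => (HasFDerivWithinAt.finsetProd (g := fun i => v (τ i) i) fun i _ =>
    (hv (τ i) i x hx).hasFDerivWithinAt).differentiableWithinAt

theorem differentiableOn_inv {ι : Type*} [Fintype ι] [DecidableEq ι] {v : ι → ι → E → ℂ}
    (hv : ∀ i j, DifferentiableOn ℂ (v i j) s)
    (h0 : ∀ x ∈ s, (Matrix.of fun i j => v i j x).det ≠ 0) (i j : ι) :
    DifferentiableOn ℂ (fun x => (Matrix.of fun i j => v i j x)⁻¹ i j) s := by
  simp only [inv_def, Matrix.smul_apply, Ring.inverse_eq_inv', smul_eq_mul, adjugate_apply]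
  refine ((differentiableOn_det hv).fun_inv h0).fun_mul ?_
  have : ∀ x, (Matrix.of fun i j => v i j x).updateRow j (Pi.single i 1) =
      Matrix.of fun a b => (if a = j then fun _ => (Pi.single i 1 : ι → ℂ) b else v a b) x :=
    fun x => by
      ext a b
      rw [updateRow_apply]
      by_cases h : a = j <;> simp [h]
  simp only [this]
  refine differentiableOn_det fun a b => ?_
  by_cases h : a = j
  · simp [h]
  · simpa [h] using hv a b

/-- In the basis of the integral form the coefficients of `ρ` are polynomials divided by a power of
the determinant, so `ρ(g)` is holomorphic in the entries of `g`. -/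
theorem differentiableOn_rep [FiniteDimensional ℂ W] {W₀ : Submodule ℤ W} {ρ}
    (hW₀ : IsIntegralForm ρ W₀) {g : E → GL (Fin n) ℂ} {w : E → W}
    (hg : ∀ i j, DifferentiableOn ℂ (fun x => g x i j) s) (hw : DifferentiableOn ℂ w s) :
    DifferentiableOn ℂ (fun x => ρ (g x) (w x)) s := by
  obtain ⟨d, b, -, e, P, hP⟩ := hW₀
  have hP : HasCoefficients ρ b e P := hP
  have h1 : ∀ x, ρ (g x) (w x) = ∑ i, (((g x : Matrix (Fin n) (Fin n) ℂ).det ^ e)⁻¹ *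
      ∑ j, MvPolynomial.aeval (fun q : Fin n × Fin n => g x q.1 q.2) (P i j) *
        b.coord j (w x)) • b i := fun x => by
    conv_lhs => rw [← b.sum_repr (ρ (g x) (w x))]
    refine Finset.sum_congr rfl fun i _ => ?_
    congr 1
    have hd : (g x : Matrix (Fin n) (Fin n) ℂ).det ≠ 0 := (g x).det.ne_zero
    rw [eq_inv_mul_iff_mul_eq₀ (pow_ne_zero _ hd)]
    exact hP.repr (g x) (w x) i
  simp only [h1]
  refine DifferentiableOn.fun_sum fun i _ => DifferentiableOn.smul_const ?_ _
  refine DifferentiableOn.fun_mul (DifferentiableOn.fun_inv ?_ fun x _ =>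
    pow_ne_zero _ (g x).det.ne_zero) ?_
  · exact (differentiableOn_det hg).fun_pow e
  · refine DifferentiableOn.fun_sum fun j _ => DifferentiableOn.fun_mul ?_ ?_
    · exact differentiableOn_aeval _ fun q => hg q.1 q.2
    · exact (LinearMap.toContinuousLinearMap (b.coord j)).differentiable.comp_differentiableOn hw

end Holomorphy

theorem IsHolomorphic.slash [FiniteDimensional ℂ W] {W₀ : Submodule ℤ W} {ρ}
    (hW₀ : IsIntegralForm ρ W₀) (x : Similitude n m) {f : UpperHalf n → W}
    (hf : IsHolomorphic f) : IsHolomorphic (slash ρ x f) := by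
  classical
  let _ : NormedAddCommGroup (Matrix (Fin n) (Fin n) ℂ) := Matrix.normedAddCommGroup
  let _ : NormedSpace ℂ (Matrix (Fin n) (Fin n) ℂ) := Matrix.normedSpace
  set F := Function.extend Subtype.val f 0 with hF
  have hF' : ∀ Z : UpperHalf n, F Z = f Z := fun Z =>
    Subtype.val_injective.extend_apply f 0 Z
  have hf' : DifferentiableOn ℂ F (upperHalfSet n) := hf
  have hid : ∀ i j, DifferentiableOn ℂ (fun Z : Matrix (Fin n) (Fin n) ℂ => Z i j)
      (upperHalfSet n) := fun i j =>
    differentiableOn_pi.mp (differentiableOn_pi.mp (differentiableOn_id (𝕜 := ℂ)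
      (E := Fin n → Fin n → ℂ) (s := upperHalfSet n)) i) j
  have hlin : ∀ (A B : Matrix (Fin n) (Fin n) ℂ) i j, DifferentiableOn ℂ
      (fun Z : Matrix (Fin n) (Fin n) ℂ => (A * Z + B) i j) (upperHalfSet n) := fun A B i j => by
    simp only [Matrix.add_apply, Matrix.mul_apply]
    exact (DifferentiableOn.fun_sum fun r _ => (hid r j).const_mul _).add_const _
  have hnum : ∀ i j, DifferentiableOn ℂ (fun Z => numer x.1 Z i j) (upperHalfSet n) :=
    fun i j => hlin _ _ i j
  have hden : ∀ i j, DifferentiableOn ℂ (fun Z => denom x.1 Z i j) (upperHalfSet n) :=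
    fun i j => hlin _ _ i j
  have hinv := differentiableOn_inv (v := fun i j Z => denom x.1 Z i j) hden
    (fun Z hZ => denom_det_ne_zero x ⟨Z, hZ⟩)
  have hmoeb : DifferentiableOn ℂ (fun Z => numer x.1 Z * (denom x.1 Z)⁻¹) (upperHalfSet n) := by
    refine differentiableOn_pi.mpr fun i => differentiableOn_pi.mpr fun j => ?_
    simp only [Matrix.mul_apply]
    exact DifferentiableOn.fun_sum fun r _ => (hnum i r).fun_mul (hinv r j)
  -- The value `1` off the half-space is arbitrary; differentiability is only asserted on the
  -- half-space.
  let g : Matrix (Fin n) (Fin n) ℂ → GL (Fin n) ℂ := fun Z =>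
    if h : Z ∈ upperHalfSet n then (autFactor x ⟨Z, h⟩)⁻¹ else 1
  have hg : ∀ i j, DifferentiableOn ℂ (fun Z => g Z i j) (upperHalfSet n) := fun i j => by
    refine (hinv i j).congr fun Z hZ => ?_
    simp only [g, dif_pos hZ]
    rw [GeneralLinearGroup.coe_inv]
    rfl
  have key := differentiableOn_rep hW₀ hg (hf'.comp hmoeb fun Z hZ => moebius_mem x ⟨Z, hZ⟩)
  refine key.congr fun Z hZ => ?_
  have h1 := Subtype.val_injective.extend_apply (SiegelHecke.slash ρ x f) 0 (⟨Z, hZ⟩ : UpperHalf n)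
  refine h1.trans ?_
  rw [slash_apply]
  simp only [g, dif_pos hZ, Function.comp_apply]
  congr 1
  exact (hF' (moebius x ⟨Z, hZ⟩)).symm

end Slash

/-! ### Sums over cosets -/

section Cosets

variable {n N m : ℕ} {X : Set (Similitude n m)}

theorem cosetSetoid_iff {x y : X} :
    (cosetSetoid N X) x y ↔ ∃ γ ∈ Gam n N, lmul γ y.1 = x.1 := by
  change (∃ γ : Gam n N, γ • y.1.1 = x.1.1) ↔ _
  constructor
  · rintro ⟨γ, h⟩
    exact ⟨γ, γ.2, Subtype.ext h⟩
  · rintro ⟨γ, hγ, h⟩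
    exact ⟨⟨γ, hγ⟩, congrArg Subtype.val h⟩

theorem exists_lmul_out (x : X) :
    ∃ γ ∈ Gam n N, lmul γ x.1 = (Quotient.mk (cosetSetoid N X) x).out.1 :=
  cosetSetoid_iff.mp (Quotient.mk_out (s := cosetSetoid N X) x)

/-- The residue modulo `N * m` of a representative determines its coset by `exists_Gam_of_red_eq`.
Finiteness makes every `finsum` over cosets an honest sum. -/
instance finite_cosets [NeZero N] : Finite (Quotient (cosetSetoid N X)) := by
  rcases Nat.eq_zero_or_pos m with h | h
  · have : IsEmpty X := ⟨fun x => absurd x.1.2.1 (by omega)⟩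
    exact Quotient.finite _
  · have : NeZero (N * m) := ⟨mul_ne_zero (NeZero.ne N) h.ne'⟩
    refine Finite.of_injective (fun c : Quotient (cosetSetoid N X) => red (N * m) c.out.1.1)
      fun c c' hcc => ?_
    obtain ⟨γ, hγ, h'⟩ := exists_Gam_of_red_eq _ _ hcc
    rw [← Quotient.out_equiv_out, ← Quotient.eq_iff_equiv, eq_comm, Quotient.eq_iff_equiv]
    exact cosetSetoid_iff.mpr ⟨γ, hγ, h'.symm⟩

/-- Reindexing of a sum over cosets by a bijection of `X` that respects cosets. -/
theorem finsum_cosets_equiv {V : Type*} [AddCommMonoid V] (σ : Equiv.Perm (Similitude n m))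
    (hX : ∀ x, σ x ∈ X ↔ x ∈ X)
    (hσ : ∀ x y : Similitude n m, (∃ γ ∈ Gam n N, lmul γ y = x) ↔
      ∃ γ ∈ Gam n N, lmul γ (σ y) = σ x) {Φ : Similitude n m → V}
    (hΦ : ∀ x ∈ X, ∀ γ ∈ Gam n N, Φ (lmul γ x) = Φ x) :
    ∑ᶠ c : Quotient (cosetSetoid N X), Φ (σ c.out.1) =
      ∑ᶠ c : Quotient (cosetSetoid N X), Φ c.out.1 := by
  let e : X ≃ X := σ.subtypeEquiv fun x => (hX x).symm
  let e' : Quotient (cosetSetoid N X) ≃ Quotient (cosetSetoid N X) :=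
    Quotient.congr e fun x y => by
      rw [cosetSetoid_iff, cosetSetoid_iff]
      exact hσ x.1 y.1
  refine finsum_eq_of_bijective e' e'.bijective fun c => ?_
  have h1 : e' c = Quotient.mk (cosetSetoid N X) (e c.out) := by
    conv_lhs => rw [← c.out_eq]
    rfl
  rw [h1]
  obtain ⟨γ, hγ, h⟩ := exists_lmul_out (N := N) (e c.out)
  rw [← h, hΦ _ (e c.out).2 γ hγ]
  rfl

variable {W : Type*} [NormedAddCommGroup W] [NormedSpace ℂ W]
  {ρ : Representation ℂ (GL (Fin n) ℂ) W} {k : Fin n → ℤ}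

theorem heckeOp_apply [NeZero N] (f : UpperHalf n → W) : heckeOp ρ k N X f =
    ((m : ℂ) ^ ((∑ j, k j) - (n : ℤ) * (n + 1) / 2)) •
      ∑ᶠ c : Quotient (cosetSetoid N X), slash ρ c.out.1 f := by
  have := Fintype.ofFinite (Quotient (cosetSetoid N X))
  rw [heckeOp, LinearMap.smul_apply, finsum_eq_sum_of_fintype, finsum_eq_sum_of_fintype,
    LinearMap.sum_apply]

theorem slash_finsum [NeZero N] (δ : Sp n) (Φ : Quotient (cosetSetoid N X) → UpperHalf n → W) :
    slash ρ δ.toSimilitude (∑ᶠ c, Φ c) = ∑ᶠ c, slash ρ δ.toSimilitude (Φ c) := by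
  have := Fintype.ofFinite (Quotient (cosetSetoid N X))
  rw [finsum_eq_sum_of_fintype, finsum_eq_sum_of_fintype, map_sum]

/-- Right translation as a permutation. -/
def rmulEquiv (m : ℕ) (δ : Sp n) : Equiv.Perm (Similitude n m) where
  toFun x := rmul x δ
  invFun x := rmul x δ⁻¹
  left_inv x := by
    beta_reduce
    rw [← rmul_mul, mul_inv_cancel, rmul_one]
  right_inv x := by
    beta_reduce
    rw [← rmul_mul, inv_mul_cancel, rmul_one]

/-- Conjugation by `δ⁻¹` as a permutation. -/
def conjEquiv (m : ℕ) (δ : Sp n) : Equiv.Perm (Similitude n m) where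
  toFun x := rmul (lmul δ⁻¹ x) δ
  invFun x := rmul (lmul δ x) δ⁻¹
  left_inv x := by
    beta_reduce
    rw [lmul_rmul, ← rmul_mul, ← lmul_mul, mul_inv_cancel, rmul_one, one_lmul]
  right_inv x := by
    beta_reduce
    rw [lmul_rmul, ← rmul_mul, ← lmul_mul, inv_mul_cancel, rmul_one, one_lmul]

instance Gam_normal (n N : ℕ) : (Gam n N).Normal := MonoidHom.normal_ker _

theorem slash_lmul_Gam {f : UpperHalf n → W} (hf : f ∈ modularForms ρ N) {γ : Sp n}
    (hγ : γ ∈ Gam n N) (x : Similitude n m) : slash ρ (lmul γ x) f = slash ρ x f := by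
  rw [slash_lmul, hf.2 γ hγ]

/-- The properties of a set of similitudes that make its Hecke operator act on
`M_ρ(Γ(N), χ)`. -/
structure IsHeckeSet (N : ℕ) (X : Set (Similitude n m)) : Prop where
  lmul_mem : ∀ γ ∈ Gam n N, ∀ x ∈ X, lmul γ x ∈ X
  rmul_mem : ∀ γ ∈ Gam n N, ∀ x ∈ X, rmul x γ ∈ X
  conj_mem : ∀ δ : Sp n, (red N (δ : Mat2 n)).IsDiag → ∀ x ∈ X, rmul (lmul δ x) δ⁻¹ ∈ X
  isDiag : ∃ Δ, ∀ x ∈ X, red N x.1 = diagonal Δ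

/-- Right translation by an element of `Γ(N)` permutes the cosets `Γ(N) \ X`, and each summand is
holomorphic because it is a slash of `f`. -/
theorem heckeOp_mem_modularForms [NeZero N] [FiniteDimensional ℂ W] {W₀ : Submodule ℤ W}
    (hW₀ : IsIntegralForm ρ W₀) (hX : IsHeckeSet N X) {f : UpperHalf n → W}
    (hf : f ∈ modularForms ρ N) : heckeOp ρ k N X f ∈ modularForms ρ N := by
  rw [heckeOp_apply]
  refine Submodule.smul_mem _ _ ⟨?_, fun γ hγ => ?_⟩
  · have := Fintype.ofFinite (Quotient (cosetSetoid N X))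
    rw [finsum_eq_sum_of_fintype]
    refine Finset.sum_induction _ IsHolomorphic (fun _ _ => IsHolomorphic.add)
      IsHolomorphic.zero fun c _ => hf.1.slash hW₀ _
  · rw [slash_finsum]
    simp only [← slash_rmul]
    refine finsum_cosets_equiv (Φ := fun x => slash ρ x f) (rmulEquiv m γ) (fun x => ?_)
      (fun x y => ?_) fun x _ δ hδ => slash_lmul_Gam hf hδ x
    · refine ⟨fun h => ?_, hX.rmul_mem γ hγ x⟩
      have := hX.rmul_mem γ⁻¹ (inv_mem hγ) _ h
      rwa [show rmul (rmulEquiv m γ x) γ⁻¹ = x from (rmulEquiv m γ).symm_apply_apply x] at this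
    · refine exists_congr fun δ => and_congr_right fun _ => ?_
      change _ ↔ lmul δ (rmul y γ) = rmulEquiv m γ x
      rw [lmul_rmul]
      exact (rmulEquiv m γ).injective.eq_iff.symm

theorem isDiag_of_mul_eq_one {ι R : Type*} [Fintype ι] [DecidableEq ι] [CommRing R]
    {G H : Matrix ι ι R} (hG : G.IsDiag) (h : H * G = 1) : H.IsDiag := by
  obtain ⟨d, rfl⟩ : ∃ d, G = diagonal d := ⟨_, ((isDiag_iff_diagonal_diag _).mp hG).symm⟩
  intro i j hij
  have h1 := congrFun (congrFun h i) j
  have h2 := congrFun (congrFun h j) j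
  rw [mul_diagonal, one_apply_ne hij] at h1
  rw [mul_diagonal, one_apply_eq] at h2
  rw [← mul_one (H i j), ← h2, mul_comm (H j j), ← mul_assoc, h1, zero_mul]

/-- Conjugation by `δ` permutes the cosets in `X`, since `Γ(N)` is normal. On the summands, `f |
(δ⁻¹ x δ) = c⁻¹ (f | x) | δ`, so slashing the whole sum by `δ` multiplies it by `c`. -/
theorem slash_heckeOp_of_eigen [NeZero N] (hX : IsHeckeSet N X) {f : UpperHalf n → W}
    (hf : f ∈ modularForms ρ N) {δ : Sp n} (hδ : (red N (δ : Mat2 n)).IsDiag) {c : ℂ}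
    (hc : c ≠ 0) (hfδ : slash ρ δ.toSimilitude f = c • f) :
    slash ρ δ.toSimilitude (heckeOp ρ k N X f) = c • heckeOp ρ k N X f := by
  have hdi := isDiag_of_mul_eq_one hδ (red_inv_mul N δ)
  have hfi : slash ρ (δ⁻¹ : Sp n).toSimilitude f = c⁻¹ • f := by
    have h1 : slash ρ (δ⁻¹ : Sp n).toSimilitude (slash ρ δ.toSimilitude f) = f := by
      rw [← slash_mul, mul_inv_cancel, slash_one]
    rw [hfδ, map_smul] at h1
    rw [← h1, smul_smul, inv_mul_cancel₀ hc, one_smul, h1]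
  have key := finsum_cosets_equiv (N := N) (X := X) (Φ := fun x => slash ρ x f) (conjEquiv m δ)
    (fun x => ?_) (fun x y => ?_) fun x _ γ hγ => slash_lmul_Gam hf hγ x
  · rw [heckeOp_apply, map_smul, slash_finsum, smul_comm]
    congr 1
    rw [← key]
    have h2 : ∀ x : Similitude n m, slash ρ (conjEquiv m δ x) f =
        c⁻¹ • slash ρ δ.toSimilitude (slash ρ x f) := fun x => by
      change slash ρ (rmul (lmul δ⁻¹ x) δ) f = _
      rw [slash_rmul, slash_lmul, hfi, map_smul, map_smul]
    simp only [h2]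
    have := Fintype.ofFinite (Quotient (cosetSetoid N X))
    rw [finsum_eq_sum_of_fintype, finsum_eq_sum_of_fintype, ← Finset.smul_sum, smul_smul,
      mul_inv_cancel₀ hc, one_smul]
  · constructor
    · intro h
      have := hX.conj_mem δ hδ _ h
      rwa [show rmul (lmul δ (conjEquiv m δ x)) δ⁻¹ = x from
        (conjEquiv m δ).symm_apply_apply x] at this
    · intro h
      have := hX.conj_mem δ⁻¹ hdi _ h
      rwa [inv_inv] at this
  · have hconj : ∀ γ : Sp n, lmul (δ⁻¹ * γ * δ) (conjEquiv m δ y) = conjEquiv m δ (lmul γ y) :=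
      fun γ => by
        change lmul _ (rmul (lmul δ⁻¹ y) δ) = rmul (lmul δ⁻¹ (lmul γ y)) δ
        rw [lmul_rmul, ← lmul_mul, ← lmul_mul, mul_assoc, mul_inv_cancel, mul_one]
    constructor
    · rintro ⟨γ, hγ, rfl⟩
      refine ⟨δ⁻¹ * γ * δ, ?_, hconj γ⟩
      simpa using (Gam_normal n N).conj_mem γ hγ δ⁻¹
    · rintro ⟨γ, hγ, h⟩
      refine ⟨δ * γ * δ⁻¹, (Gam_normal n N).conj_mem γ hγ δ, ?_⟩
      apply (conjEquiv m δ).injective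
      rw [← hconj, ← h]
      congr 1
      group

/-- The diagonal symplectic matrix `diag(s⁻¹, s)` modulo `N`. -/
def diagMod (N : ℕ) (s : Fin n → (ZMod N)ˣ) :
    Matrix (Fin n ⊕ Fin n) (Fin n ⊕ Fin n) (ZMod N) :=
  diagonal (Sum.elim (fun i => (((s i)⁻¹ : (ZMod N)ˣ) : ZMod N)) (fun i => (s i : ZMod N)))

theorem diagMod_mul (s t : Fin n → (ZMod N)ˣ) :
    diagMod N (s * t) = diagMod N s * diagMod N t := by
  rw [diagMod, diagMod, diagMod, diagonal_mul_diagonal]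
  congr 1
  funext i
  rcases i with i | i
  · simp [mul_comm]
  · simp

theorem diagMod_one : diagMod N (1 : Fin n → (ZMod N)ˣ) = 1 := by
  rw [diagMod, ← diagonal_one]
  congr 1
  funext i
  rcases i with i | i <;> simp

/-- On the diagonal the symplectic relation `Aᵀ D - Cᵀ B = 1` says that the entries of `A` and `D`
are mutually inverse. -/
theorem exists_diagMod_eq {γ : Sp n} (hγ : (red N (γ : Mat2 n)).IsDiag) :
    ∃ s, red N (γ : Mat2 n) = diagMod N s := by
  obtain ⟨d, hd⟩ : ∃ d, red N (γ : Mat2 n) = diagonal d :=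
    ⟨_, ((isDiag_iff_diagonal_diag _).mp hγ).symm⟩
  have h0 : ∀ i j, i ≠ j → ((γ.1 i j : ℤ) : ZMod N) = 0 := fun i j hij => hγ hij
  have h1 : ∀ i, d (Sum.inl i) * d (Sum.inr i) = 1 := fun i => by
    have hd' : ∀ a, ((γ.1 a a : ℤ) : ZMod N) = d a := fun a => by
      have := congrFun (congrFun hd a) a
      rwa [diagonal_apply_eq] at this
    have h := congrArg (Int.cast : ℤ → ZMod N) (congrFun (congrFun γ.blocks.2.1 i) i)
    rw [Matrix.sub_apply, Matrix.mul_apply, Matrix.mul_apply, one_apply_eq] at h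
    simp only [transpose_apply, toBlocks₁₁, toBlocks₁₂, toBlocks₂₁, toBlocks₂₂, of_apply,
      Int.cast_sub, Int.cast_sum, Int.cast_mul, Int.cast_one] at h
    rw [Finset.sum_eq_single i, Finset.sum_eq_zero, sub_zero, hd', hd'] at h
    · exact h
    · intro r _
      rw [h0 (Sum.inr r) (Sum.inl i) (by simp), zero_mul]
    · intro r _ hr
      rw [h0 (Sum.inl r) (Sum.inl i) (by simpa using hr), zero_mul]
    · simp
  refine ⟨fun i => ⟨d (Sum.inr i), d (Sum.inl i), by rw [mul_comm]; exact h1 i, h1 i⟩, ?_⟩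
  rw [hd, diagMod]
  congr 1
  funext i
  rcases i with i | i <;> rfl

/-- Diagonal classes modulo `N` have lifts in `SL_2(ℤ)ⁿ` that are diagonal modulo `N m`. -/
theorem exists_diag_lift [NeZero N] (m : ℕ) (hm : 0 < m) (s : Fin n → (ZMod N)ˣ) :
    ∃ M : Fin n → SpecialLinearGroup (Fin 2) ℤ, red N (diagSp M : Mat2 n) = diagMod N s ∧
      ∀ i, ((N * m : ℕ) : ℤ) ∣ M i 0 1 ∧ ((N * m : ℕ) : ℤ) ∣ M i 1 0 := by
  have : NeZero (N * m) := ⟨mul_ne_zero (NeZero.ne N) hm.ne'⟩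
  have key : ∀ i, ∃ M : SpecialLinearGroup (Fin 2) ℤ,
      ((M 0 0 : ℤ) : ZMod N) = ((s i)⁻¹ : (ZMod N)ˣ) ∧ ((M 1 1 : ℤ) : ZMod N) = s i ∧
      ((N * m : ℕ) : ℤ) ∣ M 0 1 ∧ ((N * m : ℕ) : ℤ) ∣ M 1 0 := fun i => by
    obtain ⟨t, ht⟩ := ZMod.unitsMap_surjective (Nat.dvd_mul_right N m) (s i)
    obtain ⟨a, ha⟩ := ZMod.intCast_surjective (t : ZMod (N * m))
    obtain ⟨b, hb⟩ := ZMod.intCast_surjective ((t⁻¹ : (ZMod (N * m))ˣ) : ZMod (N * m))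
    have hab : ((a * b : ℤ) : ZMod (N * m)) = ((1 : ℤ) : ZMod (N * m)) := by
      rw [Int.cast_mul, ha, hb, Units.mul_inv, Int.cast_one]
    obtain ⟨k, hk⟩ := (ZMod.intCast_eq_intCast_iff_dvd_sub _ _ _).mp hab
    have hcast : ∀ x : ℤ, ZMod.castHom (Nat.dvd_mul_right N m) (ZMod N) (x : ZMod (N * m)) = x :=
      fun x => by simp
    have ha' : (a : ZMod N) = s i := by
      rw [← hcast, ha, ← ht]; rfl
    have hb' : (b : ZMod N) = ((s i)⁻¹ : (ZMod N)ˣ) := by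
      rw [← hcast, hb, ← ht, ← map_inv]; rfl
    have hab' : ((a * b : ℤ) : ZMod N) = 1 := by
      rw [Int.cast_mul, ha', hb', Units.mul_inv]
    -- As `1 - a b = N m k`, the determinant is `a b (2 - a b) + (1 - a b)² = 1`, and modulo `N` the
    -- matrix is `diag(a⁻¹, a)`.
    refine ⟨⟨!![b, ((N * m : ℕ) : ℤ) * k; -(((N * m : ℕ) : ℤ) * k), a * (1 + (1 - a * b))], ?_⟩,
      ?_, ?_, ?_, ?_⟩
    · rw [det_fin_two_of, ← hk]; ring
    · simpa using hb'
    · have h : ((a * (1 + (1 - a * b)) : ℤ) : ZMod N) = s i := by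
        rw [Int.cast_mul, Int.cast_add, Int.cast_sub, hab', ha']; simp
      exact h
    · exact dvd_mul_right _ _
    · exact (dvd_mul_right _ _).neg_right
  choose M h1 h2 h3 h4 using key
  refine ⟨M, ?_, fun i => ⟨h3 i, h4 i⟩⟩
  have hz : ∀ x : ℤ, ((N * m : ℕ) : ℤ) ∣ x → (x : ZMod N) = 0 := fun x hx => by
    rw [ZMod.intCast_zmod_eq_zero_iff_dvd]
    exact dvd_trans (by rw [Nat.cast_mul]; exact dvd_mul_right _ _) hx
  rw [coe_diagSp, red, fromBlocks_map, diagonal_map Int.cast_zero, diagonal_map Int.cast_zero,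
    diagonal_map Int.cast_zero, diagonal_map Int.cast_zero]
  simp only [h1, h2, hz _ (h3 _), hz _ (h4 _)]
  rw [diagMod, ← fromBlocks_diagonal]
  simp

/-! ### Hecke operators on eigenspaces, and the eigenvalues of diagonal classes. -/

section Eigen

variable {χ : Fin n → DirichletCharacter ℂ N} {f : UpperHalf n → W}

theorem isDiag_of_isDiagLift {j : Fin n} {a : (ZMod N)ˣ} {γ : Sp n} (h : IsDiagLift N j a γ) :
    (red N (γ : Mat2 n)).IsDiag := by
  rw [← reduceSp_apply, h]
  exact isDiag_diagonal _

theorem heckeOp_mem_modularFormsChar [NeZero N] [FiniteDimensional ℂ W] {W₀ : Submodule ℤ W}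
    (hW₀ : IsIntegralForm ρ W₀) (hX : IsHeckeSet N X) (hf : f ∈ modularFormsChar ρ N χ) :
    heckeOp ρ k N X f ∈ modularFormsChar ρ N χ :=
  ⟨heckeOp_mem_modularForms hW₀ hX hf.1, fun j a γ h => slash_heckeOp_of_eigen hX hf.1
    (isDiag_of_isDiagLift h) (a.isUnit.map (χ j)).ne_zero (hf.2 j a γ h)⟩

/-- The elements of `Sp_{2n}(ℤ)` that act on `f` by a unit of `O`. -/
def eigenSubgroup (ρ : Representation ℂ (GL (Fin n) ℂ) W) (O : Subring ℂ) (f : UpperHalf n → W) :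
    Subgroup (Sp n) where
  carrier := {γ | ∃ θ : Oˣ, slash ρ γ.toSimilitude f = (θ : O) • f}
  mul_mem' := by
    rintro γ δ ⟨θ, h⟩ ⟨θ', h'⟩
    refine ⟨θ * θ', ?_⟩
    have : ∀ (c : O) (g : UpperHalf n → W), c • g = (c : ℂ) • g := fun _ _ => rfl
    rw [slash_mul, h, this, map_smul, h', this, this, smul_smul]
    simp
  one_mem' := ⟨1, by rw [slash_one, Units.val_one, one_smul]⟩
  inv_mem' := by
    rintro γ ⟨θ, h⟩
    refine ⟨θ⁻¹, ?_⟩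
    have h1 : slash ρ (γ⁻¹ : Sp n).toSimilitude (slash ρ γ.toSimilitude f) = f := by
      rw [← slash_mul, mul_inv_cancel, slash_one]
    have : ∀ (c : O) (g : UpperHalf n → W), c • g = (c : ℂ) • g := fun _ _ => rfl
    rw [h, this, map_smul, ← this] at h1
    rw [← h1, smul_smul, Units.inv_mul, one_smul, h1]

/-- The classes `g_j(a)` in the definition of `M_ρ(Γ(N), χ)` generate all diagonal classes modulo
`N`. Their eigenvalues are units of `O`, the inverse of `χ j a` being `χ j a⁻¹`. -/
theorem mem_eigenSubgroup_of_isDiag [NeZero N] {O : Subring ℂ}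
    (hO : ∀ j (a : (ZMod N)ˣ), χ j a ∈ O) (hf : f ∈ modularFormsChar ρ N χ) {γ : Sp n}
    (hγ : (red N (γ : Mat2 n)).IsDiag) : γ ∈ eigenSubgroup ρ O f := by
  let T : Subgroup (Fin n → (ZMod N)ˣ) :=
    { carrier := {s | ∃ γ ∈ eigenSubgroup ρ O f, red N (γ : Mat2 n) = diagMod N s}
      mul_mem' := by
        rintro s t ⟨γ, hγ, h⟩ ⟨δ, hδ, h'⟩
        exact ⟨γ * δ, mul_mem hγ hδ, by rw [Submonoid.coe_mul, red_mul, h, h', diagMod_mul]⟩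
      one_mem' := ⟨1, one_mem _, by rw [Submonoid.coe_one, red_one, diagMod_one]⟩
      inv_mem' := by
        rintro s ⟨γ, hγ, h⟩
        refine ⟨γ⁻¹, inv_mem hγ, ?_⟩
        have h1 := red_inv_mul N γ
        rw [h] at h1
        rw [← Matrix.one_mul (diagMod N s⁻¹), ← h1, Matrix.mul_assoc, ← diagMod_mul,
          mul_inv_cancel, diagMod_one, Matrix.mul_one] }
  have hstep : ∀ (j : ℕ) (a : (ZMod N)ˣ), j ≤ n →
      (fun i : Fin n => if (i : ℕ) < j then a else 1) ∈ T := by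
    intro j a hj
    -- Here `j` counts the leading entries equal to `a`: none for `j = 0`, and `j + 1` entries
    -- correspond to the zero-based index `j` of `χ`.
    rcases j with _ | j
    · convert one_mem T using 1
      funext i
      simp
    · obtain ⟨M, hM, -⟩ := exists_diag_lift (N := N) 1 one_pos
        (fun i : Fin n => if (i : ℕ) < j + 1 then a else 1)
      refine ⟨diagSp M, ?_, hM⟩
      have hlift : IsDiagLift N (⟨j, hj⟩ : Fin n) a (diagSp M) := by
        rw [IsDiagLift, reduceSp_apply, hM, diagMod]
        congr 1
        funext i
        rcases i with i | i
        · simp only [Sum.elim_inl, Nat.lt_succ_iff, Fin.le_def]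
          split_ifs <;> simp
        · simp only [Sum.elim_inr, Nat.lt_succ_iff, Fin.le_def]
          split_ifs <;> simp
      have hmul : ∀ b : (ZMod N)ˣ, χ ⟨j, hj⟩ b * χ ⟨j, hj⟩ (b⁻¹ : (ZMod N)ˣ) = 1 := fun b => by
        rw [← map_mul, Units.mul_inv, map_one]
      refine ⟨⟨⟨_, hO ⟨j, hj⟩ a⟩, ⟨_, hO ⟨j, hj⟩ a⁻¹⟩, Subtype.ext (hmul a), Subtype.ext ?_⟩,
        hf.2 _ a _ hlift⟩
      exact (mul_comm _ _).trans (hmul a)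
  have hsingle : ∀ j (a : (ZMod N)ˣ), (Pi.mulSingle j a : Fin n → (ZMod N)ˣ) ∈ T := fun j a => by
    -- The quotient of two consecutive initial segments isolates a single coordinate.
    convert mul_mem (hstep (j + 1) a j.2) (inv_mem (hstep j a j.2.le)) using 1
    funext i
    by_cases h : i = j
    · subst h; simp
    · have h' : (i : ℕ) ≠ j := fun h' => h (Fin.ext h')
      rw [Pi.mulSingle_eq_of_ne h]
      rw [Pi.mul_apply, Pi.inv_apply]
      by_cases h2 : (i : ℕ) < j
      · rw [if_pos h2, if_pos (Nat.lt_succ_of_lt h2), mul_inv_cancel]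
      · rw [if_neg h2, if_neg (by omega), mul_inv_cancel]
  obtain ⟨s, hs⟩ := exists_diagMod_eq hγ
  obtain ⟨δ, hδ, h⟩ : s ∈ T := by
    rw [← Finset.univ_prod_mulSingle s]
    exact prod_mem fun i _ => hsingle i _
  have h1 := mul_inv_mem_Gam (hs.trans h.symm)
  have h2 : γ * δ⁻¹ ∈ eigenSubgroup ρ O f := ⟨1, by rw [hf.1.2 _ h1, Units.val_one, one_smul]⟩
  have := mul_mem h2 hδ
  rwa [inv_mul_cancel_right] at this

end Eigen

end Cosets

/-! ### The sets of similitudes defining the Hecke operators -/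

section HeckeSets

variable {n N m : ℕ}

theorem red_lmul_of_mem {γ : Sp n} (hγ : γ ∈ Gam n N) (x : Similitude n m) :
    red N (lmul γ x).1 = red N x.1 := by
  rw [coe_lmul, red_mul, mem_Gam_iff.mp hγ, Matrix.one_mul]

theorem red_rmul_of_mem {γ : Sp n} (hγ : γ ∈ Gam n N) (x : Similitude n m) :
    red N (rmul x γ).1 = red N x.1 := by
  rw [coe_rmul, red_mul, mem_Gam_iff.mp hγ, Matrix.mul_one]

theorem red_conj_of_isDiag {δ : Sp n} (hδ : (red N (δ : Mat2 n)).IsDiag)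
    {x : Similitude n m} {Δ : Fin n ⊕ Fin n → ZMod N} (hx : red N x.1 = diagonal Δ) :
    red N (rmul (lmul δ x) δ⁻¹).1 = red N x.1 := by
  obtain ⟨d, hd⟩ : ∃ d, red N (δ : Mat2 n) = diagonal d :=
    ⟨_, ((isDiag_iff_diagonal_diag _).mp hδ).symm⟩
  have h1 := red_mul_inv N δ
  rw [coe_rmul, coe_lmul, red_mul, red_mul, hx, hd, (commute_diagonal d Δ).eq, Matrix.mul_assoc,
    ← hd, h1, Matrix.mul_one]

theorem congruenceSet_isHeckeSet : IsHeckeSet N (congruenceSet n N m) := by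
  have hdiag : ∃ Δ, (fromBlocks 1 0 0 ((m : ℤ) • 1) : Mat2 n).map (Int.cast : ℤ → ZMod N) =
      diagonal Δ := by
    refine ⟨_, ((isDiag_iff_diagonal_diag _).mp ?_).symm⟩
    rw [fromBlocks_map]
    intro i j hij
    rcases i with i | i <;> rcases j with j | j
    · have : i ≠ j := fun h => hij (congrArg _ h)
      simp [one_apply_ne this]
    · simp
    · simp
    · have : i ≠ j := fun h => hij (congrArg _ h)
      simp [Matrix.natCast_apply, this]
  obtain ⟨Δ, hΔ⟩ := hdiag
  refine ⟨fun γ hγ x hx => ?_, fun γ hγ x hx => ?_, fun δ hδ x hx => ?_,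
    ⟨Δ, fun x hx => hΔ ▸ hx⟩⟩
  · exact (red_lmul_of_mem hγ x).trans hx
  · exact (red_rmul_of_mem hγ x).trans hx
  · exact (red_conj_of_isDiag hδ (Δ := Δ) (hΔ ▸ hx)).trans hx

variable {g₁ g₂ : Fin n → ℤ}

theorem red_diagonal (N : ℕ) (g : Fin n ⊕ Fin n → ℤ) :
    red N (diagonal g : Mat2 n) = diagonal fun i => (g i : ZMod N) :=
  diagonal_map Int.cast_zero

/-- For `g = diag(g₁, g₂)` the witness is `η = g δ⁻¹ g⁻¹`. It is integral because `δ` is chosen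
diagonal modulo `N m`, not only modulo `N`. -/
theorem exists_conj_diagonal [NeZero N] (hm : 0 < m) (hg : ∀ i, g₁ i * g₂ i = m)
    (s : Fin n → (ZMod N)ˣ) : ∃ δ η : Sp n, red N (δ : Mat2 n) = diagMod N s ∧
      δ * η ∈ Gam n N ∧ (η : Mat2 n) * diagonal (Sum.elim g₁ g₂) * (δ : Mat2 n) =
        diagonal (Sum.elim g₁ g₂) := by
  obtain ⟨M, hM, hdvd⟩ := exists_diag_lift (N := N) m hm s
  choose y hy using fun i => (hdvd i).1
  choose z hz using fun i => (hdvd i).2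
  have hdet : ∀ i, M i 0 0 * M i 1 1 - M i 0 1 * M i 1 0 = 1 := fun i => by
    have := (M i).det_coe
    rwa [det_fin_two] at this
  -- Conjugation by `g` multiplies the off-diagonal entries of `δ⁻¹` by `g₁ / g₂` and `g₂ / g₁`;
  -- writing them as multiples of `N * g₁ * g₂` leaves `N g₁²` and `N g₂²`.
  let M' : Fin n → SpecialLinearGroup (Fin 2) ℤ := fun i =>
    ⟨!![M i 1 1, -(N * y i * g₁ i ^ 2); -(N * z i * g₂ i ^ 2), M i 0 0], by
      have h := hdet i
      rw [hy, hz, Nat.cast_mul, ← hg i] at h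
      rw [det_fin_two_of]
      linear_combination h⟩
  have hM' : (diagSp M' : Mat2 n) = fromBlocks (diagonal fun i => M i 1 1)
      (diagonal fun i => -(N * y i * g₁ i ^ 2)) (diagonal fun i => -(N * z i * g₂ i ^ 2))
      (diagonal fun i => M i 0 0) := rfl
  refine ⟨diagSp M, diagSp M', hM, ?_, ?_⟩
  · have h1 : red N (diagSp M' : Mat2 n) = diagMod N s⁻¹ := by
      have h2 : red N (diagSp M : Mat2 n) = fromBlocks
          (diagonal fun i => ((M i 0 0 : ℤ) : ZMod N)) (diagonal fun i => ((M i 0 1 : ℤ) : ZMod N))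
          (diagonal fun i => ((M i 1 0 : ℤ) : ZMod N))
          (diagonal fun i => ((M i 1 1 : ℤ) : ZMod N)) := by
        rw [coe_diagSp, red, fromBlocks_map, diagonal_map Int.cast_zero,
          diagonal_map Int.cast_zero, diagonal_map Int.cast_zero, diagonal_map Int.cast_zero]
      rw [hM, diagMod, ← fromBlocks_diagonal, fromBlocks_inj] at h2
      have a1 : ∀ i, (((s i)⁻¹ : (ZMod N)ˣ) : ZMod N) = (M i 0 0 : ℤ) := fun i =>
        congrFun (diagonal_injective h2.1) i
      have a2 : ∀ i, ((s i : (ZMod N)ˣ) : ZMod N) = (M i 1 1 : ℤ) := fun i =>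
        congrFun (diagonal_injective h2.2.2.2) i
      rw [hM', red, fromBlocks_map, diagonal_map Int.cast_zero, diagonal_map Int.cast_zero,
        diagonal_map Int.cast_zero, diagonal_map Int.cast_zero, diagMod, ← fromBlocks_diagonal]
      simp [← a1, ← a2]
    rw [mem_Gam_iff, Submonoid.coe_mul, red_mul, hM, h1, ← diagMod_mul, mul_inv_cancel, diagMod_one]
  · rw [hM', coe_diagSp, ← fromBlocks_diagonal, fromBlocks_multiply, fromBlocks_multiply]
    simp only [Matrix.mul_zero, add_zero, zero_add, diagonal_mul_diagonal, diagonal_add]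
    rw [← diagonal_zero, fromBlocks_inj]
    have e := fun i => hy i
    have e' := fun i => hz i
    have hmi : ∀ i, (m : ℤ) = g₁ i * g₂ i := fun i => (hg i).symm
    refine ⟨?_, ?_, ?_, ?_⟩ <;> congr 1 <;> funext i
    · calc M i 1 1 * g₁ i * M i 0 0 + -(N * y i * g₁ i ^ 2) * g₂ i * M i 1 0
          = g₁ i * (M i 0 0 * M i 1 1 - (N * (g₁ i * g₂ i) * y i) * M i 1 0) := by ring
        _ = g₁ i * (M i 0 0 * M i 1 1 - M i 0 1 * M i 1 0) := by
          rw [← hmi, hy i, Nat.cast_mul]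
        _ = g₁ i := by rw [hdet, mul_one]
    · rw [hy i, Nat.cast_mul, hmi i]; ring
    · rw [hz i, Nat.cast_mul, hmi i]; ring
    · calc -(N * z i * g₂ i ^ 2) * g₁ i * M i 0 1 + M i 0 0 * g₂ i * M i 1 1
          = g₂ i * (M i 0 0 * M i 1 1 - M i 0 1 * (N * (g₁ i * g₂ i) * z i)) := by ring
        _ = g₂ i * (M i 0 0 * M i 1 1 - M i 0 1 * M i 1 0) := by
          rw [← hmi, hz i, Nat.cast_mul]
        _ = g₂ i := by rw [hdet, mul_one]

/-- For the conjugation property, `δ` is replaced by a congruent `δ₀` for which `δ₀ g = (δ₀ η) g δ₀`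
with `δ₀ η` in `Γ(N)`. Thus `δ₀` passes across `g` at the cost of elements of `Γ(N)`. -/
theorem doubleCoset_isHeckeSet [NeZero N] (hm : 0 < m) (hg : ∀ i, g₁ i * g₂ i = m) :
    IsHeckeSet N (doubleCoset N m (diagonal (Sum.elim g₁ g₂))) := by
  set g : Mat2 n := diagonal (Sum.elim g₁ g₂) with hgdef
  refine ⟨?_, ?_, ?_, ⟨fun i => ((Sum.elim g₁ g₂ i : ℤ) : ZMod N), ?_⟩⟩
  · rintro η hη x ⟨γ, hγ, γ', hγ', h⟩
    exact ⟨η * γ, mul_mem hη hγ, γ', hγ', by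
      rw [coe_lmul, h, Submonoid.coe_mul]; simp only [Matrix.mul_assoc]⟩
  · rintro η hη x ⟨γ, hγ, γ', hγ', h⟩
    exact ⟨γ, hγ, γ' * η, mul_mem hγ' hη, by
      rw [coe_rmul, h, Submonoid.coe_mul]; simp only [Matrix.mul_assoc]⟩
  · rintro δ hδ x ⟨γ, hγ, γ', hγ', h⟩
    obtain ⟨s, hs⟩ := exists_diagMod_eq hδ
    obtain ⟨δ₀, η, h1, h2, h3⟩ := exists_conj_diagonal hm hg s
    have h4 := mul_inv_mem_Gam (hs.trans h1.symm)
    have h6 : ((δ₀ * η : Sp n) : Mat2 n) * g * (δ₀ : Mat2 n) = (δ₀ : Mat2 n) * g := by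
      rw [Submonoid.coe_mul, Matrix.mul_assoc, Matrix.mul_assoc, ← Matrix.mul_assoc (η : Mat2 n),
        h3]
    have h7 : ∀ a b : Sp n, (a : Mat2 n) * (b : Mat2 n) = ((a * b : Sp n) : Mat2 n) :=
      fun _ _ => rfl
    refine ⟨δ * γ * δ⁻¹ * (δ * δ₀⁻¹) * (δ₀ * η), mul_mem (mul_mem ((Gam_normal n N).conj_mem _ hγ _)
      h4) h2, (δ * δ₀⁻¹)⁻¹ * (δ * γ' * δ⁻¹), mul_mem (inv_mem h4)
        ((Gam_normal n N).conj_mem _ hγ' _), ?_⟩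
    have e1 : (δ * δ₀⁻¹)⁻¹ * (δ * γ' * δ⁻¹) = δ₀ * (γ' * δ⁻¹) := by group
    have e2 : δ * γ * δ⁻¹ * (δ * δ₀⁻¹) * (δ₀ * η) = δ * γ * δ₀⁻¹ * (δ₀ * η) := by group
    have e3 : δ * γ * δ₀⁻¹ * δ₀ = δ * γ := by group
    rw [coe_rmul, coe_lmul, h, e1, e2, ← h7 _ (δ₀ * η), ← h7 δ₀ (γ' * δ⁻¹)]
    calc (δ : Mat2 n) * ((γ : Mat2 n) * g * (γ' : Mat2 n)) * ((δ⁻¹ : Sp n) : Mat2 n)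
        = ((δ : Mat2 n) * (γ : Mat2 n)) * g * ((γ' : Mat2 n) * ((δ⁻¹ : Sp n) : Mat2 n)) := by
          simp only [Matrix.mul_assoc]
      _ = ((δ * γ * δ₀⁻¹ : Sp n) : Mat2 n) * ((δ₀ : Mat2 n) * g) *
          ((γ' * δ⁻¹ : Sp n) : Mat2 n) := by
          rw [h7, h7, ← Matrix.mul_assoc _ (δ₀ : Mat2 n), h7, e3]
      _ = _ := by rw [← h6]; simp only [Matrix.mul_assoc]
  · rintro x ⟨γ, hγ, γ', hγ', h⟩
    rw [h, red_mul, red_mul, mem_Gam_iff.mp hγ, mem_Gam_iff.mp hγ', Matrix.one_mul, Matrix.mul_one,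
      red_diagonal]

theorem red_castHom (N m : ℕ) (x : Mat2 n) :
    (red (N * m) x).map (ZMod.castHom (Nat.dvd_mul_right N m) (ZMod N)) = red N x := by
  ext i j
  simp

theorem red_eq_of_eps {u : (ZMod (N * m))ˣ}
    (hu : ZMod.castHom (Nat.dvd_mul_right N m) (ZMod N) (u : ZMod (N * m)) = 1) {x y : Mat2 n}
    (h : red (N * m) x * epsMatrix n (N * m) u = epsMatrix n (N * m) u * red (N * m) y) :
    red N x = red N y := by
  have he : (epsMatrix n (N * m) u).map (ZMod.castHom (Nat.dvd_mul_right N m) (ZMod N)) = 1 := by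
    rw [epsMatrix, fromBlocks_map, ← fromBlocks_one]
    congr 1
    · ext i j
      rw [map_apply, Matrix.smul_apply, smul_eq_mul, map_mul, hu, one_mul, one_apply, one_apply]
      split_ifs <;> simp
    · ext; simp
    · ext; simp
    · exact Matrix.map_one _ (map_zero _) (map_one _)
  have h1 := congrArg (fun M : Matrix _ _ _ =>
    M.map (ZMod.castHom (Nat.dvd_mul_right N m) (ZMod N))) h
  simp only [Matrix.map_mul, he, red_castHom, Matrix.mul_one, Matrix.one_mul] at h1
  exact h1

/-- Modulo `N m`, conjugation by `diag(u, 1)` fixes the diagonal matrix `g` and, since `u ≡ 1`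
modulo `N`, carries `Γ(N)` to itself. So it carries double coset elements to residues of double
coset elements, and a residue modulo `N m` determines a left coset of `Γ(N)`. -/
theorem doubleCoset_eps [NeZero N] {u : (ZMod (N * m))ˣ}
    (hu : ZMod.castHom (Nat.dvd_mul_right N m) (ZMod N) (u : ZMod (N * m)) = 1)
    (hg : ∀ i, g₁ i * g₂ i = m) {γ : Sp n}
    {h h' : Similitude n m} (hh : red (N * m) h'.1 * epsMatrix n (N * m) u =
      epsMatrix n (N * m) u * red (N * m) h.1)
    (hx : lmul γ h ∈ doubleCoset N m (diagonal (Sum.elim g₁ g₂))) :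
    lmul γ h' ∈ doubleCoset N m (diagonal (Sum.elim g₁ g₂)) := by
  have hX := doubleCoset_isHeckeSet (N := N) h.2.1 hg
  obtain ⟨γ₁, hγ₁, γ₂, hγ₂, hx⟩ := hx
  set g : Mat2 n := diagonal (Sum.elim g₁ g₂) with hgdef
  set e := epsMatrix n (N * m) u with he
  have heg : e * red (N * m) g = red (N * m) g * e := by
    rw [he, epsMatrix, hgdef, red_diagonal]
    have : (fromBlocks ((u : ZMod (N * m)) • 1) 0 0 1 :
        Matrix (Fin n ⊕ Fin n) (Fin n ⊕ Fin n) (ZMod (N * m))) =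
        diagonal (Sum.elim (fun _ => (u : ZMod (N * m))) (fun _ => 1)) := by
      rw [← fromBlocks_diagonal, ← smul_one_eq_diagonal, diagonal_one]
    rw [this]
    exact (commute_diagonal _ _).eq
  have hcancel : ∀ {Y Z : Matrix (Fin n ⊕ Fin n) (Fin n ⊕ Fin n) (ZMod (N * m))},
      Y * e = Z * e → Y = Z := fun {Y Z} hYZ => by
    have := congrArg (fun T => T * epsMatrix n (N * m) (u⁻¹ : (ZMod (N * m))ˣ)) hYZ
    simpa only [Matrix.mul_assoc, he, epsMatrix_mul, Units.mul_inv, epsMatrix_one,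
      Matrix.mul_one] using this
  obtain ⟨γ', h0⟩ := exists_eps_lift (N * m) u γ
  obtain ⟨γ₁', h1⟩ := exists_eps_lift (N * m) u γ₁
  obtain ⟨γ₂', h2⟩ := exists_eps_lift (N * m) u γ₂
  have m1 : γ₁' ∈ Gam n N := by rw [mem_Gam_iff, red_eq_of_eps hu h1]; exact hγ₁
  have m2 : γ₂' ∈ Gam n N := by rw [mem_Gam_iff, red_eq_of_eps hu h2]; exact hγ₂
  have m0 := mul_inv_mem_Gam (red_eq_of_eps hu h0).symm
  have hgform : gᵀ * J (Fin n) ℤ * g = (m : ℤ) • J (Fin n) ℤ := by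
    rw [hgdef, ← fromBlocks_diagonal, similitude_iff]
    refine ⟨by simp, ?_, by simp⟩
    rw [diagonal_transpose, diagonal_mul_diagonal, transpose_zero, Matrix.zero_mul, sub_zero,
      smul_one_eq_diagonal]
    exact congrArg _ (funext hg)
  let y : Similitude n m := lmul γ₁' (rmul ⟨g, h.2.1, hgform⟩ γ₂')
  have hy : y ∈ doubleCoset N m g := ⟨γ₁', m1, γ₂', m2, (Matrix.mul_assoc _ _ _).symm⟩
  have key : red (N * m) y.1 = red (N * m) (lmul γ' h').1 := by
    apply hcancel
    have r : red (N * m) y.1 * e = e * red (N * m) (lmul γ h).1 := by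
      have : y.1 = (γ₁' : Mat2 n) * (g * (γ₂' : Mat2 n)) := rfl
      rw [hx, this, red_mul, red_mul, red_mul, red_mul, Matrix.mul_assoc, Matrix.mul_assoc, h2,
        ← Matrix.mul_assoc (red (N * m) g), ← heg, ← Matrix.mul_assoc, ← Matrix.mul_assoc, h1]
      simp only [Matrix.mul_assoc, he]
    rw [r, coe_lmul, coe_lmul, red_mul, red_mul, Matrix.mul_assoc (red (N * m) (γ' : Mat2 n)), hh,
      ← Matrix.mul_assoc, ← Matrix.mul_assoc, h0]
  obtain ⟨η, hη, h3⟩ := exists_Gam_of_red_eq _ _ key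
  have h4 : lmul γ h' = lmul (γ * γ'⁻¹) (lmul γ' h') := by
    rw [← lmul_mul, inv_mul_cancel_right]
  rw [h4, h3]
  exact hX.lmul_mem _ m0 _ (hX.lmul_mem _ hη _ hy)

end HeckeSets

/-! ### Upper triangular representatives -/

section UpperRepresentatives

variable {n N m : ℕ}

/-- `h = [A NB; 0 D]` with `B Aᵀ = S`. -/
def IsUpper (N : ℕ) (h : Similitude n m) (A S : Matrix (Fin n) (Fin n) ℤ) : Prop :=
  ∃ B D : Matrix (Fin n) (Fin n) ℤ, h.1 = fromBlocks A ((N : ℤ) • B) 0 D ∧ B * Aᵀ = S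

theorem mul_eq_smul_one_comm {X Y : Matrix (Fin n) (Fin n) ℤ} {c : ℤ} (hc : c ≠ 0)
    (h : X * Y = c • 1) : Y * X = c • 1 := by
  have h1 : IsUnit (X.map (Int.cast : ℤ → ℚ)).det := by
    have h2 := congrArg (fun M : Matrix (Fin n) (Fin n) ℤ => (M.map (Int.cast : ℤ → ℚ)).det) h
    have h3 : ∀ M : Matrix (Fin n) (Fin n) ℤ, (M.map (Int.cast : ℤ → ℚ)).det = (M.det : ℚ) :=
      fun M => (Int.cast_det M).symm
    simp only [h3] at h2 ⊢
    rw [det_mul, det_smul, det_one, mul_one] at h2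
    refine isUnit_iff_ne_zero.mpr fun h0 => ?_
    rw [Int.cast_mul, h0, zero_mul] at h2
    exact pow_ne_zero _ hc (by exact_mod_cast h2.symm)
  have h4 : (X.map (Int.cast : ℤ → ℚ)) * (Y * X).map (Int.cast : ℤ → ℚ) =
      X.map (Int.cast : ℤ → ℚ) * (c • 1 : Matrix (Fin n) (Fin n) ℤ).map (Int.cast : ℤ → ℚ) := by
    have e : ∀ M M' : Matrix (Fin n) (Fin n) ℤ, M.map (Int.cast : ℤ → ℚ) * M'.map Int.cast =
      (M * M').map Int.cast := fun M M' => (Matrix.map_mul (f := Int.castRingHom ℚ)).symm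
    rw [e, e, ← Matrix.mul_assoc, h, Matrix.smul_mul, Matrix.mul_smul, Matrix.one_mul,
      Matrix.mul_one]
  have h5 := congrArg (fun M => (X.map (Int.cast : ℤ → ℚ))⁻¹ * M) h4
  simp only [nonsing_inv_mul_cancel_left _ _ h1] at h5
  exact Matrix.map_injective Int.cast_injective h5

theorem smul_matrix_injective {c : ℤ} (hc : c ≠ 0) {X Y : Matrix (Fin n) (Fin n) ℤ}
    (h : c • X = c • Y) : X = Y := by
  ext i j
  have := congrFun (congrFun h i) j
  rw [Matrix.smul_apply, Matrix.smul_apply, smul_eq_mul, smul_eq_mul] at this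
  exact mul_left_cancel₀ hc this

theorem Similitude.ne_zero (h : Similitude n m) : (m : ℤ) ≠ 0 := by exact_mod_cast h.2.1.ne'

theorem upper_relations {h : Similitude n m} {A B D : Matrix (Fin n) (Fin n) ℤ}
    (hh : h.1 = fromBlocks A B 0 D) :
    Aᵀ * D = (m : ℤ) • 1 ∧ D * Aᵀ = (m : ℤ) • 1 ∧ Dᵀ * A = (m : ℤ) • 1 ∧ A * Dᵀ = (m : ℤ) • 1 ∧
      Bᵀ * D = Dᵀ * B ∧ (B * Aᵀ)ᵀ = B * Aᵀ := by
  have hm := h.ne_zero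
  have h0 := h.2.2
  rw [hh, similitude_iff] at h0
  obtain ⟨-, h1, h2⟩ := h0
  rw [transpose_zero, Matrix.zero_mul, sub_zero] at h1
  have h3 := mul_eq_smul_one_comm hm h1
  have h4 : Dᵀ * A = (m : ℤ) • 1 := by
    have := congrArg transpose h1
    rwa [transpose_mul, transpose_transpose, transpose_smul, transpose_one] at this
  have h5 := mul_eq_smul_one_comm hm h4
  refine ⟨h1, h3, h4, h5, h2, smul_matrix_injective hm ?_⟩
  rw [transpose_mul, transpose_transpose]
  calc (m : ℤ) • (A * Bᵀ) = A * Bᵀ * (D * Aᵀ) := by rw [h3, Matrix.mul_smul, Matrix.mul_one]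
    _ = A * (Bᵀ * D) * Aᵀ := by simp only [Matrix.mul_assoc]
    _ = (A * Dᵀ) * B * Aᵀ := by rw [h2]; simp only [Matrix.mul_assoc]
    _ = (m : ℤ) • (B * Aᵀ) := by
      rw [h5, Matrix.smul_mul, Matrix.one_mul, Matrix.smul_mul]

theorem IsUpper.relations (hN : 0 < N) {h : Similitude n m} {A S : Matrix (Fin n) (Fin n) ℤ}
    (hu : IsUpper N h A S) : ∃ B D : Matrix (Fin n) (Fin n) ℤ,
      h.1 = fromBlocks A ((N : ℤ) • B) 0 D ∧ B * Aᵀ = S ∧ Aᵀ * D = (m : ℤ) • 1 ∧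
        D * Aᵀ = (m : ℤ) • 1 ∧ Sᵀ = S ∧ S * D = (m : ℤ) • B := by
  obtain ⟨B, D, hh, hS⟩ := hu
  obtain ⟨h1, h2, -, -, -, h6⟩ := upper_relations hh
  refine ⟨B, D, hh, hS, h1, h2, ?_, ?_⟩
  · rw [Matrix.smul_mul, hS, transpose_smul] at h6
    exact smul_matrix_injective (by exact_mod_cast hN.ne') h6
  · rw [← hS, Matrix.mul_assoc, h1, Matrix.mul_smul, Matrix.mul_one]

/-- The only constraints on a symmetric `S` are that `S D` be divisible by `m`; then `B = m⁻¹ S D`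
is integral and automatically satisfies the symplectic relation. -/
theorem exists_isUpper {A D S B : Matrix (Fin n) (Fin n) ℤ} (hm : 0 < m)
    (hAD : Aᵀ * D = (m : ℤ) • 1) (hS : Sᵀ = S) (hSD : S * D = (m : ℤ) • B) :
    ∃ h : Similitude n m, h.1 = fromBlocks A ((N : ℤ) • B) 0 D ∧ IsUpper N h A S := by
  have hm' : (m : ℤ) ≠ 0 := by exact_mod_cast hm.ne'
  have hBD : Bᵀ * D = Dᵀ * B := by
    apply smul_matrix_injective hm'
    rw [← Matrix.smul_mul, ← transpose_smul, ← hSD, ← Matrix.mul_smul, ← hSD, transpose_mul, hS,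
      Matrix.mul_assoc]
  refine ⟨ofBlocks A ((N : ℤ) • B) 0 D hm (by simp) (by simp [hAD]) ?_, rfl, B, D, rfl, ?_⟩
  · rw [transpose_smul, Matrix.smul_mul, Matrix.mul_smul, hBD]
  · apply smul_matrix_injective hm'
    rw [← Matrix.smul_mul, ← hSD, Matrix.mul_assoc, mul_eq_smul_one_comm hm' hAD, Matrix.mul_smul,
      Matrix.mul_one]

theorem red_fromBlocks (M : ℕ) (A B C D : Matrix (Fin n) (Fin n) ℤ) :
    red M (fromBlocks A B C D) = fromBlocks (A.map Int.cast) (B.map Int.cast) (C.map Int.cast)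
      (D.map Int.cast) := fromBlocks_map A B C D _

theorem smul_map_cast_self (B : Matrix (Fin n) (Fin n) ℤ) :
    (((N : ℤ) • B).map Int.cast : Matrix (Fin n) (Fin n) (ZMod N)) = 0 := by
  ext i j
  rw [Matrix.map_apply, Matrix.smul_apply, smul_eq_mul, Int.cast_mul, Int.cast_natCast,
    ZMod.natCast_self, zero_mul, Matrix.zero_apply]

theorem isUnit_of_coprime_similitude (hmN : m.Coprime N) (h : Similitude n m) :
    IsUnit (red N h.1) := by
  have hu : IsUnit ((m : ℤ) : ZMod N) := by
    rw [Int.cast_natCast]; exact (ZMod.isUnit_iff_coprime m N).mpr hmN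
  have h1 := congrArg (red N) h.2.2
  rw [red_mul, red_mul] at h1
  have hJ : red N (J (Fin n) ℤ) = J (Fin n) (ZMod N) := Matrix.map_J (l := Fin n) (Int.castRingHom (ZMod N))
  have h2 : red N ((m : ℤ) • J (Fin n) ℤ) = ((m : ℤ) : ZMod N) • J (Fin n) (ZMod N) := by
    rw [← hJ]
    exact Matrix.ext fun i j => Int.cast_mul _ _
  rw [h2] at h1
  rw [Matrix.isUnit_iff_isUnit_det]
  have h3 := congrArg det h1
  rw [det_mul, det_smul] at h3
  have h4 : IsUnit (((m : ℤ) : ZMod N) ^ Fintype.card (Fin n ⊕ Fin n) * (J (Fin n) (ZMod N)).det) :=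
    (hu.pow _).mul (isUnit_det_J _ _)
  rw [← h3] at h4
  exact isUnit_of_mul_isUnit_right h4

/-- Upper triangular representatives with the same diagonal blocks are transformed to elements of
`X` by the same classes modulo `N`. -/
theorem red_eq_of_isUpper (hN : 0 < N) (hmN : m.Coprime N) {X : Set (Similitude n m)} (hX : IsHeckeSet N X)
    {γ γ' : Sp n} {h h' : Similitude n m} {A S S' : Matrix (Fin n) (Fin n) ℤ}
    (hu : IsUpper N h A S) (hu' : IsUpper N h' A S') (hx : lmul γ h ∈ X) (hx' : lmul γ' h' ∈ X) :
    red N (γ : Mat2 n) = red N (γ' : Mat2 n) := by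
  obtain ⟨Δ, hΔ⟩ := hX.isDiag
  obtain ⟨B, D, hh, -, h1, -⟩ := hu.relations hN
  obtain ⟨B', D', hh', -, h1', h2', -⟩ := hu'.relations hN
  have hD : D = D' := by
    apply smul_matrix_injective h.ne_zero
    calc (m : ℤ) • D = (D' * Aᵀ) * D := by rw [h2', Matrix.smul_mul, Matrix.one_mul]
      _ = _ := by rw [Matrix.mul_assoc, h1, Matrix.mul_smul, Matrix.mul_one]
  -- The upper right blocks are multiples of `N`, so `S` is invisible modulo `N`.
  have e : red N h.1 = red N h'.1 := by
    rw [hh, hh', hD, red_fromBlocks, red_fromBlocks, smul_map_cast_self, smul_map_cast_self]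
  have e1 := (hΔ _ hx).trans (hΔ _ hx').symm
  rw [coe_lmul, coe_lmul, red_mul, red_mul, e] at e1
  exact (isUnit_of_coprime_similitude hmN h').mul_left_injective e1

/-- If `S' = S + m R` then `B' = B + R D`, and `h'` is the translate of `h` by `N R`, an element of
`Γ(N)`. The elements `γ` and `γ'` agree modulo `N`. -/
theorem coset_eq_of_isUpper (hN : 0 < N) (hmN : m.Coprime N) {X : Set (Similitude n m)} (hX : IsHeckeSet N X)
    {γ γ' : Sp n} {h h' : Similitude n m} {A S S' R : Matrix (Fin n) (Fin n) ℤ}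
    (hu : IsUpper N h A S) (hu' : IsUpper N h' A S') (hx : lmul γ h ∈ X) (hx' : lmul γ' h' ∈ X)
    (hR : S' = S + (m : ℤ) • R) : ∃ η ∈ Gam n N, lmul γ' h' = lmul η (lmul γ h) := by
  have e := red_eq_of_isUpper hN hmN hX hu hu' hx hx'
  obtain ⟨B, D, hh, hS, h1, h2, h3, h4⟩ := hu.relations hN
  obtain ⟨B', D', hh', hS', h1', h2', h3', h4'⟩ := hu'.relations hN
  have hD : D = D' := by
    apply smul_matrix_injective h.ne_zero
    calc (m : ℤ) • D = (D' * Aᵀ) * D := by rw [h2', Matrix.smul_mul, Matrix.one_mul]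
      _ = _ := by rw [Matrix.mul_assoc, h1, Matrix.mul_smul, Matrix.mul_one]
  subst hD
  have hRs : Rᵀ = R := by
    apply smul_matrix_injective h.ne_zero
    rw [← transpose_smul, ← sub_eq_of_eq_add' hR, transpose_sub, h3, h3']
  have hB : B' = B + R * D := by
    apply smul_matrix_injective h.ne_zero
    rw [← h4', hR, add_mul, h4, smul_add, Matrix.smul_mul]
  have hNR : ((N : ℤ) • R)ᵀ = (N : ℤ) • R := by rw [transpose_smul, hRs]
  have hh1 : h' = lmul (transl ((N : ℤ) • R) hNR) h := by
    apply Subtype.ext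
    rw [coe_lmul, coe_transl, hh, hh', fromBlocks_multiply, hB]
    simp only [Matrix.mul_zero, add_zero, Matrix.one_mul, Matrix.zero_mul, zero_add,
      Matrix.smul_mul, smul_add]
  refine ⟨γ' * transl ((N : ℤ) • R) hNR * γ⁻¹, ?_, ?_⟩
  · rw [mem_Gam_iff, Submonoid.coe_mul, Submonoid.coe_mul, red_mul, red_mul, coe_transl,
      red_fromBlocks, smul_map_cast_self, ← red_one (n := n) N, ← fromBlocks_one, red_fromBlocks]
    rw [Matrix.map_zero _ (Int.cast_zero (R := ZMod N)),
      Matrix.map_one _ (Int.cast_zero (R := ZMod N)) Int.cast_one, fromBlocks_one, Matrix.mul_one,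
      ← e, red_mul_inv]
  · rw [hh1, ← lmul_mul, ← lmul_mul, inv_mul_cancel_right]

/-- A partial converse to `coset_eq_of_isUpper`. Since `A` is invertible over `ℚ`, `τ` has zero
lower left block, so its upper left block is unimodular. If that block is `1`, then `τ` is a
translation, by a multiple of `N`. -/
theorem unimodular_of_isUpper (hN : 0 < N) {τ : Sp n} (hτ : (red N (τ : Mat2 n)).IsDiag)
    {h h' : Similitude n m} {A A' S S' : Matrix (Fin n) (Fin n) ℤ}
    (hu : IsUpper N h A S) (hu' : IsUpper N h' A' S') (hh' : h' = lmul τ h) :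
    ∃ U : GL (Fin n) ℤ, ((U : Matrix (Fin n) (Fin n) ℤ).map (Int.cast : ℤ → ZMod N)).IsDiag ∧
      A' = U * A ∧ (A' = A → ∃ R, S' = S + (m : ℤ) • R) := by
  obtain ⟨B, D, h0, hS, h1, h2, h3, h4⟩ := hu.relations hN
  obtain ⟨B', D', h0', hS', h1', h2', h3', h4'⟩ := hu'.relations hN
  have hDA : A * Dᵀ = (m : ℤ) • 1 := (upper_relations h0).2.2.2.1
  obtain ⟨b1, b2, b3⟩ := τ.blocks
  have ht : (τ : Mat2 n) = fromBlocks τ.1.toBlocks₁₁ τ.1.toBlocks₁₂ τ.1.toBlocks₂₁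
    τ.1.toBlocks₂₂ := (fromBlocks_toBlocks _).symm
  have hc := congrArg Subtype.val hh'
  rw [coe_lmul, h0, h0', ht, fromBlocks_multiply, fromBlocks_inj] at hc
  rw [ht, red_fromBlocks] at hτ
  generalize τ.1.toBlocks₁₁ = a at *
  generalize τ.1.toBlocks₁₂ = b at *
  generalize τ.1.toBlocks₂₁ = c at *
  generalize τ.1.toBlocks₂₂ = d at *
  obtain ⟨c1, c2, c3, c4⟩ := hc
  have hcancel : ∀ {X Y : Matrix (Fin n) (Fin n) ℤ}, X * A = Y * A → X = Y := fun {X Y} e => by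
    have := congrArg (fun M => M * Dᵀ) e
    simp only [Matrix.mul_assoc, hDA, Matrix.mul_smul, Matrix.mul_one] at this
    exact smul_matrix_injective h.ne_zero this
  have hc0 : c = 0 := by
    apply hcancel
    rw [Matrix.mul_zero, add_zero] at c3
    rw [← c3, Matrix.zero_mul]
  rw [hc0, transpose_zero, Matrix.zero_mul, sub_zero] at b2
  have b2' : dᵀ * a = 1 := by
    have := congrArg transpose b2
    rwa [transpose_mul, transpose_transpose, transpose_one] at this
  rw [Matrix.mul_zero, add_zero] at c1
  refine ⟨⟨a, dᵀ, mul_eq_one_comm.mp b2', b2'⟩, ?_, c1, fun hA => ?_⟩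
  · intro i j hij
    exact hτ (i := Sum.inl i) (j := Sum.inl j) fun e => hij (Sum.inl_injective e)
  · have ha : a = 1 := hcancel (by rw [← c1, hA, Matrix.one_mul])
    subst ha
    rw [transpose_one, Matrix.one_mul] at b2
    subst b2
    subst hc0
    rw [Matrix.one_mul, Matrix.zero_mul, zero_add] at c4
    rw [Matrix.one_mul] at c2
    have hb : ∀ i j, ∃ r : ℤ, b i j = N * r := fun i j => by
      have : ((b i j : ℤ) : ZMod N) = 0 := hτ (i := Sum.inl i) (j := Sum.inr j) (by simp)
      rwa [ZMod.intCast_zmod_eq_zero_iff_dvd] at this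
    choose b' hb' using hb
    refine ⟨of b', ?_⟩
    have hb2 : b = (N : ℤ) • of b' := by
      ext i j; rw [hb', Matrix.smul_apply, smul_eq_mul, of_apply]
    have hB : B' = B + of b' * D := by
      apply smul_matrix_injective (c := N) (by exact_mod_cast hN.ne')
      rw [c2, hb2, smul_add, Matrix.smul_mul]
    rw [← hS', ← hS, hA, hB, add_mul, Matrix.mul_assoc, h2, Matrix.mul_smul, Matrix.mul_one]

end UpperRepresentatives

/-! ### Existence of triangular representatives and parametrization of cosets. -/

section Partition

variable {n N m : ℕ}

/-- Modulo `N` the matrix wanted is `diag(A) A⁻¹`. It is unipotent upper triangular, so lifting the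
entries above the diagonal arbitrarily gives determinant `1` over `ℤ`. -/
theorem exists_unipotent_mul_isDiag {A : Matrix (Fin n) (Fin n) ℤ} (hA : ∀ i j, j < i → A i j = 0)
    (hu : IsUnit (A.map (Int.cast : ℤ → ZMod N)).det) :
    ∃ U : GL (Fin n) ℤ,
      (((U : Matrix (Fin n) (Fin n) ℤ) * A).map (Int.cast : ℤ → ZMod N)).IsDiag := by
  set A' := A.map (Int.cast : ℤ → ZMod N) with hA'
  have hbt : A'.BlockTriangular id := fun i j hij => by
    rw [hA', map_apply, hA i j hij, Int.cast_zero]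
  let _ : Invertible A' := A'.invertibleOfIsUnitDet hu
  have hbi : A'⁻¹.BlockTriangular id := blockTriangular_inv_of_blockTriangular hbt
  have hinv : A'⁻¹ * A' = 1 := nonsing_inv_mul _ hu
  have hd : ∀ i, A'⁻¹ i i * A' i i = 1 := fun i => by
    have := congrFun (congrFun hinv i) i
    rw [one_apply_eq, Matrix.mul_apply, Finset.sum_eq_single i] at this
    · exact this
    · intro j _ hj
      rcases lt_or_gt_of_ne hj with h | h
      · rw [hbi h, zero_mul]
      · rw [hbt h, mul_zero]
    · simp
  choose lift hlift using ZMod.intCast_surjective (n := N)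
  let V : Matrix (Fin n) (Fin n) ℤ := of fun i j =>
    if i = j then 1 else if i < j then lift (A' i i * A'⁻¹ i j) else 0
  have hV : V.det = 1 := by
    rw [det_of_isUpperTriangular (fun i j hij => ?_)]
    · simp [V]
    · have h1 : j < i := hij
      simp [V, h1.ne', h1.not_gt]
  have hVmap : V.map (Int.cast : ℤ → ZMod N) = diagonal (fun i => A' i i) * A'⁻¹ := by
    ext i j
    rw [diagonal_mul, map_apply]
    simp only [V, of_apply]
    split_ifs with h1 h2
    · subst h1; rw [mul_comm, hd, Int.cast_one]
    · exact hlift _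
    · have : j < i := lt_of_le_of_ne (not_lt.mp h2) (Ne.symm h1)
      rw [hbi this, mul_zero, Int.cast_zero]
  refine ⟨nonsingInvUnit V (by rw [hV]; exact isUnit_one), ?_⟩
  have e : (V * A).map (Int.cast : ℤ → ZMod N) = V.map Int.cast * A' :=
    Matrix.map_mul (f := Int.castRingHom (ZMod N))
  have e2 : ((nonsingInvUnit V (by rw [hV]; exact isUnit_one) : GL (Fin n) ℤ) :
    Matrix (Fin n) (Fin n) ℤ) = V := rfl
  rw [e2, e, hVmap, Matrix.mul_assoc, hinv, Matrix.mul_one]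
  exact isDiag_diagonal _

theorem isUnit_upper_det (hmN : m.Coprime N) {h : Similitude n m}
    {A B D : Matrix (Fin n) (Fin n) ℤ} (hh : h.1 = fromBlocks A B 0 D) :
    IsUnit (A.map (Int.cast : ℤ → ZMod N)).det ∧ IsUnit (D.map (Int.cast : ℤ → ZMod N)).det := by
  have h1 := isUnit_of_coprime_similitude hmN h
  rw [hh, red_fromBlocks, Matrix.map_zero _ (Int.cast_zero (R := ZMod N)),
    Matrix.isUnit_iff_isUnit_det, det_fromBlocks_zero₂₁] at h1
  exact IsUnit.mul_iff.mp h1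

theorem coe_lmul_levi (U : GL (Fin n) ℤ) {h : Similitude n m} {A B D : Matrix (Fin n) (Fin n) ℤ}
    (hh : h.1 = fromBlocks A B 0 D) : (lmul (levi U) h).1 =
      fromBlocks ((U : Matrix (Fin n) (Fin n) ℤ) * A) ((U : Matrix (Fin n) (Fin n) ℤ) * B) 0 (((U⁻¹ : GL (Fin n) ℤ) : Matrix (Fin n) (Fin n) ℤ)ᵀ * D) := by
  rw [coe_lmul, coe_levi, hh, fromBlocks_multiply]
  simp

/-- Every element of a Hecke set of similitude prime to the level has an upper triangular
representative. -/
theorem exists_isUpper_lmul (hmN : m.Coprime N) {X : Set (Similitude n m)}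
    (hX : IsHeckeSet N X) {x : Similitude n m} (hx : x ∈ X) :
    ∃ (γ : Sp n) (h : Similitude n m) (A S : Matrix (Fin n) (Fin n) ℤ),
      (red N (γ : Mat2 n)).IsDiag ∧ lmul γ h = x ∧ IsUpper N h A S := by
  obtain ⟨Δ, hΔ⟩ := hX.isDiag
  obtain ⟨γ₁, -, hC, hA⟩ := exists_upper ⊤ (fun _ => Subgroup.mem_top _)
    (fun _ => Subgroup.mem_top _) x
  have hh := (fromBlocks_toBlocks (lmul γ₁ x).1).symm
  rw [hC] at hh
  set h₁ := lmul γ₁ x with hh1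
  clear_value h₁
  generalize h₁.1.toBlocks₁₁ = A at *
  generalize h₁.1.toBlocks₁₂ = B at *
  generalize h₁.1.toBlocks₂₂ = D at *
  obtain ⟨U, hU⟩ := exists_unipotent_mul_isDiag hA (isUnit_upper_det hmN hh).1
  have hh2 := coe_lmul_levi U hh
  set h₂ := lmul (levi U) h₁ with hh2'
  generalize (U : Matrix (Fin n) (Fin n) ℤ) * A = A₂ at *
  generalize (U : Matrix (Fin n) (Fin n) ℤ) * B = B₂ at *
  generalize ((U⁻¹ : GL (Fin n) ℤ) : Matrix (Fin n) (Fin n) ℤ)ᵀ * D = D₂ at *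
  obtain ⟨r1, r2, r3, r4, r5, r6⟩ := upper_relations hh2
  have hmu : IsUnit ((m : ℤ) : ZMod N) := by
    rw [Int.cast_natCast]; exact (ZMod.isUnit_iff_coprime m N).mpr hmN
  obtain ⟨w, hw⟩ := hmu.exists_right_inv
  choose lift hlift using ZMod.intCast_surjective (n := N)
  -- With `w = m⁻¹` modulo `N`, the choice `S ≡ -w B Aᵀ` gives `B + S D ≡ B - w m B = 0`. The lift
  -- is a function of the residue, so `S` inherits the symmetry of `B Aᵀ`.
  let S : Matrix (Fin n) (Fin n) ℤ := of fun i j => lift (-w * (((B₂ * A₂ᵀ) i j : ℤ) : ZMod N))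
  have hS : Sᵀ = S := by
    ext i j
    simp only [S, transpose_apply, of_apply]
    rw [← transpose_apply (B₂ * A₂ᵀ) i j, r6]
  have hSmap : S.map (Int.cast : ℤ → ZMod N) = (-w) • (B₂ * A₂ᵀ).map (Int.cast : ℤ → ZMod N) := by
    ext i j
    rw [map_apply, Matrix.smul_apply, map_apply, smul_eq_mul]
    exact hlift _
  have hmm : ∀ X Y : Matrix (Fin n) (Fin n) ℤ, (X * Y).map (Int.cast : ℤ → ZMod N) =
    X.map Int.cast * Y.map Int.cast := fun X Y => Matrix.map_mul (f := Int.castRingHom (ZMod N))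
  have hma : ∀ X Y : Matrix (Fin n) (Fin n) ℤ, (X + Y).map (Int.cast : ℤ → ZMod N) =
    X.map Int.cast + Y.map Int.cast := fun X Y => Matrix.map_add _ (fun a b => Int.cast_add a b) X Y
  have hmsm : ((m : ℤ) • (1 : Matrix (Fin n) (Fin n) ℤ)).map (Int.cast : ℤ → ZMod N) =
      ((m : ℤ) : ZMod N) • 1 := by
    ext i j
    rw [map_apply, Matrix.smul_apply, Matrix.smul_apply, smul_eq_mul, smul_eq_mul, Int.cast_mul,
      one_apply, one_apply]
    split_ifs <;> simp
  have hB : (B₂ + S * D₂).map (Int.cast : ℤ → ZMod N) = 0 := by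
    rw [hma, hmm, hSmap, Matrix.smul_mul, ← hmm, Matrix.mul_assoc, r1, hmm, hmsm, Matrix.mul_smul,
      Matrix.mul_one, smul_smul, neg_mul, mul_comm w, hw, neg_smul, one_smul, add_neg_cancel]
  have hB' : ∃ B₃ : Matrix (Fin n) (Fin n) ℤ, B₂ + S * D₂ = (N : ℤ) • B₃ := by
    have : ∀ i j, ∃ b : ℤ, (B₂ + S * D₂) i j = N * b := fun i j => by
      have := congrFun (congrFun hB i) j
      rw [map_apply, Matrix.zero_apply, ZMod.intCast_zmod_eq_zero_iff_dvd] at this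
      exact this
    choose b hb using this
    exact ⟨of b, by ext i j; rw [hb, Matrix.smul_apply, of_apply, smul_eq_mul]⟩
  obtain ⟨B₃, hB₃⟩ := hB'
  have hh3 : (lmul (transl S hS) h₂).1 = fromBlocks A₂ ((N : ℤ) • B₃) 0 D₂ := by
    rw [coe_lmul, coe_transl, hh2, fromBlocks_multiply, ← hB₃]
    simp
  set τ : Sp n := transl S hS * levi U * γ₁ with hτ
  have hh4 : lmul τ x = lmul (transl S hS) h₂ := by
    rw [hτ, lmul_mul, lmul_mul, ← hh1]
  have hD : (D₂.map (Int.cast : ℤ → ZMod N)).IsDiag := by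
    apply isDiag_of_mul_eq_one (G := w • (A₂ᵀ).map Int.cast)
    · rw [transpose_map]
      exact hU.transpose.smul _
    · rw [Matrix.mul_smul, ← hmm, r2, hmsm, smul_smul, mul_comm, hw, one_smul]
  have hdiag : (red N (lmul τ x).1).IsDiag := by
    rw [hh4, hh3, red_fromBlocks, smul_map_cast_self,
      Matrix.map_zero _ (Int.cast_zero (R := ZMod N))]
    exact hU.fromBlocks hD
  -- Both `x` and `τ x` are diagonal modulo `N`, and the second is invertible there.
  have hτinv : (red N ((τ⁻¹ : Sp n) : Mat2 n)).IsDiag := by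
    obtain ⟨d, hd⟩ : ∃ d, red N (lmul τ x).1 = diagonal d :=
      ⟨_, ((isDiag_iff_diagonal_diag _).mp hdiag).symm⟩
    have e : red N ((τ⁻¹ : Sp n) : Mat2 n) * diagonal d = diagonal Δ := by
      rw [← hd, coe_lmul, red_mul, ← Matrix.mul_assoc, red_inv_mul, Matrix.one_mul, hΔ x hx]
    have hu := isUnit_of_coprime_similitude hmN (lmul τ x)
    rw [hd] at hu
    obtain ⟨i, hi⟩ := (Matrix.isUnit_diagonal.mp hu).exists_right_inv
    intro a b hab
    have := congrFun (congrFun e a) b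
    rw [mul_diagonal, diagonal_apply_ne _ hab] at this
    have h5 : d b * i b = 1 := congrFun hi b
    rw [← mul_one (red N ((τ⁻¹ : Sp n) : Mat2 n) a b), ← h5, ← mul_assoc, this, zero_mul]
  refine ⟨τ⁻¹, lmul τ x, A₂, _, hτinv, ?_, B₃, D₂, hh4 ▸ hh3, rfl⟩
  rw [← lmul_mul, inv_mul_cancel, one_lmul]

/-- Left multiplication by unimodular matrices that are diagonal modulo `N`. -/
def unimodularSetoid (n N : ℕ) : Setoid (Matrix (Fin n) (Fin n) ℤ) where
  r A A' := ∃ U : GL (Fin n) ℤ,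
    ((U : Matrix (Fin n) (Fin n) ℤ).map (Int.cast : ℤ → ZMod N)).IsDiag ∧ A' = U * A
  iseqv := by
    have hmm : ∀ X Y : Matrix (Fin n) (Fin n) ℤ, (X * Y).map (Int.cast : ℤ → ZMod N) =
      X.map Int.cast * Y.map Int.cast := fun X Y => Matrix.map_mul (f := Int.castRingHom (ZMod N))
    have hm1 : (1 : Matrix (Fin n) (Fin n) ℤ).map (Int.cast : ℤ → ZMod N) = 1 :=
      Matrix.map_one _ Int.cast_zero Int.cast_one
    refine ⟨fun A => ⟨1, ?_, by simp⟩, ?_, ?_⟩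
    · rw [Units.val_one, hm1]; exact isDiag_one
    · rintro A A' ⟨U, hU, rfl⟩
      refine ⟨U⁻¹, isDiag_of_mul_eq_one hU ?_, by rw [Units.inv_mul_cancel_left]⟩
      rw [← hmm, Units.inv_mul, hm1]
    · rintro A A' A'' ⟨U, hU, rfl⟩ ⟨V, hV, rfl⟩
      refine ⟨V * U, ?_, by rw [Units.val_mul, Matrix.mul_assoc]⟩
      rw [Units.val_mul, hmm, ← (isDiag_iff_diagonal_diag _).mp hU,
        ← (isDiag_iff_diagonal_diag _).mp hV, diagonal_mul_diagonal]
      exact isDiag_diagonal _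

/-- `S` occurs with the diagonal block `A` among the upper triangular representatives of `X`. -/
def Occurs (N : ℕ) (X : Set (Similitude n m)) (A S : Matrix (Fin n) (Fin n) ℤ) : Prop :=
  ∃ (γ : Sp n) (h : Similitude n m), (red N (γ : Mat2 n)).IsDiag ∧ lmul γ h ∈ X ∧ IsUpper N h A S

/-- The cosets in a Hecke set are parametrized by a diagonal block `A` and a symmetric matrix `S`
modulo `m`. -/
theorem exists_coset_parameters (hN : 0 < N) (hmN : m.Coprime N) {X : Set (Similitude n m)}
    (hX : IsHeckeSet N X) : ∃ κ σ : Quotient (cosetSetoid N X) → Matrix (Fin n) (Fin n) ℤ,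
      (∀ c, ∃ (γ : Sp n) (h : Similitude n m), (red N (γ : Mat2 n)).IsDiag ∧
        lmul γ h = c.out.1 ∧ IsUpper N h (κ c) (σ c)) ∧
      (∀ c c', κ c = κ c' → (σ c).map (Int.cast : ℤ → ZMod m) = (σ c').map Int.cast → c = c') ∧
      ∀ c S, Occurs N X (κ c) S → ∃ c', κ c' = κ c ∧
        (σ c').map (Int.cast : ℤ → ZMod m) = S.map Int.cast := by
  have hmm : ∀ X Y : Matrix (Fin n) (Fin n) ℤ, (X * Y).map (Int.cast : ℤ → ZMod N) =
    X.map Int.cast * Y.map Int.cast := fun X Y => Matrix.map_mul (f := Int.castRingHom (ZMod N))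
  -- The block `A` is moved by a Levi element to the chosen representative of its unimodular class,
  -- so that equivalent blocks become equal blocks.
  have key : ∀ c : Quotient (cosetSetoid N X), ∃ (A S : Matrix (Fin n) (Fin n) ℤ) (γ : Sp n)
      (h : Similitude n m), (red N (γ : Mat2 n)).IsDiag ∧ lmul γ h = c.out.1 ∧ IsUpper N h A S ∧
      A = (Quotient.mk (unimodularSetoid n N) A).out := fun c => by
    obtain ⟨γ, h, A, S, hγ, hx, B, D, hh, hS⟩ := exists_isUpper_lmul hmN hX c.out.2
    obtain ⟨U, hU, hA⟩ : (unimodularSetoid n N) A (Quotient.mk (unimodularSetoid n N) A).out :=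
      (unimodularSetoid n N).symm (Quotient.mk_out (s := unimodularSetoid n N) A)
    have hUi : (((U⁻¹ : GL (Fin n) ℤ) : Matrix (Fin n) (Fin n) ℤ).map
        (Int.cast : ℤ → ZMod N)).IsDiag := isDiag_of_mul_eq_one hU (by
      rw [← hmm, Units.inv_mul, Matrix.map_one _ Int.cast_zero Int.cast_one])
    have hl : (red N ((levi U⁻¹ : Sp n) : Mat2 n)).IsDiag := by
      rw [coe_levi, red_fromBlocks, Matrix.map_zero _ (Int.cast_zero (R := ZMod N)), inv_inv]
      exact hUi.fromBlocks (by rw [transpose_map]; exact hU.transpose)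
    have hl1 : levi U⁻¹ * levi U = 1 := by
      apply Subtype.ext
      rw [Submonoid.coe_mul, coe_levi, coe_levi, fromBlocks_multiply, ← transpose_mul, inv_inv,
        Units.inv_mul]
      simp
    have hq : Quotient.mk (unimodularSetoid n N) ((U : Matrix (Fin n) (Fin n) ℤ) * A) =
        Quotient.mk (unimodularSetoid n N) A :=
      Quotient.sound ((unimodularSetoid n N).symm ⟨U, hU, rfl⟩)
    refine ⟨(U : Matrix (Fin n) (Fin n) ℤ) * A, (U : Matrix (Fin n) (Fin n) ℤ) * B * ((U : Matrix (Fin n) (Fin n) ℤ) * A)ᵀ, γ * levi U⁻¹, lmul (levi U) h,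
      ?_, ?_, ⟨(U : Matrix (Fin n) (Fin n) ℤ) * B,
      ((U⁻¹ : GL (Fin n) ℤ) : Matrix (Fin n) (Fin n) ℤ)ᵀ * D, ?_, rfl⟩, ?_⟩
    · rw [Submonoid.coe_mul, red_mul, ← (isDiag_iff_diagonal_diag _).mp hγ,
        ← (isDiag_iff_diagonal_diag _).mp hl, diagonal_mul_diagonal]
      exact isDiag_diagonal _
    · rw [← lmul_mul, mul_assoc, hl1, mul_one, hx]
    · rw [coe_lmul_levi U hh, Matrix.mul_smul]
    · rw [hq, ← hA]
  choose κ σ γ h hγ hx hu hκ using key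
  refine ⟨κ, σ, fun c => ⟨γ c, h c, hγ c, hx c, hu c⟩, fun c c' h1 h2 => ?_, fun c S => ?_⟩
  · obtain ⟨R, hR⟩ : ∃ R, σ c' = σ c + (m : ℤ) • R := by
      have : ∀ i j, ∃ r : ℤ, σ c' i j = σ c i j + m * r := fun i j => by
        have h3 : ((σ c i j : ℤ) : ZMod m) = (σ c' i j : ℤ) := congrFun (congrFun h2 i) j
        obtain ⟨r, hr⟩ := (ZMod.intCast_eq_intCast_iff_dvd_sub _ _ _).mp h3
        exact ⟨r, by rw [← hr]; ring⟩
      choose r hr using this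
      exact ⟨of r, by ext i j; rw [hr, Matrix.add_apply, Matrix.smul_apply, of_apply, smul_eq_mul]⟩
    obtain ⟨η, hη, e⟩ := coset_eq_of_isUpper hN hmN hX (hu c) (h1 ▸ hu c')
      (by rw [hx]; exact c.out.2) (by rw [hx]; exact c'.out.2) hR
    rw [hx, hx] at e
    rw [← Quotient.out_eq c, ← Quotient.out_eq c']
    exact ((Quotient.sound (cosetSetoid_iff.mpr ⟨η, hη, e.symm⟩))).symm
  · rintro ⟨γ', h', hγ', hx', hu'⟩
    set c' : Quotient (cosetSetoid N X) := Quotient.mk (cosetSetoid N X) ⟨_, hx'⟩ with hc'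
    obtain ⟨η, hη, e⟩ := exists_lmul_out (N := N) (⟨_, hx'⟩ : X)
    rw [← hc', ← hx c', ← lmul_mul] at e
    have e2 : h c' = lmul ((γ c')⁻¹ * (η * γ')) h' := by
      rw [lmul_mul, e, ← lmul_mul, inv_mul_cancel, one_lmul]
    have hτ : (red N (((γ c')⁻¹ * (η * γ') : Sp n) : Mat2 n)).IsDiag := by
      rw [Submonoid.coe_mul, red_mul, Submonoid.coe_mul, red_mul, mem_Gam_iff.mp hη, Matrix.one_mul,
        ← (isDiag_iff_diagonal_diag _).mp hγ', ← (isDiag_iff_diagonal_diag _).mp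
          (isDiag_of_mul_eq_one (hγ c') (red_inv_mul N (γ c'))), diagonal_mul_diagonal]
      exact isDiag_diagonal _
    obtain ⟨U, hU, hA, hR⟩ := unimodular_of_isUpper hN hτ hu' (hu c') e2
    have hA2 : κ c' = κ c := by
      rw [hκ c', hκ c]
      refine congrArg _ (Quotient.sound ((unimodularSetoid n N).symm ⟨U, hU, hA⟩))
    refine ⟨c', hA2, ?_⟩
    obtain ⟨R, hR⟩ := hR hA2
    rw [hR]
    ext i j
    rw [map_apply, map_apply, Matrix.add_apply, Matrix.smul_apply, smul_eq_mul, Int.cast_add,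
      Int.cast_mul, Int.cast_natCast, ZMod.natCast_self, zero_mul, add_zero]

end Partition

/-! ### Stability properties of the matrices `S` occurring with a given block. -/

section Stability

variable {n N m : ℕ}

theorem Occurs.exists_dual (hN : 0 < N) {X : Set (Similitude n m)}
    {A S : Matrix (Fin n) (Fin n) ℤ} (h : Occurs N X A S) :
    Sᵀ = S ∧ ∃ D, Aᵀ * D = (m : ℤ) • 1 := by
  obtain ⟨γ, h, -, -, hu⟩ := h
  obtain ⟨B, D, -, -, h1, -, h2, -⟩ := hu.relations hN
  exact ⟨h2, D, h1⟩

/-- Right translation by `[1 NR; 0 1]`, which lies in `Γ(N)`, replaces `B` by `B + A R`. -/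
theorem Occurs.add_conj {X : Set (Similitude n m)} (hX : IsHeckeSet N X)
    {A S : Matrix (Fin n) (Fin n) ℤ} (h : Occurs N X A S) {R : Matrix (Fin n) (Fin n) ℤ}
    (hR : Rᵀ = R) : Occurs N X A (S + A * R * Aᵀ) := by
  obtain ⟨γ, h, hγ, hx, B, D, hh, hS⟩ := h
  have hNR : ((N : ℤ) • R)ᵀ = (N : ℤ) • R := by rw [transpose_smul, hR]
  refine ⟨γ, rmul h (transl _ hNR), hγ, ?_, B + A * R, D, ?_, ?_⟩
  · rw [lmul_rmul]
    refine hX.rmul_mem _ ?_ _ hx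
    rw [mem_Gam_iff, coe_transl, red_fromBlocks, smul_map_cast_self,
      Matrix.map_zero _ (Int.cast_zero (R := ZMod N)),
      Matrix.map_one _ (Int.cast_zero (R := ZMod N)) Int.cast_one, fromBlocks_one]
  · rw [coe_rmul, coe_transl, hh, fromBlocks_multiply]
    simp only [Matrix.mul_one, Matrix.mul_zero, add_zero, Matrix.zero_mul, Matrix.mul_smul,
      smul_zero, smul_add, add_comm]
  · rw [add_mul, hS]

/-- Upper triangular similitudes with the same diagonal blocks agree modulo `N`. -/
theorem exists_isUpper_red_eq (hN : 0 < N) {h : Similitude n m} {A S S' D B' : Matrix (Fin n) (Fin n) ℤ}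
    (hu : IsUpper N h A S) (hD : Aᵀ * D = (m : ℤ) • 1) (hS' : S'ᵀ = S')
    (hB' : S' * D = (m : ℤ) • B') :
    ∃ h' : Similitude n m, IsUpper N h' A S' ∧ red N h'.1 = red N h.1 := by
  obtain ⟨B, D', hh, hS, h1, h2, -, -⟩ := hu.relations hN
  have hDD : D = D' := by
    apply smul_matrix_injective h.ne_zero
    calc (m : ℤ) • D = (D' * Aᵀ) * D := by rw [h2, Matrix.smul_mul, Matrix.one_mul]
      _ = _ := by rw [Matrix.mul_assoc, hD, Matrix.mul_smul, Matrix.mul_one]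
  obtain ⟨h', hh', hu'⟩ := exists_isUpper (N := N) h.2.1 hD hS' hB'
  refine ⟨h', hu', ?_⟩
  rw [hh, hh', red_fromBlocks, red_fromBlocks, smul_map_cast_self, smul_map_cast_self, hDD]

/-- Membership in the congruence set depends only on the residue modulo `N`, which does not see `S`.
Hence every symmetric `R` with `R D` divisible by `m` may be added, more than `add_conj` provides in
general. -/
theorem Occurs.congruenceSet_add (hN : 0 < N) {A S D R B : Matrix (Fin n) (Fin n) ℤ}
    (h : Occurs N (congruenceSet n N m) A S) (hD : Aᵀ * D = (m : ℤ) • 1) (hR : Rᵀ = R)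
    (hRD : R * D = (m : ℤ) • B) : Occurs N (congruenceSet n N m) A (S + R) := by
  obtain ⟨γ, h, hγ, hx, hu⟩ := h
  obtain ⟨B', D', hh, hS, h1, h2, h3, h4⟩ := hu.relations hN
  have hDD : D = D' := by
    apply smul_matrix_injective h.ne_zero
    calc (m : ℤ) • D = (D' * Aᵀ) * D := by rw [h2, Matrix.smul_mul, Matrix.one_mul]
      _ = _ := by rw [Matrix.mul_assoc, hD, Matrix.mul_smul, Matrix.mul_one]
  obtain ⟨h', hu', e⟩ := exists_isUpper_red_eq (S' := S + R) (B' := B' + B) hN hu hD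
    (by rw [transpose_add, h3, hR]) (by rw [add_mul, hRD, hDD, h4, smul_add])
  refine ⟨γ, h', hγ, ?_, hu'⟩
  have : red N (lmul γ h).1 = _ := hx
  change red N (lmul γ h').1 = _
  rw [← this, coe_lmul, coe_lmul, red_mul, red_mul, e]

theorem Occurs.congruenceSet_smul (hN : 0 < N) {A S : Matrix (Fin n) (Fin n) ℤ}
    (h : Occurs N (congruenceSet n N m) A S) (c : ℤ) :
    Occurs N (congruenceSet n N m) A (c • S) := by
  obtain ⟨γ, h, hγ, hx, hu⟩ := h
  obtain ⟨B', D', hh, hS, h1, h2, h3, h4⟩ := hu.relations hN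
  obtain ⟨h', hu', e⟩ := exists_isUpper_red_eq (S' := c • S) (B' := c • B') hN hu h1
    (by rw [transpose_smul, h3]) (by rw [Matrix.smul_mul, h4, smul_comm])
  refine ⟨γ, h', hγ, ?_, hu'⟩
  have : red N (lmul γ h).1 = _ := hx
  change red N (lmul γ h').1 = _
  rw [← this, coe_lmul, coe_lmul, red_mul, red_mul, e]

/-- Scaling `S` by `c` is conjugation of `h` by `diag(c, 1)` modulo `N m`. The condition `c ≡ 1`
modulo `N` is what `doubleCoset_eps` needs. -/
theorem Occurs.doubleCoset_smul [NeZero N] {g₁ g₂ : Fin n → ℤ} (hg : ∀ i, g₁ i * g₂ i = m)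
    {A S : Matrix (Fin n) (Fin n) ℤ}
    (h : Occurs N (doubleCoset N m (diagonal (Sum.elim g₁ g₂))) A S) {c : ℤ}
    (hc : (c : ZMod N) = 1) (hcu : IsUnit (c : ZMod (N * m))) :
    Occurs N (doubleCoset N m (diagonal (Sum.elim g₁ g₂))) A (c • S) := by
  obtain ⟨γ, h, hγ, hx, hu⟩ := h
  obtain ⟨B', D', hh, hS, h1, h2, h3, h4⟩ := hu.relations (Nat.pos_of_ne_zero (NeZero.ne N))
  obtain ⟨u, hcu⟩ := hcu
  obtain ⟨h', hh', hu'⟩ := exists_isUpper (N := N) (S := c • S) (B := c • B') h.2.1 h1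
    (by rw [transpose_smul, h3]) (by rw [Matrix.smul_mul, h4, smul_comm])
  refine ⟨γ, h', hγ, doubleCoset_eps (u := u) (by rw [hcu, map_intCast, hc]) hg ?_ hx, hu'⟩
  rw [hh, hh', red_fromBlocks, red_fromBlocks, epsMatrix, fromBlocks_multiply, fromBlocks_multiply,
    Matrix.map_zero _ (Int.cast_zero (R := ZMod (N * m)))]
  have : ((N : ℤ) • c • B').map (Int.cast : ℤ → ZMod (N * m)) =
      (c : ZMod (N * m)) • ((N : ℤ) • B').map (Int.cast : ℤ → ZMod (N * m)) := by
    rw [smul_comm]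
    exact Matrix.ext fun i j => Int.cast_mul _ _
  rw [this, hcu]
  simp

/-- Integers prime to `m` can be modified modulo `m` to be congruent to `1` modulo `N`. -/
theorem exists_int_lift_unit [NeZero N] (hm : 0 < m) (hmN : m.Coprime N) (v : (ZMod m)ˣ) :
    ∃ c : ℤ, (c : ZMod N) = 1 ∧ (c : ZMod m) = v ∧ IsUnit (c : ZMod (N * m)) := by
  have : NeZero m := ⟨hm.ne'⟩
  obtain ⟨k, h1, h2⟩ := Nat.chineseRemainder hmN.symm 1 (v : ZMod m).val
  have e1 : ((k : ℕ) : ZMod N) = 1 := by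
    have := (ZMod.natCast_eq_natCast_iff k 1 N).mpr h1
    rwa [Nat.cast_one] at this
  have e2 : ((k : ℕ) : ZMod m) = v := by
    have := (ZMod.natCast_eq_natCast_iff k (v : ZMod m).val m).mpr h2
    rwa [ZMod.natCast_zmod_val] at this
  refine ⟨k, by rw [Int.cast_natCast, e1], by rw [Int.cast_natCast, e2], ?_⟩
  rw [Int.cast_natCast, ZMod.isUnit_iff_coprime]
  refine Nat.Coprime.mul_right ?_ ?_
  · rw [← ZMod.isUnit_iff_coprime, e1]; exact isUnit_one
  · rw [← ZMod.isUnit_iff_coprime, e2]; exact v.isUnit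

end Stability

/-! ### Exponential sums over unit-stable sets -/

section CharacterSums

theorem sum_eq_card_mul_sum_quotient {V : Type*} [AddCommGroup V] [Fintype V] (H : AddSubgroup V)
    (g : V → ℂ) (hg : ∀ s, ∀ h ∈ H, g (s + h) = g s) :
    ∃ q : Finset V, ∑ s, g s = (Nat.card H : ℂ) * ∑ s ∈ q, g s := by
  classical
  have e : Function.Bijective fun x : (V ⧸ H) × H => x.1.out + (x.2 : V) := by
    have hmk : ∀ x : (V ⧸ H) × H, ((x.1.out + (x.2 : V) : V) : V ⧸ H) = x.1 := fun x => by
      rw [QuotientAddGroup.mk_add, (QuotientAddGroup.eq_zero_iff _).mpr x.2.2, add_zero,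
        QuotientAddGroup.out_eq']
    constructor
    · intro x y hxy
      have h1 : x.1 = y.1 := by
        rw [← hmk x, ← hmk y]; exact congrArg _ hxy
      refine Prod.ext h1 (Subtype.ext ?_)
      simp only [h1] at hxy
      exact add_left_cancel hxy
    · intro v
      refine ⟨((v : V ⧸ H), ⟨-(v : V ⧸ H).out + v, ?_⟩), by simp⟩
      rw [← QuotientAddGroup.eq, QuotientAddGroup.out_eq']
  have : Fintype (V ⧸ H) := Fintype.ofFinite _
  have : Fintype H := Fintype.ofFinite _
  refine ⟨Finset.univ.image fun q : V ⧸ H => q.out, ?_⟩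
  rw [← (Equiv.ofBijective _ e).sum_comp, Fintype.sum_prod_type, Finset.sum_image, Finset.mul_sum]
  · refine Finset.sum_congr rfl fun q _ => ?_
    rw [Finset.sum_congr rfl fun h _ => show g ((Equiv.ofBijective _ e) (q, h)) = g q.out from
      hg _ _ h.2]
    simp [Nat.card_eq_fintype_card]
  · intro q _ q' _ h
    rw [← QuotientAddGroup.out_eq' q, ← QuotientAddGroup.out_eq' q']
    exact congrArg _ h

/-- Translating by `h` permutes `F` and multiplies the sum by a root of unity different from `1`. -/
theorem charSum_eq_zero {m : ℕ} [NeZero m] {V : Type*} [AddCommGroup V] [Module (ZMod m) V]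
    {F : Finset V} (ψ : V →ₗ[ZMod m] ZMod m) {h : V}
    (hF : ∀ s ∈ F, s + h ∈ F) (hh : ψ h ≠ 0) : ∑ s ∈ F, ZMod.stdAddChar (ψ s) = (0 : ℂ) := by
  classical
  have e : ∑ s ∈ F, ZMod.stdAddChar (ψ s) = ZMod.stdAddChar (ψ h) *
      ∑ s ∈ F, (ZMod.stdAddChar (ψ s) : ℂ) := by
    have hi : F.image (· + h) = F := Finset.eq_of_subset_of_card_le
      (fun x hx => by
        obtain ⟨s, hs, rfl⟩ := Finset.mem_image.mp hx
        exact hF s hs)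
      (Finset.card_image_of_injective _ (add_left_injective h)).ge
    conv_lhs => rw [← hi, Finset.sum_image (fun _ _ _ _ hxy => add_left_injective h hxy)]
    rw [Finset.mul_sum]
    exact Finset.sum_congr rfl fun s _ => by rw [map_add, AddChar.map_add_eq_mul, mul_comm]
  have h1 : (ZMod.stdAddChar (ψ h) : ℂ) ≠ 1 := fun h1 => hh (ZMod.injective_stdAddChar (by
    rw [h1, AddChar.map_zero_eq_one]))
  have h2 : (ZMod.stdAddChar (ψ h) - 1 : ℂ) * ∑ s ∈ F, (ZMod.stdAddChar (ψ s) : ℂ) = 0 := by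
    rw [sub_mul, one_mul, ← e, sub_self]
  exact (mul_eq_zero.mp h2).resolve_left (sub_ne_zero.mpr h1)

variable {p δ : ℕ} [Fact p.Prime]

theorem isUnit_iff_notMem_zmultiples (hδ : δ ≠ 0) (a : ZMod (p ^ δ)) :
    IsUnit a ↔ a ∉ AddSubgroup.zmultiples (p : ZMod (p ^ δ)) := by
  have hp : p.Prime := Fact.out
  have : NeZero (p ^ δ) := ⟨pow_ne_zero _ hp.ne_zero⟩
  have h1 : ∀ z : ℤ, ((z : ZMod (p ^ δ)) ∈ AddSubgroup.zmultiples (p : ZMod (p ^ δ))) ↔ (p : ℤ) ∣ z := fun z => by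
    rw [AddSubgroup.mem_zmultiples_iff]
    constructor
    · rintro ⟨k, hk⟩
      rw [zsmul_eq_mul, ← Int.cast_natCast (R := ZMod (p ^ δ)) p, ← Int.cast_mul] at hk
      have h2 := (ZMod.intCast_eq_intCast_iff_dvd_sub _ _ _).mp hk
      have h3 : (p : ℤ) ∣ ((p ^ δ : ℕ) : ℤ) := by exact_mod_cast dvd_pow_self p hδ
      have := dvd_add (h3.trans h2) (dvd_mul_left (p : ℤ) k)
      rwa [sub_add_cancel] at this
    · rintro ⟨k, rfl⟩
      exact ⟨k, by rw [zsmul_eq_mul, Int.cast_mul, Int.cast_natCast, mul_comm]⟩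
  have h2 := h1 a.val
  rw [Int.cast_natCast, ZMod.natCast_zmod_val, Int.natCast_dvd_natCast] at h2
  rw [h2, ← ZMod.isUnit_natCast_iff_not_dvd_pow hp (Nat.pos_of_ne_zero hδ), ZMod.natCast_zmod_val]

/-- The sum of an additive character of `ℤ/p^δ` over all unit multiples of an element is an
integer. -/
theorem exists_int_sum_units (hδ : δ ≠ 0) (y : ZMod (p ^ δ)) :
    ∃ r : ℤ, ∑ u : (ZMod (p ^ δ))ˣ, ZMod.stdAddChar ((u : ZMod (p ^ δ)) * y) = (r : ℂ) := by
  classical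
  set K := AddSubgroup.zmultiples (p : ZMod (p ^ δ))
  have hsum : ∀ H : AddSubgroup (ZMod (p ^ δ)), ∃ r : ℤ,
      ∑ a : H, ZMod.stdAddChar ((a : ZMod (p ^ δ)) * y) = (r : ℂ) := fun H => by
    let χ : AddChar H ℂ := ((ZMod.stdAddChar (N := p ^ δ)).compAddMonoidHom
      (AddMonoidHom.mulRight y)).compAddMonoidHom H.subtype
    have h1 : ∀ a : H, ZMod.stdAddChar ((a : ZMod (p ^ δ)) * y) = χ a := fun a => rfl
    rw [Finset.sum_congr rfl fun a _ => h1 a, AddChar.sum_eq_ite]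
    split_ifs
    · exact ⟨Fintype.card H, by simp⟩
    · exact ⟨0, by simp⟩
  -- The units are the complement of the subgroup generated by `p`, and the sum of a character over
  -- a subgroup is its order or zero.
  obtain ⟨r, hr⟩ := hsum ⊤
  obtain ⟨r', hr'⟩ := hsum K
  refine ⟨r - r', ?_⟩
  have e1 : ∑ a : (⊤ : AddSubgroup (ZMod (p ^ δ))), ZMod.stdAddChar ((a : ZMod (p ^ δ)) * y) =
      ∑ a : ZMod (p ^ δ), ZMod.stdAddChar (a * y) :=
    AddSubgroup.topEquiv.toEquiv.sum_comp fun a : ZMod (p ^ δ) =>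
      (ZMod.stdAddChar (a * y) : ℂ)
  have e2 : ∑ a : K, ZMod.stdAddChar ((a : ZMod (p ^ δ)) * y) =
      ∑ a ∈ Finset.univ.filter (· ∈ K), ZMod.stdAddChar (a * y) :=
    (Finset.sum_subtype _ (by simp) fun a => (ZMod.stdAddChar (a * y) : ℂ)).symm
  have e3 : ∑ u : (ZMod (p ^ δ))ˣ, ZMod.stdAddChar ((u : ZMod (p ^ δ)) * y) =
      ∑ a ∈ Finset.univ.filter (¬ · ∈ K), ZMod.stdAddChar (a * y) := by
    refine Finset.sum_bij (fun u _ => (u : ZMod (p ^ δ))) (fun u _ => ?_) (fun u _ v _ h => Units.ext h)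
      (fun a ha => ?_) fun u _ => rfl
    · simpa using (isUnit_iff_notMem_zmultiples hδ _).mp u.isUnit
    · obtain ⟨u, hu⟩ := (isUnit_iff_notMem_zmultiples hδ a).mpr (by simpa using ha)
      exact ⟨u, Finset.mem_univ _, hu⟩
  rw [e3, Int.cast_sub, ← hr, ← hr', e1, e2, eq_sub_iff_add_eq', Finset.sum_filter_add_sum_filter_not]

theorem isIntegral_stdAddChar (y : ZMod (p ^ δ)) :
    IsIntegral ℤ (ZMod.stdAddChar y : ℂ) := by
  have hp : 0 < p ^ δ := pow_pos (Fact.out : p.Prime).pos _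
  refine IsIntegral.of_pow hp ?_
  rw [← AddChar.map_nsmul_eq_pow, nsmul_eq_mul, ZMod.natCast_self, zero_mul,
    AddChar.map_zero_eq_one]
  exact isIntegral_one

variable {V : Type*} [AddCommGroup V] [Module (ZMod (p ^ δ)) V]

/-- If `ψ` is nontrivial on `H` the sum is zero. Otherwise it is `|H|` times a sum of roots of unity
over representatives modulo `H`, so the quotient is an algebraic integer; it is also rational, and
`ℤ` is integrally closed. -/
theorem charSum_eq_card_mul [Fintype V] (hδ : δ ≠ 0) {F : Finset V} (ψ : V →ₗ[ZMod (p ^ δ)] ZMod (p ^ δ))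
    (H : AddSubgroup V) (hFH : ∀ s ∈ F, ∀ h ∈ H, s + h ∈ F)
    (hFu : ∀ s ∈ F, ∀ u : (ZMod (p ^ δ))ˣ, (u : ZMod (p ^ δ)) • s ∈ F) :
    ∃ r : ℤ, ∑ s ∈ F, ZMod.stdAddChar (ψ s) = (Nat.card H : ℂ) * r := by
  classical
  by_cases hψ : ∃ h ∈ H, ψ h ≠ 0
  · obtain ⟨h, hh, h0⟩ := hψ
    exact ⟨0, by rw [charSum_eq_zero ψ (fun s hs => hFH s hs h hh) h0]; simp⟩
  push Not at hψ
  have hH : (Nat.card H : ℂ) ≠ 0 := by exact_mod_cast Nat.card_pos.ne'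
  have hint : IsIntegral ℤ ((Nat.card H : ℂ)⁻¹ * ∑ s ∈ F, (ZMod.stdAddChar (ψ s) : ℂ)) := by
    have hmem : ∀ s, ∀ h ∈ H, s + h ∈ F ↔ s ∈ F := fun s h hh =>
      ⟨fun hs => by simpa using hFH _ hs _ (neg_mem hh), fun hs => hFH s hs h hh⟩
    obtain ⟨q, hq⟩ := sum_eq_card_mul_sum_quotient H
      (fun s => if s ∈ F then (ZMod.stdAddChar (ψ s) : ℂ) else 0) fun s h hh => by
        simp only [hmem s h hh, map_add, hψ h hh, add_zero]
    rw [← Finset.sum_filter, Finset.filter_mem_eq_inter, Finset.univ_inter] at hq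
    rw [hq, inv_mul_cancel_left₀ hH]
    refine IsIntegral.sum _ fun s _ => ?_
    split_ifs
    · exact isIntegral_stdAddChar _
    · exact isIntegral_zero
  -- Unit stability of `F` allows averaging over all `u`; after exchanging the sums, the inner ones
  -- are integers by `exists_int_sum_units`.
  have hrat : ∃ r : ℤ, (Fintype.card (ZMod (p ^ δ))ˣ : ℂ) * ∑ s ∈ F, (ZMod.stdAddChar (ψ s) : ℂ) = r := by
    have hu : ∀ u : (ZMod (p ^ δ))ˣ, ∑ s ∈ F, (ZMod.stdAddChar (ψ s) : ℂ) =
        ∑ s ∈ F, ZMod.stdAddChar ((u : ZMod (p ^ δ)) * ψ s) := fun u => by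
      have hinj : Function.Injective fun s : V => (u : ZMod (p ^ δ)) • s := fun a b hab => by
        have := congrArg (fun s => ((u⁻¹ : (ZMod (p ^ δ))ˣ) : ZMod (p ^ δ)) • s) hab
        simpa [smul_smul] using this
      have hi : F.image (fun s => (u : ZMod (p ^ δ)) • s) = F := Finset.eq_of_subset_of_card_le
        (fun x hx => by
          obtain ⟨s, hs, rfl⟩ := Finset.mem_image.mp hx
          exact hFu s hs u)
        (Finset.card_image_of_injective _ hinj).ge
      conv_lhs => rw [← hi, Finset.sum_image (fun _ _ _ _ hxy => hinj hxy)]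
      exact Finset.sum_congr rfl fun s _ => by rw [map_smul, smul_eq_mul]
    choose r hr using fun y => exists_int_sum_units (p := p) hδ y
    refine ⟨∑ s ∈ F, r (ψ s), ?_⟩
    rw [Int.cast_sum, ← Finset.sum_congr rfl fun s _ => hr (ψ s), Finset.sum_comm,
      ← Finset.sum_congr rfl fun u _ => hu u, Finset.sum_const, Finset.card_univ, nsmul_eq_mul]
  obtain ⟨r, hr⟩ := hrat
  have hc : (Fintype.card (ZMod (p ^ δ))ˣ : ℂ) ≠ 0 := by exact_mod_cast Fintype.card_ne_zero
  have hx : (Nat.card H : ℂ)⁻¹ * ∑ s ∈ F, (ZMod.stdAddChar (ψ s) : ℂ) =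
      algebraMap ℚ ℂ ((r : ℚ) / (Nat.card H * Fintype.card (ZMod (p ^ δ))ˣ : ℚ)) := by
    rw [map_div₀, map_mul, map_intCast, map_natCast, map_natCast, ← hr]
    field_simp
  rw [hx, isIntegral_algebraMap_iff (algebraMap ℚ ℂ).injective,
    IsIntegrallyClosed.isIntegral_iff (R := ℤ)] at hint
  obtain ⟨z, hz⟩ := hint
  refine ⟨z, ?_⟩
  rw [← hz] at hx
  rw [← inv_mul_eq_iff_eq_mul₀ hH, hx]
  simp

end CharacterSums

/-! ### Sums over pairs and the exponents -/

section Pairs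

variable {n : ℕ}

/-- The pairs `(i, j)` with `i ≤ j`. -/
def orderedPairs (n : ℕ) : Finset (Fin n × Fin n) := Finset.univ.filter fun q => q.1 ≤ q.2

theorem two_mul_sum_orderedPairs (f : Fin n → Fin n → ℤ) (hf : ∀ i j, f i j = f j i) :
    2 * ∑ q ∈ orderedPairs n, f q.1 q.2 = ∑ i, ∑ j, f i j + ∑ i, f i i := by
  have h1 : ∑ q ∈ orderedPairs n, f q.1 q.2 = ∑ i, ∑ j, if i ≤ j then f i j else 0 := by
    rw [orderedPairs, Finset.sum_filter, Fintype.sum_prod_type]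
  have h2 : ∑ q ∈ orderedPairs n, f q.1 q.2 = ∑ i, ∑ j, if j ≤ i then f i j else 0 := by
    rw [h1, Finset.sum_comm]
    exact Finset.sum_congr rfl fun i _ => Finset.sum_congr rfl fun j _ => by rw [hf]
  have h3 : ∑ i, f i i = ∑ i, ∑ j, if i = j then f i j else 0 := by simp
  rw [two_mul]
  nth_rewrite 1 [h1]
  rw [h2, h3, ← Finset.sum_add_distrib, ← Finset.sum_add_distrib]
  refine Finset.sum_congr rfl fun i _ => ?_
  rw [← Finset.sum_add_distrib, ← Finset.sum_add_distrib]
  refine Finset.sum_congr rfl fun j _ => ?_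
  rcases lt_trichotomy i j with h | h | h
  · simp [h.le, h.ne, h.not_ge]
  · simp [h]
  · simp [h.le, h.ne', h.not_ge]

theorem two_mul_card_orderedPairs (n : ℕ) : 2 * ((orderedPairs n).card : ℤ) = n * (n + 1) := by
  have := two_mul_sum_orderedPairs (n := n) (fun _ _ => 1) fun _ _ => rfl
  simp only [Finset.sum_const, Finset.card_univ, Fintype.card_fin, nsmul_eq_mul, mul_one] at this
  rw [this]; ring

theorem two_mul_sum_mul (α β : Fin n → ℤ) :
    2 * ∑ q ∈ orderedPairs n, (α q.1 * β q.2 + β q.1 * α q.2) =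
      2 * ((∑ i, α i) * ∑ i, β i) + 2 * ∑ i, α i * β i := by
  rw [two_mul_sum_orderedPairs (fun i j => α i * β j + β i * α j) fun i j => by ring]
  have h1 : ∑ i, ∑ j, (α i * β j + β i * α j) = 2 * ((∑ i, α i) * ∑ i, β i) := by
    simp only [Finset.sum_add_distrib, ← Finset.sum_mul_sum]
    ring
  rw [h1, Finset.mul_sum (a := 2)]
  exact congrArg _ (Finset.sum_congr rfl fun i _ => by ring)

/-- With `r = ∑ ι`, the claim is `n(n+1)/2 ≤ e₁ + (n-r)(n-r+1)/2 + k r`. For `k < n` the difference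
of the two sides is `x(x+1)/2` with `x = n - k - r`; otherwise it is `r(r-1)/2 + r(k-n)`. This is
where the value of `exponent₁` comes from. -/
theorem card_orderedPairs_le_level (k : ℤ) (ι : Fin n → ℤ)
    (hι : ∀ i, ι i = 0 ∨ ι i = 1) :
    ((orderedPairs n).card : ℤ) ≤ exponent₁ n k +
      ∑ q ∈ orderedPairs n, (1 - ι q.1) * (1 - ι q.2) + k * ∑ i, ι i := by
  have h1 := two_mul_card_orderedPairs n
  have h2 := two_mul_sum_orderedPairs (fun i j => (1 - ι i) * (1 - ι j)) fun i j => mul_comm _ _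
  have h3 : ∑ i, (1 - ι i) * (1 - ι i) = n - ∑ i, ι i := by
    rw [Finset.sum_congr rfl fun i _ => show (1 - ι i) * (1 - ι i) = 1 - ι i by
      rcases hι i with h | h <;> simp [h], Finset.sum_sub_distrib]
    simp
  have h4 : ∑ i, ∑ j, (1 - ι i) * (1 - ι j) = (n - ∑ i, ι i) * (n - ∑ i, ι i) := by
    rw [← Finset.sum_mul_sum, Finset.sum_sub_distrib]; simp
  rw [h3, h4] at h2
  have hr : 0 ≤ ∑ i, ι i := Finset.sum_nonneg fun i _ => by rcases hι i with h | h <;> simp [h]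
  generalize ∑ i, ι i = r at *
  generalize ∑ q ∈ orderedPairs n, (1 - ι q.1) * (1 - ι q.2) = s at *
  have hsq : ∀ x : ℤ, 0 ≤ x * x + x := fun x => by
    rcases le_or_gt 0 x with h | h <;> nlinarith
  rw [exponent₁]
  split_ifs with hkn
  · have h5 : 2 * (((n : ℤ) - k) * (n - k + 1) / 2) = (n - k) * (n - k + 1) :=
      Int.mul_ediv_cancel' (Int.even_mul_succ_self _).two_dvd
    have := hsq (n - k - r)
    nlinarith
  · have h6 := hsq (-r)
    have h7 : 0 ≤ r * (k - n) := mul_nonneg hr (by linarith)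
    nlinarith

/-- Sum of the previous inequality over the levels `t < δ`, with `ι i = 1` when `t < ε i`. A pair
contributes to the middle term at the `δ - max` levels that exceed neither exponent's range. -/
theorem exponent₁_inequality (k : ℤ) {δ : ℕ} (ε : Fin n → ℕ) (hε : ∀ i, ε i ≤ δ) :
    (δ : ℤ) * (orderedPairs n).card ≤ δ * exponent₁ n k +
      ((∑ q ∈ orderedPairs n, (δ - max (ε q.1) (ε q.2)) : ℕ) : ℤ) + k * ∑ i, (ε i : ℤ) := by
  have key := Finset.sum_le_sum fun t (_ : t ∈ Finset.range δ) =>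
    card_orderedPairs_le_level (n := n) k (fun i => if t < ε i then 1 else 0) fun i => by
      split_ifs <;> simp
  rw [Finset.sum_add_distrib, Finset.sum_add_distrib, Finset.sum_const, Finset.sum_const,
    Finset.card_range, nsmul_eq_mul, nsmul_eq_mul, Finset.sum_comm (s := Finset.range δ),
    ← Finset.mul_sum, Finset.sum_comm (s := Finset.range δ)] at key
  have hcount : ∀ e, e ≤ δ → ∑ t ∈ Finset.range δ, (if t < e then (1 : ℤ) else 0) = e := fun e he => by
    rw [← Finset.sum_filter, Finset.sum_const, nsmul_eq_mul, mul_one]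
    rw [show (Finset.range δ).filter (· < e) = Finset.range e by ext; simp; omega,
      Finset.card_range]
  have e1 : ∑ i, ∑ t ∈ Finset.range δ, (if t < ε i then (1 : ℤ) else 0) = ∑ i, (ε i : ℤ) :=
    Finset.sum_congr rfl fun i _ => hcount _ (hε i)
  have e2 : ∑ q ∈ orderedPairs n, ∑ t ∈ Finset.range δ,
      (1 - if t < ε q.1 then (1 : ℤ) else 0) * (1 - if t < ε q.2 then (1 : ℤ) else 0) =
      ((∑ q ∈ orderedPairs n, (δ - max (ε q.1) (ε q.2)) : ℕ) : ℤ) := by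
    rw [Nat.cast_sum]
    refine Finset.sum_congr rfl fun q _ => ?_
    have hm : max (ε q.1) (ε q.2) ≤ δ := max_le (hε _) (hε _)
    rw [Nat.cast_sub hm, ← hcount _ hm]
    rw [eq_sub_iff_add_eq, ← Finset.sum_add_distrib]
    rw [Finset.sum_congr rfl (g := fun _ => (1 : ℤ))]
    · simp
    · intro t _
      by_cases h1 : t < ε q.1 <;> by_cases h2 : t < ε q.2 <;> simp [h1, h2]
  rw [e1, e2] at key
  exact key

/-- Let `a`, `b`, `c` count the indices with `ε = 0, 1, 2`. The truncated sum over pairs is `a(a+1)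
+ a b`, and for `k ≤ n` the claim becomes `k(a-c) ≤ a(a+b+1)`. It is trivial for `a ≤ c`, and
otherwise follows from `k ≤ n = a + b + c`. -/
theorem exponent₂_inequality (k : ℤ) (hk : 0 ≤ k) (ε : Fin n → ℕ) (hε : ∀ i, ε i ≤ 2) :
    (2 : ℤ) * (orderedPairs n).card ≤ exponent₂ n k +
      ((∑ q ∈ orderedPairs n, (2 - (ε q.1 + ε q.2)) : ℕ) : ℤ) + k * ∑ i, (ε i : ℤ) := by
  let α : Fin n → ℤ := fun i => if ε i = 0 then 1 else 0
  let β : Fin n → ℤ := fun i => if ε i = 1 then 1 else 0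
  let γ : Fin n → ℤ := fun i => if ε i = 2 then 1 else 0
  have hcases : ∀ i, ε i = 0 ∨ ε i = 1 ∨ ε i = 2 := fun i => by have := hε i; omega
  have h1 := two_mul_card_orderedPairs n
  have hn : (n : ℤ) = ∑ i, α i + ∑ i, β i + ∑ i, γ i := by
    rw [← Finset.sum_add_distrib, ← Finset.sum_add_distrib,
      Finset.sum_congr rfl (g := fun _ => (1 : ℤ)) fun i _ => ?_]
    · simp
    · rcases hcases i with h | h | h <;> simp [α, β, γ, h]
  have hs : ∑ i, (ε i : ℤ) = ∑ i, β i + 2 * ∑ i, γ i := by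
    rw [Finset.mul_sum, ← Finset.sum_add_distrib]
    refine Finset.sum_congr rfl fun i _ => ?_
    rcases hcases i with h | h | h <;> simp [β, γ, h]
  have hq : ((∑ q ∈ orderedPairs n, (2 - (ε q.1 + ε q.2)) : ℕ) : ℤ) =
      ∑ q ∈ orderedPairs n, (α q.1 * α q.2 + α q.1 * α q.2) +
      ∑ q ∈ orderedPairs n, (α q.1 * β q.2 + β q.1 * α q.2) := by
    rw [Nat.cast_sum, ← Finset.sum_add_distrib]
    refine Finset.sum_congr rfl fun q _ => ?_
    rcases hcases q.1 with h | h | h <;> rcases hcases q.2 with h' | h' | h' <;> simp [α, β, h, h']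
  have q1 := two_mul_sum_mul α α
  have q2 := two_mul_sum_mul α β
  have d1 : ∑ i, α i * α i = ∑ i, α i := Finset.sum_congr rfl fun i _ => by
    rcases hcases i with h | h | h <;> simp [α, h]
  have d2 : ∑ i, α i * β i = 0 := Finset.sum_eq_zero fun i _ => by
    rcases hcases i with h | h | h <;> simp [α, β, h]
  have pa : 0 ≤ ∑ i, α i := Finset.sum_nonneg fun i _ => by
    rcases hcases i with h | h | h <;> simp [α, h]
  have pb : 0 ≤ ∑ i, β i := Finset.sum_nonneg fun i _ => by
    rcases hcases i with h | h | h <;> simp [β, h]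
  have pc : 0 ≤ ∑ i, γ i := Finset.sum_nonneg fun i _ => by
    rcases hcases i with h | h | h <;> simp [γ, h]
  rw [hq, hs]
  rw [d1] at q1
  rw [d2] at q2
  generalize ∑ i, α i = a at *
  generalize ∑ i, β i = b at *
  generalize ∑ i, γ i = c at *
  have q1' : ∑ q ∈ orderedPairs n, (α q.1 * α q.2 + α q.1 * α q.2) = a * a + a := by linarith
  have q2' : ∑ q ∈ orderedPairs n, (α q.1 * β q.2 + β q.1 * α q.2) = a * b := by linarith
  rw [q1', q2', h1, exponent₂]
  have pab := mul_nonneg pa pb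
  have pbc := mul_nonneg pb pc
  have pcc := mul_nonneg pc pc
  rcases le_or_gt a c with hac | hac
  · have hkac := mul_nonneg hk (sub_nonneg.mpr hac)
    split_ifs with hkn
    · rw [hn]; nlinarith
    · have : (n + 1 : ℤ) ≤ k := by linarith
      have := mul_le_mul_of_nonneg_right this (by linarith : 0 ≤ b + 2 * c)
      have h6 := mul_nonneg (by linarith : (0 : ℤ) ≤ n + 1) (sub_nonneg.mpr hac)
      rw [hn] at this h6 ⊢
      nlinarith
  · split_ifs with hkn
    · have := mul_le_mul_of_nonneg_right hkn (sub_nonneg.mpr hac.le)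
      rw [hn] at this ⊢
      nlinarith
    · have : (n + 1 : ℤ) ≤ k := by linarith
      have := mul_le_mul_of_nonneg_right this (by linarith : 0 ≤ b + 2 * c)
      rw [hn] at this ⊢
      nlinarith

end Pairs

/-! ### Divisibility of the exponential sums -/

section Divisibility

variable {n N p δ : ℕ}

/-- An elementary divisor `a i` of `A` divides `p^δ` because `A Dᵀ = p^δ`; so it is, up to sign, a
power of `p` with exponent at most `δ`. -/
theorem exists_smith_prime_power (hp : p.Prime) {A D : Matrix (Fin n) (Fin n) ℤ}
    (hAD : Aᵀ * D = ((p ^ δ : ℕ) : ℤ) • 1) :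
    ∃ (P Q : GL (Fin n) ℤ) (a : Fin n → ℤ) (ε : Fin n → ℕ),
      A = (P : Matrix (Fin n) (Fin n) ℤ) * diagonal a * (Q : Matrix (Fin n) (Fin n) ℤ) ∧
      (∀ i, (a i).natAbs = p ^ ε i) ∧ (∀ i, ε i ≤ δ) ∧ A.det.natAbs = p ^ ∑ i, ε i := by
  have hm : ((p ^ δ : ℕ) : ℤ) ≠ 0 := by exact_mod_cast pow_ne_zero _ hp.ne_zero
  have hDA : A * Dᵀ = ((p ^ δ : ℕ) : ℤ) • 1 := by
    apply mul_eq_smul_one_comm hm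
    have := congrArg transpose hAD
    rwa [transpose_mul, transpose_transpose, transpose_smul, transpose_one] at this
  have hdet : A.det ≠ 0 := fun h => by
    have := congrArg det hDA
    rw [det_mul, h, zero_mul, det_smul, det_one, mul_one] at this
    exact pow_ne_zero _ hm this.symm
  obtain ⟨P, Q, a, hA⟩ := smith_normal_form A hdet
  have ha : ∀ i, a i ∣ ((p ^ δ : ℕ) : ℤ) := fun i => by
    have h1 : diagonal a * ((Q : Matrix (Fin n) (Fin n) ℤ) * Dᵀ * (P : Matrix (Fin n) (Fin n) ℤ)) =
        ((p ^ δ : ℕ) : ℤ) • 1 := by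
      calc _ = ((P⁻¹ : GL (Fin n) ℤ) : Matrix (Fin n) (Fin n) ℤ) * (A * Dᵀ) *
            (P : Matrix (Fin n) (Fin n) ℤ) := by
            rw [hA]; simp only [← Matrix.mul_assoc, Units.inv_mul, Matrix.one_mul]
        _ = _ := by
          rw [hDA, Matrix.mul_smul, Matrix.mul_one, Matrix.smul_mul, Units.inv_mul]
    have h2 := congrFun (congrFun h1 i) i
    rw [diagonal_mul, Matrix.smul_apply, one_apply_eq, smul_eq_mul, mul_one] at h2
    exact ⟨_, h2.symm⟩
  have hε : ∀ i, ∃ e ≤ δ, (a i).natAbs = p ^ e := fun i =>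
    (Nat.dvd_prime_pow hp).mp (Int.natAbs_dvd_natAbs.mpr (ha i))
  choose ε h1 h2 using hε
  refine ⟨P, Q, a, ε, hA, h2, h1, ?_⟩
  have hunit : ∀ U : GL (Fin n) ℤ, (U : Matrix (Fin n) (Fin n) ℤ).det.natAbs = 1 := fun U =>
    Int.natAbs_of_isUnit ((Matrix.isUnit_iff_isUnit_det _).mp U.isUnit)
  rw [hA, det_mul, det_mul, det_diagonal, Int.natAbs_mul, Int.natAbs_mul, hunit, hunit, one_mul,
    mul_one, ← Finset.prod_pow_eq_pow_sum, ← Finset.prod_congr rfl fun i _ => h2 i]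
  exact map_prod Int.natAbsHom _ _

/-- The symmetric matrices `P S Pᵀ` modulo `p^δ`, with `p ^ w i j ∣ S i j`. -/
theorem exists_lattice_subgroup (hp : p.Prime) (P : GL (Fin n) ℤ) (w : Fin n → Fin n → ℕ)
    (hw : ∀ i j, w i j = w j i) : ∃ H : AddSubgroup (Matrix (Fin n) (Fin n) (ZMod (p ^ δ))),
      Nat.card H = p ^ ∑ q ∈ orderedPairs n, (δ - w q.1 q.2) ∧
      ∀ h ∈ H, ∃ S : Matrix (Fin n) (Fin n) ℤ, Sᵀ = S ∧ (∀ i j, ((p ^ w i j : ℕ) : ℤ) ∣ S i j) ∧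
        h = ((P : Matrix (Fin n) (Fin n) ℤ) * S * (P : Matrix (Fin n) (Fin n) ℤ)ᵀ).map Int.cast := by
  have hmm : ∀ X Y : Matrix (Fin n) (Fin n) ℤ, (X * Y).map (Int.cast : ℤ → ZMod (p ^ δ)) =
    X.map Int.cast * Y.map Int.cast :=
    fun X Y => Matrix.map_mul (f := Int.castRingHom (ZMod (p ^ δ)))
  have hm0 : p ^ δ ≠ 0 := pow_ne_zero _ hp.ne_zero
  set P' : Matrix (Fin n) (Fin n) (ZMod (p ^ δ)) :=
    (P : Matrix (Fin n) (Fin n) ℤ).map Int.cast with hP'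
  set Pi' : Matrix (Fin n) (Fin n) (ZMod (p ^ δ)) :=
    ((P⁻¹ : GL (Fin n) ℤ) : Matrix (Fin n) (Fin n) ℤ).map Int.cast with hPi'
  have hPi : Pi' * P' = 1 := by
    rw [hP', hPi', ← hmm, Units.inv_mul, Matrix.map_one _ Int.cast_zero Int.cast_one]
  have hPi2 : P'ᵀ * Pi'ᵀ = 1 := by rw [← transpose_mul, hPi, transpose_one]
  let I := {q : Fin n × Fin n // q ∈ orderedPairs n}
  let G : I → Type := fun q => AddSubgroup.zmultiples ((p ^ w q.1.1 q.1.2 : ℕ) : ZMod (p ^ δ))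
  have hle : ∀ {i j : Fin n}, i ≤ j → (i, j) ∈ orderedPairs n := fun h => by
    simpa [orderedPairs] using h
  let sym : ∀ {R : Type}, (I → R) → Matrix (Fin n) (Fin n) R := fun x => of fun i j =>
    if h : i ≤ j then x ⟨(i, j), hle h⟩ else x ⟨(j, i), hle (le_of_not_ge h)⟩
  have hsym : ∀ {R : Type} (x : I → R), (sym x)ᵀ = sym x := fun x => by
    ext i j
    simp only [sym, transpose_apply, of_apply]
    rcases lt_trichotomy i j with h | h | h
    · simp [h.le, h.not_ge]
    · subst h; rfl
    · simp [h.le, h.not_ge]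
  let f : (∀ q, G q) →+ Matrix (Fin n) (Fin n) (ZMod (p ^ δ)) :=
    { toFun := fun x => P' * sym (fun q => (x q : ZMod (p ^ δ))) * P'ᵀ
      map_zero' := by
        have : sym (fun q => (((0 : ∀ q, G q) q : ZMod (p ^ δ)))) = 0 := by
          ext i j
          simp only [sym, of_apply]
          split_ifs <;> rfl
        rw [this, Matrix.mul_zero, Matrix.zero_mul]
      map_add' := fun x y => by
        have : sym (fun q => (((x + y) q : G q) : ZMod (p ^ δ))) =
            sym (fun q => (x q : ZMod (p ^ δ))) + sym (fun q => (y q : ZMod (p ^ δ))) := by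
          ext i j
          simp only [sym, of_apply, Matrix.add_apply]
          split_ifs <;> rfl
        rw [this, Matrix.mul_add, Matrix.add_mul] }
  have hf : Function.Injective f := fun x y hxy => by
    have h1 := congrArg (fun M => Pi' * M * Pi'ᵀ) hxy
    have h2 : ∀ M : Matrix (Fin n) (Fin n) (ZMod (p ^ δ)), Pi' * (P' * M * P'ᵀ) * Pi'ᵀ = M :=
      fun M => by
        rw [Matrix.mul_assoc P', ← Matrix.mul_assoc Pi', hPi, Matrix.one_mul, Matrix.mul_assoc, hPi2,
          Matrix.mul_one]
    have h3 : sym (fun q => (x q : ZMod (p ^ δ))) = sym (fun q => (y q : ZMod (p ^ δ))) :=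
      (h2 _).symm.trans (h1.trans (h2 _))
    funext q
    obtain ⟨⟨i, j⟩, hq⟩ := q
    have hij : i ≤ j := by simpa [orderedPairs] using hq
    have := congrFun (congrFun h3 i) j
    simp only [sym, of_apply, dif_pos hij] at this
    exact Subtype.ext this
  refine ⟨f.range, ?_, ?_⟩
  · rw [← Nat.card_congr (AddMonoidHom.ofInjective hf).toEquiv, Nat.card_pi]
    rw [← Finset.prod_pow_eq_pow_sum,
      ← Finset.prod_coe_sort (orderedPairs n) fun q => p ^ (δ - w q.1 q.2)]
    refine Finset.prod_congr rfl fun q _ => ?_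
    rw [Nat.card_zmultiples, ZMod.addOrderOf_coe _ hm0]
    -- The multiples of `p^w` in `ℤ/p^δ` number `p^(δ - w)`; if `w ≥ δ` the group is trivial, in
    -- agreement with truncated subtraction.
    rcases le_total (w q.1.1 q.1.2) δ with h | h
    · rw [Nat.gcd_eq_right (pow_dvd_pow p h), Nat.pow_div h hp.pos]
    · rw [Nat.gcd_eq_left (pow_dvd_pow p h), Nat.div_self (Nat.pos_of_ne_zero hm0),
        Nat.sub_eq_zero_of_le h, pow_zero]
  · rintro _ ⟨x, rfl⟩
    choose z hz using fun q => AddSubgroup.mem_zmultiples_iff.mp (x q).2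
    let y : I → ℤ := fun q => z q * ((p ^ w q.1.1 q.1.2 : ℕ) : ℤ)
    refine ⟨sym y, hsym y, fun i j => ?_, ?_⟩
    · simp only [sym, of_apply, y]
      split_ifs
      · exact dvd_mul_left _ _
      · rw [hw i j]; exact dvd_mul_left _ _
    · have : (sym y).map
          (Int.cast : ℤ → ZMod (p ^ δ)) = sym (fun q => (x q : ZMod (p ^ δ))) := by
        ext i j
        simp only [sym, of_apply, map_apply, y]
        split_ifs <;>
          rw [Int.cast_mul, Int.cast_natCast, ← zsmul_eq_mul, hz]
      rw [hmm, hmm, this, transpose_map]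
      rfl

end Divisibility

/-! ### Integrality of the scaled exponential sums. -/

section IntegralSums

variable {n N : ℕ}

/-- The exponential sums over the upper triangular representatives of `X` with a given diagonal
block `A`, scaled by `c m^{-n(n+1)/2} det(A)^k`, are integers. -/
def IntegralSums {m : ℕ} [NeZero m] (N : ℕ) (X : Set (Similitude n m)) (c : ℂ) (k : ℕ) : Prop :=
  ∀ (A : Matrix (Fin n) (Fin n) ℤ) (D : Matrix (Fin n) (Fin n) ℤ), Aᵀ * D = (m : ℤ) • 1 →
    ∀ F : Finset (Matrix (Fin n) (Fin n) (ZMod m)),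
      (∀ s, s ∈ F ↔ ∃ S, Occurs N X A S ∧ S.map Int.cast = s) →
    ∀ ψ : Matrix (Fin n) (Fin n) (ZMod m) →ₗ[ZMod m] ZMod m, ∃ r : ℤ,
      c * (m : ℂ) ^ (-((n : ℤ) * (n + 1) / 2)) * (∑ s ∈ F, ZMod.stdAddChar (ψ s)) *
        (A.det : ℂ) ^ k = r

/-- Counting powers of `p`: the sum contributes `h`, the determinant `k E`, and the normalization `e
- δ n(n+1)/2`. The hypothesis `hle` says that the total is nonnegative. -/
theorem exists_int_scaled_charSum {p δ : ℕ} [Fact p.Prime] (hδ : δ ≠ 0) {e : ℤ} {k h E : ℕ}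
    {F : Finset (Matrix (Fin n) (Fin n) (ZMod (p ^ δ)))}
    (ψ : Matrix (Fin n) (Fin n) (ZMod (p ^ δ)) →ₗ[ZMod (p ^ δ)] ZMod (p ^ δ))
    {H : AddSubgroup (Matrix (Fin n) (Fin n) (ZMod (p ^ δ)))} (hH : Nat.card H = p ^ h)
    (hFH : ∀ s ∈ F, ∀ t ∈ H, s + t ∈ F)
    (hFu : ∀ s ∈ F, ∀ u : (ZMod (p ^ δ))ˣ, (u : ZMod (p ^ δ)) • s ∈ F)
    {d : ℤ} (hd : d.natAbs = p ^ E)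
    (hle : (δ : ℤ) * (orderedPairs n).card ≤ e + h + k * E) : ∃ r : ℤ,
      (p : ℂ) ^ e * ((p ^ δ : ℕ) : ℂ) ^ (-((n : ℤ) * (n + 1) / 2)) *
        (∑ s ∈ F, ZMod.stdAddChar (ψ s)) * (d : ℂ) ^ k = r := by
  obtain ⟨r, hr⟩ := charSum_eq_card_mul hδ ψ H hFH hFu
  have hp0 : (p : ℂ) ≠ 0 := by exact_mod_cast (Fact.out : p.Prime).ne_zero
  obtain ⟨σ, hσ⟩ : ∃ σ : ℤ, d = σ * (p : ℤ) ^ E := by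
    rcases Int.natAbs_eq d with h | h
    · exact ⟨1, by rw [h, hd]; push_cast; ring⟩
    · exact ⟨-1, by rw [h, hd]; push_cast; ring⟩
  have hc : (n : ℤ) * (n + 1) / 2 = (orderedPairs n).card := by
    have := two_mul_card_orderedPairs n
    omega
  obtain ⟨g, hg⟩ : ∃ g : ℕ, (g : ℤ) = e - δ * (orderedPairs n).card + h + k * E :=
    ⟨_, Int.toNat_of_nonneg (by linarith)⟩
  refine ⟨p ^ g * r * σ ^ k, ?_⟩
  have e1 : (p : ℂ) ^ g =
      (p : ℂ) ^ e * ((p ^ δ : ℕ) : ℂ) ^ (-((n : ℤ) * (n + 1) / 2)) * (p : ℂ) ^ h *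
        ((p : ℂ) ^ E) ^ k := by
    rw [hc, Nat.cast_pow, ← zpow_natCast (p : ℂ) g, hg, ← zpow_natCast (p : ℂ) δ, ← _root_.zpow_mul,
      ← zpow_natCast (p : ℂ) h, ← pow_mul, ← zpow_natCast (p : ℂ) (E * k), ← zpow_add₀ hp0,
      ← zpow_add₀ hp0, ← zpow_add₀ hp0]
    congr 1
    push_cast
    ring
  rw [hr, hH, hσ]
  push_cast
  rw [e1, mul_pow]
  push_cast
  ring

theorem smul_map_cast {m : ℕ} (c : ℤ) (S : Matrix (Fin n) (Fin n) ℤ) :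
    (c • S).map (Int.cast : ℤ → ZMod m) = (c : ZMod m) • S.map Int.cast :=
  Matrix.ext fun _ _ => Int.cast_mul _ _

theorem add_map_cast {m : ℕ} (S R : Matrix (Fin n) (Fin n) ℤ) :
    (S + R).map (Int.cast : ℤ → ZMod m) = S.map Int.cast + R.map Int.cast :=
  Matrix.ext fun _ _ => Int.cast_add _ _

/-- With `A = P diag(a) Q`, adding `P R Pᵀ` is allowed as soon as column `j` of `R` is divisible by
`a j`, because `diag(a) Pᵀ D` is then divisible by `p^δ`. Symmetry of `R` turns this into
divisibility by `p^max(ε i, ε j)`. -/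
theorem integralSums_congruenceSet [NeZero N] {p δ : ℕ} [Fact p.Prime] (hδ : δ ≠ 0)
    (k : ℕ) :
    IntegralSums N (congruenceSet n N (p ^ δ)) (((p : ℂ) ^ δ) ^ exponent₁ n k) k := by
  intro A D hAD F hF ψ
  have hN : 0 < N := Nat.pos_of_ne_zero (NeZero.ne N)
  have hp : p.Prime := Fact.out
  obtain ⟨P, Q, a, ε, hA, ha, hε, hdet⟩ := exists_smith_prime_power hp hAD
  obtain ⟨H, hH, hHS⟩ := exists_lattice_subgroup (δ := δ) hp P (fun i j => max (ε i) (ε j))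
    fun i j => max_comm _ _
  rw [← zpow_natCast (p : ℂ) δ, ← _root_.zpow_mul]
  refine exists_int_scaled_charSum hδ ψ hH ?_ ?_ hdet ?_
  · intro s hs t ht
    obtain ⟨S, hS, rfl⟩ := (hF s).mp hs
    obtain ⟨R, hR, hdvd, rfl⟩ := hHS t ht
    refine (hF _).mpr ⟨S + (P : Matrix (Fin n) (Fin n) ℤ) * R * (P : Matrix (Fin n) (Fin n) ℤ)ᵀ, ?_,
      add_map_cast _ _⟩
    have h1 : ∀ i j, ∃ r, R i j = r * a j := fun i j => by
      have h2 : a j ∣ ((p ^ max (ε i) (ε j) : ℕ) : ℤ) := by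
        rw [← Int.natAbs_dvd, ha]
        exact_mod_cast pow_dvd_pow p (le_max_right _ _)
      obtain ⟨r, hr⟩ := h2.trans (hdvd i j)
      exact ⟨r, by rw [hr, mul_comm]⟩
    choose M hM using h1
    have hRM : R = of M * diagonal a := by ext i j; rw [mul_diagonal, hM, of_apply]
    refine hS.congruenceSet_add hN hAD ?_ (B := (P : Matrix (Fin n) (Fin n) ℤ) * of M *
      (((Q⁻¹ : GL (Fin n) ℤ) : Matrix (Fin n) (Fin n) ℤ)ᵀ)) ?_
    · rw [transpose_mul, transpose_mul, transpose_transpose, hR, Matrix.mul_assoc]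
    · have e : diagonal a * (P : Matrix (Fin n) (Fin n) ℤ)ᵀ =
          ((Q⁻¹ : GL (Fin n) ℤ) : Matrix (Fin n) (Fin n) ℤ)ᵀ * Aᵀ := by
        rw [hA, transpose_mul, transpose_mul, diagonal_transpose, ← Matrix.mul_assoc _ _ (_ * _),
          ← transpose_mul, Units.mul_inv, transpose_one, Matrix.one_mul]
      calc (P : Matrix (Fin n) (Fin n) ℤ) * R * (P : Matrix (Fin n) (Fin n) ℤ)ᵀ * D
          = (P : Matrix (Fin n) (Fin n) ℤ) * of M *
            (diagonal a * (P : Matrix (Fin n) (Fin n) ℤ)ᵀ) * D := by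
            rw [hRM]; simp only [Matrix.mul_assoc]
        _ = (P : Matrix (Fin n) (Fin n) ℤ) * of M *
            ((Q⁻¹ : GL (Fin n) ℤ) : Matrix (Fin n) (Fin n) ℤ)ᵀ * (Aᵀ * D) := by
            rw [e]; simp only [Matrix.mul_assoc]
        _ = _ := by rw [hAD, Matrix.mul_smul, Matrix.mul_one]
  · intro s hs u
    obtain ⟨S, hS, rfl⟩ := (hF s).mp hs
    obtain ⟨c, hc⟩ := ZMod.intCast_surjective (u : ZMod (p ^ δ))
    exact (hF _).mpr ⟨c • S, hS.congruenceSet_smul hN c, by rw [smul_map_cast, hc]⟩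
  · have := exponent₁_inequality (k : ℤ) ε hε
    push_cast at this ⊢
    exact this

/-- Here only matrices `A M Aᵀ` with `M` symmetric are available as translations; in Smith
coordinates they are the `P R Pᵀ` with `R i j` divisible by `a i * a j`, whence the exponents `ε i +
ε j`. -/
theorem integralSums_doubleCoset [NeZero N] {p δ : ℕ} [Fact p.Prime] (hpN : ¬ p ∣ N) (hδ : δ ≠ 0)
    {g₁ g₂ : Fin n → ℤ} (hg : ∀ i, g₁ i * g₂ i = ((p ^ δ : ℕ) : ℤ)) {k : ℕ} {e : ℤ}
    (he : ∀ ε : Fin n → ℕ, (∀ i, ε i ≤ δ) → (δ : ℤ) * (orderedPairs n).card ≤ e +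
      ((∑ q ∈ orderedPairs n, (δ - (ε q.1 + ε q.2)) : ℕ) : ℤ) + k * ∑ i, (ε i : ℤ)) :
    IntegralSums N (doubleCoset N (p ^ δ) (diagonal (Sum.elim g₁ g₂))) ((p : ℂ) ^ e) k := by
  intro A D hAD F hF ψ
  have hp : p.Prime := Fact.out
  have hpos : 0 < p ^ δ := pow_pos hp.pos _
  have hX := doubleCoset_isHeckeSet (N := N) hpos hg
  obtain ⟨P, Q, a, ε, hA, ha, hε, hdet⟩ := exists_smith_prime_power hp hAD
  obtain ⟨H, hH, hHS⟩ := exists_lattice_subgroup (δ := δ) hp P (fun i j => ε i + ε j)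
    fun i j => add_comm _ _
  have ha0 : ∀ i, a i ≠ 0 := fun i h => by
    have := ha i
    rw [h, Int.natAbs_zero] at this
    exact pow_ne_zero _ hp.ne_zero this.symm
  refine exists_int_scaled_charSum hδ ψ hH ?_ ?_ hdet ?_
  · intro s hs t ht
    obtain ⟨S, hS, rfl⟩ := (hF s).mp hs
    obtain ⟨R, hR, hdvd, rfl⟩ := hHS t ht
    refine (hF _).mpr ⟨S + (P : Matrix (Fin n) (Fin n) ℤ) * R * (P : Matrix (Fin n) (Fin n) ℤ)ᵀ, ?_,
      add_map_cast _ _⟩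
    have h1 : ∀ i j, ∃ r, R i j = a i * r * a j := fun i j => by
      have h2 : a i * a j ∣ ((p ^ (ε i + ε j) : ℕ) : ℤ) := by
        rw [← Int.natAbs_dvd, Int.natAbs_mul, ha, ha, pow_add]
      obtain ⟨r, hr⟩ := h2.trans (hdvd i j)
      exact ⟨r, by rw [hr]; ring⟩
    choose M hM using h1
    have hRM : R = diagonal a * of M * diagonal a := by
      ext i j; rw [mul_diagonal, diagonal_mul, hM, of_apply]
    have hMt : (of M)ᵀ = of M := by
      ext i j
      have := congrFun (congrFun hR i) j
      rw [transpose_apply, hM, hM] at this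
      have h3 : a i * a j * M j i = a i * a j * M i j := by linear_combination this
      exact mul_left_cancel₀ (mul_ne_zero (ha0 i) (ha0 j)) h3
    set Qi := ((Q⁻¹ : GL (Fin n) ℤ) : Matrix (Fin n) (Fin n) ℤ) with hQi
    have e1 : diagonal a * (P : Matrix (Fin n) (Fin n) ℤ)ᵀ = Qiᵀ * Aᵀ := by
      rw [hA, transpose_mul, transpose_mul, diagonal_transpose, ← Matrix.mul_assoc _ _ (_ * _),
        ← transpose_mul, Units.mul_inv, transpose_one, Matrix.one_mul]
    have e2 : (P : Matrix (Fin n) (Fin n) ℤ) * diagonal a = A * Qi := by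
      have := congrArg transpose e1
      rwa [transpose_mul, transpose_mul, transpose_transpose, transpose_transpose,
        transpose_transpose, diagonal_transpose] at this
    have e3 : (P : Matrix (Fin n) (Fin n) ℤ) * R * (P : Matrix (Fin n) (Fin n) ℤ)ᵀ =
        A * (Qi * of M * Qiᵀ) * Aᵀ := by
      calc _ = ((P : Matrix (Fin n) (Fin n) ℤ) * diagonal a) * of M *
            (diagonal a * (P : Matrix (Fin n) (Fin n) ℤ)ᵀ) := by
            rw [hRM]; simp only [Matrix.mul_assoc]
        _ = _ := by rw [e1, e2]; simp only [Matrix.mul_assoc]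
    rw [e3]
    exact hS.add_conj hX (by
      rw [transpose_mul, transpose_mul, transpose_transpose, hMt, Matrix.mul_assoc])
  · intro s hs u
    obtain ⟨S, hS, rfl⟩ := (hF s).mp hs
    obtain ⟨c, hc1, hc2, hc3⟩ := exists_int_lift_unit (N := N) hpos
      (Nat.Coprime.pow_left _ ((Nat.Prime.coprime_iff_not_dvd hp).mpr hpN)) u
    exact (hF _).mpr ⟨c • S, hS.doubleCoset_smul hg hc1 hc3, by rw [smul_map_cast, hc2]⟩
  · have := he ε hε
    push_cast at this ⊢
    exact this

end IntegralSums

/-! ### Half-integral matrices as linear forms on integral symmetric matrices -/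

section TraceForms

variable {n N m : ℕ}

theorem HalfIntegral.transpose_eq (T : HalfIntegral n) : T.1ᵀ = T.1 := by
  have h : T.1.IsHermitian := T.2.1.1
  rwa [IsHermitian, conjTranspose_eq_transpose_of_trivial] at h

/-- Take `τ` upper triangular, with entries `T i i` on the diagonal and `2 T i j` above it. The
difference `T - τ` is antisymmetric and pairs to zero with symmetric matrices. -/
theorem exists_traceForm (T : HalfIntegral n) : ∃ τ : Matrix (Fin n) (Fin n) ℤ,
    ∀ S : Matrix (Fin n) (Fin n) ℤ, Sᵀ = S →
      (T.1 * S.map (Int.cast : ℤ → ℝ)).trace = ((∑ i, ∑ j, τ i j * S i j : ℤ) : ℝ) := by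
  choose d hd using T.2.2.1
  choose c hc using T.2.2.2
  let τ : Matrix (Fin n) (Fin n) ℤ := of fun i j => if i = j then d i else if i < j then c i j else 0
  refine ⟨τ, fun S hS => ?_⟩
  have hT : ∀ i j, T.1 j i = T.1 i j := fun i j => congrFun (congrFun T.transpose_eq i) j
  have hS' : ∀ i j, S j i = S i j := fun i j => congrFun (congrFun hS i) j
  have h1 : (T.1 * S.map (Int.cast : ℤ → ℝ)).trace = ∑ i, ∑ j, T.1 i j * S i j := by
    simp only [trace, diag_apply, Matrix.mul_apply, map_apply]
    exact Finset.sum_congr rfl fun i _ => Finset.sum_congr rfl fun j _ => by rw [hS']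
  let x : Fin n → Fin n → ℝ := fun i j => (T.1 i j - τ i j) * S i j
  have hx : ∀ i j, x j i = - x i j := fun i j => by
    simp only [x, τ, of_apply, hS' i j, hT i j]
    rcases lt_trichotomy i j with h | h | h
    · simp only [h.ne, h.ne', h, h.not_gt, if_true, if_false, ← hc]; push_cast; ring
    · subst h; simp [hd]
    · simp only [h.ne, h.ne', h, h.not_gt, if_true, if_false, ← hc, hT i j]; push_cast; ring
  have h2 : ∑ i, ∑ j, x i j = 0 := by
    have h3 : ∑ i, ∑ j, x i j = - ∑ i, ∑ j, x i j := by
      conv_lhs => rw [Finset.sum_comm]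
      rw [← Finset.sum_neg_distrib]
      refine Finset.sum_congr rfl fun i _ => ?_
      rw [← Finset.sum_neg_distrib]
      exact Finset.sum_congr rfl fun j _ => hx i j
    linarith
  rw [h1]
  push_cast
  rw [← sub_eq_zero, ← h2, ← Finset.sum_sub_distrib]
  refine Finset.sum_congr rfl fun i _ => ?_
  rw [← Finset.sum_sub_distrib]
  exact Finset.sum_congr rfl fun j _ => by simp only [x]; ring

/-- Integral coefficients of the linear form `S ↦ tr(TS)` on integral symmetric matrices. -/
def traceForm (T : HalfIntegral n) : Matrix (Fin n) (Fin n) ℤ := (exists_traceForm T).choose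

theorem trace_mul_eq (T : HalfIntegral n) {S : Matrix (Fin n) (Fin n) ℤ} (hS : Sᵀ = S) :
    (T.1 * S.map (Int.cast : ℤ → ℝ)).trace = ((∑ i, ∑ j, traceForm T i j * S i j : ℤ) : ℝ) :=
  (exists_traceForm T).choose_spec S hS

theorem trace_ofReal_mul_eq (T : HalfIntegral n) {S : Matrix (Fin n) (Fin n) ℤ} (hS : Sᵀ = S) :
    (T.1.map Complex.ofReal * S.map (Int.cast : ℤ → ℂ)).trace =
      ((∑ i, ∑ j, traceForm T i j * S i j : ℤ) : ℂ) := by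
  have h := congrArg Complex.ofReal (trace_mul_eq T hS)
  rw [Complex.ofReal_intCast] at h
  rw [← h]
  simp [trace, Matrix.mul_apply]

/-- The linear form `s ↦ ∑ τ i j s i j` modulo `m`. -/
def pairing (m : ℕ) (τ : Matrix (Fin n) (Fin n) ℤ) :
    Matrix (Fin n) (Fin n) (ZMod m) →ₗ[ZMod m] ZMod m where
  toFun s := ∑ i, ∑ j, (τ i j : ZMod m) * s i j
  map_add' s t := by simp [mul_add, Finset.sum_add_distrib]
  map_smul' c s := by simp [Finset.mul_sum, mul_left_comm]

theorem pairing_map (τ S : Matrix (Fin n) (Fin n) ℤ) :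
    pairing m τ (S.map Int.cast) = ((∑ i, ∑ j, τ i j * S i j : ℤ) : ZMod m) := by
  simp [pairing]

/-- If `T` is trivial modulo `m` on the matrices `A R Aᵀ`, then `m⁻¹ Aᵀ T A` is half-integral. -/
theorem exists_halfIntegral_conj (hm : 0 < m) (T : HalfIntegral n) (A : Matrix (Fin n) (Fin n) ℤ)
    (h : ∀ R : Matrix (Fin n) (Fin n) ℤ, Rᵀ = R →
      pairing m (traceForm T) ((A * R * Aᵀ).map Int.cast) = 0) :
    ∃ T' : HalfIntegral n, T'.1 = (m : ℝ)⁻¹ •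
      ((A.map (Int.cast : ℤ → ℝ))ᵀ * T.1 * A.map (Int.cast : ℤ → ℝ)) := by
  have hm0 : (m : ℝ) ≠ 0 := by exact_mod_cast hm.ne'
  set A' := A.map (Int.cast : ℤ → ℝ) with hA'
  set M := (m : ℝ)⁻¹ • (A'ᵀ * T.1 * A') with hM
  have hpos : M.PosSemidef := by
    have h1 := T.2.1.conjTranspose_mul_mul_same A'
    rw [conjTranspose_eq_transpose_of_trivial] at h1
    exact h1.smul (inv_nonneg.mpr (Nat.cast_nonneg m))
  have hsymm : ∀ i j, M j i = M i j := fun i j => by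
    have h1 : M.IsHermitian := hpos.1
    rw [IsHermitian, conjTranspose_eq_transpose_of_trivial] at h1
    exact congrFun (congrFun h1 i) j
  have hmm : ∀ X Y : Matrix (Fin n) (Fin n) ℤ, (X * Y).map (Int.cast : ℤ → ℝ) =
    X.map Int.cast * Y.map Int.cast := fun X Y => Matrix.map_mul (f := Int.castRingHom ℝ)
  have htr : ∀ R : Matrix (Fin n) (Fin n) ℤ, Rᵀ = R → ∃ c : ℤ,
      (M * R.map (Int.cast : ℤ → ℝ)).trace = c := fun R hR => by
    have h1 := h R hR
    rw [pairing_map, ZMod.intCast_zmod_eq_zero_iff_dvd] at h1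
    obtain ⟨c, hc⟩ := h1
    have hARA : (A * R * Aᵀ)ᵀ = A * R * Aᵀ := by
      rw [transpose_mul, transpose_mul, transpose_transpose, hR, Matrix.mul_assoc]
    have h2 := trace_mul_eq T hARA
    rw [hc, hmm, hmm, transpose_map] at h2
    refine ⟨c, ?_⟩
    have h3 : (A'ᵀ * T.1 * A' * R.map (Int.cast : ℤ → ℝ)).trace = m * c := by
      push_cast at h2
      rw [← h2, Matrix.mul_assoc, Matrix.mul_assoc, trace_mul_comm]
      simp only [Matrix.mul_assoc, hA']
    rw [hM, Matrix.smul_mul, trace_smul, h3, smul_eq_mul, inv_mul_cancel_left₀ hm0]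
  have hsingle : ∀ i j : Fin n, (single i j (1 : ℤ)).map (Int.cast : ℤ → ℝ) = single i j 1 :=
    fun i j => by
      ext a b
      simp only [map_apply, single_apply]
      split_ifs <;> simp
  have hts : ∀ i j : Fin n, (M * single i j (1 : ℝ)).trace = M j i := fun i j => by
    rw [trace_mul_single]; simp
  refine ⟨⟨M, hpos, fun i => ?_, fun i j => ?_⟩, rfl⟩
  -- Testing on `E_ii` gives the diagonal entries, and on `E_ij + E_ji` twice the general entries.
  · obtain ⟨c, hc⟩ := htr (single i i 1) (transpose_single _ _ _)
    exact ⟨c, by rw [← hc, hsingle, hts]⟩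
  · obtain ⟨c, hc⟩ := htr (single i j 1 + single j i 1) (by
      rw [transpose_add, transpose_single, transpose_single, add_comm])
    refine ⟨c, ?_⟩
    rw [← hc, Matrix.map_add _ (fun a b => Int.cast_add a b), hsingle, hsingle, Matrix.mul_add,
      trace_add, hts, hts, hsymm i j]
    ring

/-- The exponential of `T` at `m⁻¹ A Z Aᵀ`. -/
def conjTerm (N m : ℕ) (A : Matrix (Fin n) (Fin n) ℤ) (T : HalfIntegral n) (Z : UpperHalf n) : ℂ :=
  Complex.exp (2 * Real.pi * Complex.I * (1 / N) * ((m : ℂ)⁻¹ * (T.1.map Complex.ofReal *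
    (A.map (Int.cast : ℤ → ℂ) * Z.1 * (A.map (Int.cast : ℤ → ℂ))ᵀ)).trace))

theorem conjTerm_eq_fourierTerm {A : Matrix (Fin n) (Fin n) ℤ} {T T' : HalfIntegral n}
    (hT' : T'.1 = (m : ℝ)⁻¹ • ((A.map (Int.cast : ℤ → ℝ))ᵀ * T.1 * A.map (Int.cast : ℤ → ℝ)))
    (Z : UpperHalf n) : conjTerm N m A T Z = fourierTerm N T' Z := by
  rw [conjTerm, fourierTerm]
  have h1 : T'.1.map Complex.ofReal = (m : ℂ)⁻¹ • ((A.map (Int.cast : ℤ → ℂ))ᵀ *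
      T.1.map Complex.ofReal * A.map (Int.cast : ℤ → ℂ)) := by
    rw [hT']
    ext i j
    simp [Matrix.mul_apply]
  rw [h1, Matrix.smul_mul, trace_smul, smul_eq_mul]
  congr 3
  rw [← Matrix.mul_assoc, trace_mul_comm]
  simp only [Matrix.mul_assoc]

theorem moebius_of_isUpper (hN : 0 < N) {h : Similitude n m} {A S : Matrix (Fin n) (Fin n) ℤ}
    (hu : IsUpper N h A S) (Z : UpperHalf n) : (moebius h Z).1 =
      (m : ℂ)⁻¹ • (A.map (Int.cast : ℤ → ℂ) * Z.1 * (A.map (Int.cast : ℤ → ℂ))ᵀ +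
        (N : ℂ) • S.map (Int.cast : ℤ → ℂ)) := by
  obtain ⟨B, D, hh, hS, -, h2, -⟩ := hu.relations hN
  have hm0 : (m : ℂ) ≠ 0 := by exact_mod_cast h.2.1.ne'
  have hmm : ∀ X Y : Matrix (Fin n) (Fin n) ℤ, (X * Y).map (Int.cast : ℤ → ℂ) =
    X.map Int.cast * Y.map Int.cast := fun X Y => Matrix.map_mul (f := Int.castRingHom ℂ)
  have hsm : ∀ (c : ℤ) (X : Matrix (Fin n) (Fin n) ℤ), (c • X).map (Int.cast : ℤ → ℂ) =
    (c : ℂ) • X.map Int.cast := fun c X => Matrix.ext fun i j => Int.cast_mul _ _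
  have hD : (D.map (Int.cast : ℤ → ℂ))⁻¹ = (m : ℂ)⁻¹ • (A.map (Int.cast : ℤ → ℂ))ᵀ := by
    apply inv_eq_right_inv
    rw [Matrix.mul_smul, ← transpose_map, ← hmm, h2, hsm,
      Matrix.map_one _ Int.cast_zero Int.cast_one, smul_smul, Int.cast_natCast, inv_mul_cancel₀ hm0,
      one_smul]
  rw [moebius_coe, numer, denom, hh, toBlocks_fromBlocks₁₁, toBlocks_fromBlocks₁₂,
    toBlocks_fromBlocks₂₁, toBlocks_fromBlocks₂₂, Matrix.map_zero _ (Int.cast_zero (R := ℂ)),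
    Matrix.zero_mul, zero_add, hD, Matrix.mul_smul, add_mul, hsm, Matrix.smul_mul, ← hS, hmm,
    transpose_map, Int.cast_natCast]

/-- The factor `1 / N` in the exponent cancels the `N` in `N S`, leaving an `m`-th root of unity
that depends only on `S` modulo `m`. -/
theorem fourierTerm_moebius (hN : 0 < N) [NeZero m] {h : Similitude n m}
    {A S : Matrix (Fin n) (Fin n) ℤ} (hu : IsUpper N h A S) (T : HalfIntegral n) (Z : UpperHalf n) :
    fourierTerm N T (moebius h Z) =
      ZMod.stdAddChar (pairing m (traceForm T) (S.map Int.cast)) * conjTerm N m A T Z := by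
  have hS := (hu.relations hN).choose_spec.choose_spec.2.2.2.2.1
  have hN0 : (N : ℂ) ≠ 0 := by exact_mod_cast hN.ne'
  rw [pairing_map, ZMod.stdAddChar_coe, conjTerm, ← Complex.exp_add, fourierTerm,
    moebius_of_isUpper hN hu, Matrix.mul_smul, trace_smul, Matrix.mul_add, trace_add,
    Matrix.mul_smul, trace_smul, trace_ofReal_mul_eq T hS]
  congr 1
  simp only [smul_eq_mul]
  field_simp
  ring

end TraceForms

/-! ### Fourier coefficients of Hecke operators -/

section FourierCoefficients

variable {n N m : ℕ} {W : Type*} [NormedAddCommGroup W] [NormedSpace ℂ W]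
  [FiniteDimensional ℂ W] {ρ : Representation ℂ (GL (Fin n) ℂ) W} {k : Fin n → ℤ}

theorem det_ne_zero_of_mul_eq (hm : 0 < m) {A D : Matrix (Fin n) (Fin n) ℤ}
    (hAD : Aᵀ * D = (m : ℤ) • 1) : Aᵀ.det ≠ 0 := fun h => by
  have := congrArg det hAD
  rw [det_mul, h, zero_mul, det_smul, det_one, mul_one] at this
  exact pow_ne_zero _ (by exact_mod_cast hm.ne') this.symm

/-- The automorphy factor of `h` is the constant matrix `D`. As `Aᵀ D = m`, the central character
gives `m^(∑ k) ρ(D)⁻¹ = ρ(Aᵀ)`, which is continuous and passes through the Fourier series. -/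
theorem hasSum_slash_of_isUpper (hρ : ρ.IsIrreducible) (hk : HasHighestWeight ρ k) (hN : 0 < N)
    [NeZero m] {f : UpperHalf n → W} {a : HalfIntegral n → W} (ha : HasFourierExpansion N f a)
    {h : Similitude n m} {A S : Matrix (Fin n) (Fin n) ℤ} (hu : IsUpper N h A S)
    (hA : Aᵀ.det ≠ 0) (Z : UpperHalf n) :
    HasSum (fun T => (ZMod.stdAddChar (pairing m (traceForm T) (S.map Int.cast)) *
      conjTerm N m A T Z) • ρ (intGL Aᵀ hA) (a T)) ((m : ℂ) ^ (∑ i, k i) • slash ρ h f Z) := by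
  have hm0 : (m : ℂ) ≠ 0 := by exact_mod_cast h.2.1.ne'
  obtain ⟨B, D, hh, -, h1, -⟩ := hu.relations hN
  have haut : ((autFactor h Z : GL (Fin n) ℂ) : Matrix (Fin n) (Fin n) ℂ) =
      D.map (Int.cast : ℤ → ℂ) := by
    change denom h.1 Z = _
    rw [denom, hh, toBlocks_fromBlocks₂₁, toBlocks_fromBlocks₂₂,
      Matrix.map_zero _ (Int.cast_zero (R := ℂ)), Matrix.zero_mul, zero_add]
  have hz : ((intGL Aᵀ hA * autFactor h Z : GL (Fin n) ℂ) : Matrix (Fin n) (Fin n) ℂ) =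
      (m : ℂ) • 1 := by
    have e : ((intGL Aᵀ hA : GL (Fin n) ℂ) : Matrix (Fin n) (Fin n) ℂ) =
      Aᵀ.map (Int.cast : ℤ → ℂ) := rfl
    have hmm : ∀ X Y : Matrix (Fin n) (Fin n) ℤ, (X * Y).map (Int.cast : ℤ → ℂ) =
      X.map Int.cast * Y.map Int.cast := fun X Y => Matrix.map_mul (f := Int.castRingHom ℂ)
    rw [Units.val_mul, haut, e, ← hmm, h1]
    ext i j
    rw [map_apply, Matrix.smul_apply, Matrix.smul_apply, one_apply, one_apply]
    split_ifs <;> simp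
  have hρw : ∀ w, ρ (intGL Aᵀ hA) w = (m : ℂ) ^ (∑ i, k i) • ρ (autFactor h Z)⁻¹ w := fun w => by
    rw [← hk.scalar hρ hz hm0, ← Module.End.mul_apply, ← map_mul, mul_inv_cancel_right]
  have hs := (ha (moebius h Z)).mapL (LinearMap.toContinuousLinearMap (ρ (intGL Aᵀ hA)))
  simp only [LinearMap.coe_toContinuousLinearMap', map_smul] at hs
  rw [slash_apply, ← hρw]
  convert hs using 2 with T
  rw [fourierTerm_moebius hN hu]

/-- The contribution of the cosets with a given diagonal block to the Fourier expansion. -/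
theorem exists_fourier_block (hρ : ρ.IsIrreducible) (hk : HasHighestWeight ρ k) (hN : 0 < N)
    [NeZero m] {l : Fin n} (hl : ∀ i, i ≤ l) {kn : ℕ} (hkn : k l = kn) {W₀ : Submodule ℤ W}
    (hW₀ : IsIntegralForm ρ W₀) {O : Subring ℂ} {X : Set (Similitude n m)} (hX : IsHeckeSet N X)
    {c : ℂ} (hc : IntegralSums N X c kn) {f : UpperHalf n → W} {a : HalfIntegral n → W}
    (ha : HasFourierExpansion N f a) (haL : ∀ T, a T ∈ latticeOver W₀ O)
    {A D : Matrix (Fin n) (Fin n) ℤ} (hAD : Aᵀ * D = (m : ℤ) • 1) {ι : Type*} {q : Finset ι}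
    {h : ι → Similitude n m} {σ : ι → Matrix (Fin n) (Fin n) ℤ}
    (hu : ∀ i ∈ q, IsUpper N (h i) A (σ i))
    (hinj : ∀ i ∈ q, ∀ j ∈ q, (σ i).map (Int.cast : ℤ → ZMod m) = (σ j).map Int.cast → i = j)
    (hocc : ∀ i ∈ q, Occurs N X A (σ i))
    (hsurj : ∀ S, Occurs N X A S → ∃ i ∈ q, (σ i).map (Int.cast : ℤ → ZMod m) = S.map Int.cast) :
    ∃ b : HalfIntegral n → W, HasFourierExpansion N
      (fun Z => (c * (m : ℂ) ^ (-((n : ℤ) * (n + 1) / 2))) •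
        ((m : ℂ) ^ (∑ i, k i) • ∑ i ∈ q, slash ρ (h i) f Z)) b ∧
      ∀ T, b T ∈ latticeOver W₀ O := by
  classical
  have hm : 0 < m := Nat.pos_of_ne_zero (NeZero.ne m)
  have hm0 : (m : ℝ) ≠ 0 := by exact_mod_cast hm.ne'
  have hA := det_ne_zero_of_mul_eq hm hAD
  let F : Finset (Matrix (Fin n) (Fin n) (ZMod m)) := q.image fun i => (σ i).map Int.cast
  have hF : ∀ s, s ∈ F ↔ ∃ S, Occurs N X A S ∧ S.map Int.cast = s := fun s => by
    constructor
    · intro hs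
      obtain ⟨i, hi, rfl⟩ := Finset.mem_image.mp hs
      exact ⟨σ i, hocc i hi, rfl⟩
    · rintro ⟨S, hS, rfl⟩
      obtain ⟨i, hi, e⟩ := hsurj S hS
      exact Finset.mem_image.mpr ⟨i, hi, e⟩
  let C : ℂ := c * (m : ℂ) ^ (-((n : ℤ) * (n + 1) / 2))
  let charSum : HalfIntegral n → ℂ := fun T =>
    ∑ s ∈ F, ZMod.stdAddChar (pairing m (traceForm T) s)
  let b₀ : HalfIntegral n → W := fun T => (C * charSum T) • ρ (intGL Aᵀ hA) (a T)
  have hsum : ∀ Z, HasSum (fun T => conjTerm N m A T Z • b₀ T)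
      (C • ((m : ℂ) ^ (∑ i, k i) • ∑ i ∈ q, slash ρ (h i) f Z)) := fun Z => by
    have h1 := (hasSum_sum fun i hi => hasSum_slash_of_isUpper hρ hk hN ha (hu i hi) hA Z).const_smul C
    rw [← Finset.smul_sum] at h1
    convert h1 using 2 with T
    simp only [b₀, charSum]
    rw [Finset.sum_image fun i hi j hj e => hinj i hi j hj e, ← Finset.sum_smul,
      ← Finset.sum_mul, smul_smul, smul_smul]
    congr 1
    ring
  have hb₀ : ∀ T, b₀ T ∈ latticeOver W₀ O := fun T => by
    obtain ⟨w, hw, e⟩ := intGL_latticeOver hρ hk hl hkn hW₀ O Aᵀ hA (haL T)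
    obtain ⟨r, hr⟩ := hc A D hAD F hF (pairing m (traceForm T))
    have : b₀ T = (r : O) • w := by
      simp only [b₀, e]
      rw [smul_smul, det_transpose, hr]
      rfl
    rw [this]
    exact Submodule.smul_mem _ _ hw
  -- If the target index is not half-integral, some `A R Aᵀ` pairs nontrivially with `T`; the set of
  -- the `S` is stable under adding it, so the exponential sum vanishes.
  have hzero : ∀ T, (¬ ∃ T' : HalfIntegral n, T'.1 = (m : ℝ)⁻¹ •
      ((A.map (Int.cast : ℤ → ℝ))ᵀ * T.1 * A.map (Int.cast : ℤ → ℝ))) → b₀ T = 0 := fun T hT => by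
    have h1 : ∃ R : Matrix (Fin n) (Fin n) ℤ, Rᵀ = R ∧
        pairing m (traceForm T) ((A * R * Aᵀ).map Int.cast) ≠ 0 := by
      by_contra! h2
      exact hT (exists_halfIntegral_conj hm T A h2)
    obtain ⟨R, hR, h0⟩ := h1
    have h3 : charSum T = 0 := charSum_eq_zero _ (fun s hs => by
      obtain ⟨S, hS, rfl⟩ := (hF s).mp hs
      exact (hF _).mpr ⟨_, hS.add_conj hX hR, add_map_cast _ _⟩) h0
    simp only [b₀, h3, mul_zero, zero_smul]
  let G : Set (HalfIntegral n) := {T | ∃ T' : HalfIntegral n, T'.1 = (m : ℝ)⁻¹ •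
      ((A.map (Int.cast : ℤ → ℝ))ᵀ * T.1 * A.map (Int.cast : ℤ → ℝ))}
  choose φ hφ using fun T : G => T.2
  have hφinj : Function.Injective φ := fun T T' e => by
    have h1 := hφ T
    rw [e, hφ T'] at h1
    have h2 := congrArg (fun M => (m : ℝ) • M) h1
    simp only [smul_smul, mul_inv_cancel₀ hm0, one_smul] at h2
    have hu : IsUnit (A.map (Int.cast : ℤ → ℝ)).det := by
      have : (A.map (Int.cast : ℤ → ℝ)).det = (A.det : ℝ) := (Int.cast_det A).symm
      rw [this, isUnit_iff_ne_zero]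
      rw [det_transpose] at hA
      exact_mod_cast hA
    have hu' : IsUnit (A.map (Int.cast : ℤ → ℝ))ᵀ.det := by rwa [det_transpose]
    have h3 := congrArg (fun M => ((A.map (Int.cast : ℤ → ℝ))ᵀ)⁻¹ * M *
      (A.map (Int.cast : ℤ → ℝ))⁻¹) h2
    simp only [Matrix.mul_assoc] at h3
    simp only [mul_nonsing_inv _ hu, Matrix.mul_one, nonsing_inv_mul_cancel_left _ _ hu'] at h3
    exact Subtype.ext (Subtype.ext h3.symm)
  -- Since `T ↦ m⁻¹ Aᵀ T A` is injective, every index receives at most one contribution; indices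
  -- outside the image get coefficient `0`.
  refine ⟨Function.extend φ (fun T => b₀ T) 0, fun Z => ?_, fun T => ?_⟩
  · refine (hφinj.hasSum_iff fun T hT => ?_).mp ?_
    · rw [Function.extend_apply' _ _ _ fun ⟨x, hx⟩ => hT ⟨x, hx⟩, Pi.zero_apply, smul_zero]
    · have h1 : (fun T => fourierTerm N T Z • Function.extend φ (fun T : G => b₀ T) 0 T) ∘ φ =
          (fun T => conjTerm N m A T Z • b₀ T) ∘ (Subtype.val : G → HalfIntegral n) := by
        funext T
        simp only [Function.comp_apply, hφinj.extend_apply, conjTerm_eq_fourierTerm (hφ T)]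
      rw [h1, hasSum_subtype_iff_of_support_subset]
      · exact hsum Z
      · intro T hT
        by_contra h2
        exact hT (by simp only [hzero T h2, smul_zero])
  · by_cases h1 : ∃ x, φ x = T
    · obtain ⟨x, rfl⟩ := h1
      rw [hφinj.extend_apply]
      exact hb₀ _
    · rw [Function.extend_apply' _ _ _ h1]
      exact zero_mem _

/-- The cosets are grouped by their block `A = κ i`; each group is handled by
`exists_fourier_block`, and the finitely many expansions are added. -/
theorem heckeOp_mem_integralFormsChar (hρ : ρ.IsIrreducible) (hk : HasHighestWeight ρ k)
    [NeZero N] [NeZero m] (hmN : m.Coprime N) {l : Fin n} (hl : ∀ i, i ≤ l) {kn : ℕ}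
    (hkn : k l = kn) {W₀ : Submodule ℤ W} (hW₀ : IsIntegralForm ρ W₀) {O : Subring ℂ}
    {χ : Fin n → DirichletCharacter ℂ N} (hO : ∀ j (a : (ZMod N)ˣ), χ j a ∈ O)
    {X : Set (Similitude n m)} (hX : IsHeckeSet N X) {c : ℂ} (hc : IntegralSums N X c kn)
    {f : UpperHalf n → W} (hf : f ∈ integralFormsChar ρ N χ W₀ O) :
    c • heckeOp ρ k N X f ∈ integralFormsChar ρ N χ W₀ O := by
  classical
  have hN : 0 < N := Nat.pos_of_ne_zero (NeZero.ne N)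
  have hm0 : (m : ℂ) ≠ 0 := by exact_mod_cast NeZero.ne m
  obtain ⟨hfχ, a, ha, haL⟩ := hf
  refine ⟨Submodule.smul_mem _ _ (heckeOp_mem_modularFormsChar hW₀ hX hfχ), ?_⟩
  have := Fintype.ofFinite (Quotient (cosetSetoid N X))
  obtain ⟨κ, σ, h1, h2, h3⟩ := exists_coset_parameters hN hmN hX
  choose γ h hγ hx hu using h1
  have hxX : ∀ i, lmul (γ i) (h i) ∈ X := fun i => by rw [hx]; exact i.out.2
  have key : ∀ A ∈ Finset.univ.image κ, ∃ b : HalfIntegral n → W, HasFourierExpansion N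
      (fun Z => (c * (m : ℂ) ^ (-((n : ℤ) * (n + 1) / 2))) • ((m : ℂ) ^ (∑ i, k i) •
        ∑ i with κ i = A, slash ρ i.out.1 f Z)) b ∧ ∀ T, b T ∈ latticeOver W₀ O := by
    intro A hA
    obtain ⟨i₀, -, rfl⟩ := Finset.mem_image.mp hA
    -- One unit `θ` serves the whole group: all `γ i` with the same block agree modulo `N` by
    -- `red_eq_of_isUpper`.
    obtain ⟨θ, hθ⟩ := mem_eigenSubgroup_of_isDiag hO hfχ (hγ i₀)
    obtain ⟨-, D, hAD⟩ := Occurs.exists_dual (X := X) hN ⟨γ i₀, h i₀, hγ i₀, hxX i₀, hu i₀⟩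
    have hslash : ∀ i, κ i = κ i₀ → slash ρ i.out.1 f = ((θ : O) : ℂ) • slash ρ (h i) f := by
      intro i hi
      have e := red_eq_of_isUpper hN hmN hX (hu i) (hi ▸ hu i₀) (hxX i) (hxX i₀)
      have e2 : slash ρ (γ i).toSimilitude f = slash ρ (γ i₀).toSimilitude f := by
        conv_lhs => rw [← inv_mul_cancel_right (γ i) (γ i₀)]
        rw [slash_mul, hfχ.1.2 _ (mul_inv_mem_Gam e)]
      have e3 : slash ρ (γ i).toSimilitude f = ((θ : O) : ℂ) • f := e2.trans hθ
      rw [← hx, slash_lmul, e3, map_smul]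
    obtain ⟨b, hb, hbL⟩ := exists_fourier_block hρ hk hN hl hkn hW₀ hX hc ha haL hAD
      (q := Finset.univ.filter fun i => κ i = κ i₀) (h := h) (σ := σ)
      (fun i hi => (Finset.mem_filter.mp hi).2 ▸ hu i)
      (fun i hi j hj e => h2 i j
        ((Finset.mem_filter.mp hi).2.trans (Finset.mem_filter.mp hj).2.symm) e)
      (fun i hi => ⟨γ i, h i, hγ i, hxX i, (Finset.mem_filter.mp hi).2 ▸ hu i⟩)
      (fun S hS => by
        obtain ⟨i, hi, e⟩ := h3 i₀ S hS
        exact ⟨i, Finset.mem_filter.mpr ⟨Finset.mem_univ _, hi⟩, e⟩)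
    refine ⟨fun T => (θ : O) • b T, fun Z => ?_, fun T => Submodule.smul_mem _ _ (hbL T)⟩
    have h4 := (hb Z).const_smul ((θ : O) : ℂ)
    have e : ∑ i with κ i = κ i₀, slash ρ i.out.1 f Z =
        ((θ : O) : ℂ) • ∑ i with κ i = κ i₀, slash ρ (h i) f Z := by
      rw [Finset.smul_sum]
      exact Finset.sum_congr rfl fun i hi => by
        rw [hslash i (Finset.mem_filter.mp hi).2]; rfl
    beta_reduce at h4 ⊢
    have h6 : ∀ w : W, (θ : O) • w = ((θ : O) : ℂ) • w := fun _ => rfl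
    rw [e]
    simp only [h6, smul_comm _ ((θ : O) : ℂ)] at h4 ⊢
    exact h4
  choose! b hb hbL using key
  refine ⟨fun T => ∑ A ∈ Finset.univ.image κ, b A T, fun Z => ?_, fun T =>
    Submodule.sum_mem _ fun A hA => hbL A hA T⟩
  have h5 := hasSum_sum fun A hA => hb A hA Z
  simp only [← Finset.smul_sum] at h5 ⊢
  rw [Finset.sum_fiberwise_of_maps_to fun i _ => Finset.mem_image_of_mem κ (Finset.mem_univ i)] at h5
  have e : (c • heckeOp ρ k N X f) Z = (c * (m : ℂ) ^ (-((n : ℤ) * (n + 1) / 2))) •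
      ((m : ℂ) ^ (∑ i, k i) • ∑ i : Quotient (cosetSetoid N X), slash ρ i.out.1 f Z) := by
    rw [heckeOp_apply, finsum_eq_sum_of_fintype, Pi.smul_apply, Pi.smul_apply, Finset.sum_apply,
      smul_smul, smul_smul, sub_eq_add_neg, zpow_add₀ hm0]
    congr 1
    ring
  rw [e]
  exact h5

end FourierCoefficients

/-! ### The operators `T(p)`, `T(p^δ)` and `T_{j,n-j}(p²)` -/

section HeckeOperators

variable {n N : ℕ}

/-- At units the values of a character are roots of unity. -/
theorem character_mem_integersOf [NeZero N] {K : IntermediateField ℚ ℂ}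
    (hK : ∀ (ψ : DirichletCharacter ℂ N) (a : ZMod N), ψ a ∈ K) (ψ : DirichletCharacter ℂ N)
    (a : (ZMod N)ˣ) : ψ a ∈ integersOf K := by
  refine ⟨?_, hK ψ a⟩
  have h : IsIntegral ℤ (ψ a) := by
    refine IsIntegral.of_pow (n := Fintype.card (ZMod N)ˣ) Fintype.card_pos ?_
    rw [← map_pow, ← Units.val_pow_eq_pow_val, pow_card_eq_one, Units.val_one, map_one]
    exact isIntegral_one
  exact h

/-- For `δ = 1` the exponents are `0` or `1`, so the truncated differences `1 - (ε i + ε j)` and `1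
- max (ε i) (ε j)` agree and `exponent₁_inequality` applies. The modulus is a variable equal to `p ^
1` because the double coset is stated for `p`. -/
theorem integralSums_heckeMatrix₁ [NeZero N] {p : ℕ} (hp : p.Prime) (hpN : ¬ p ∣ N) {m : ℕ}
    [NeZero m] (hm : m = p ^ 1) (k : ℕ) :
    IntegralSums N (doubleCoset N m (heckeMatrix₁ n p)) ((p : ℂ) ^ exponent₁ n k) k := by
  have : Fact p.Prime := ⟨hp⟩
  subst hm
  refine integralSums_doubleCoset hpN one_ne_zero (fun i => by simp) fun ε hε => ?_
  have h := exponent₁_inequality (k : ℤ) ε hε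
  have e : ∀ q : Fin n × Fin n, 1 - (ε q.1 + ε q.2) = 1 - max (ε q.1) (ε q.2) := fun q => by
    have h1 := hε q.1
    have h2 := hε q.2
    omega
  rw [Finset.sum_congr rfl fun q _ => e q]
  simpa using h

theorem integralSums_heckeMatrix₂ [NeZero N] {p : ℕ} [Fact p.Prime] (hpN : ¬ p ∣ N) (j k : ℕ) :
    IntegralSums N (doubleCoset N (p ^ 2) (heckeMatrix₂ n p j)) ((p : ℂ) ^ exponent₂ n k) k := by
  refine integralSums_doubleCoset hpN two_ne_zero (fun i => ?_) fun ε hε =>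
    exponent₂_inequality (k : ℤ) (Int.natCast_nonneg k) ε hε
  split_ifs <;> push_cast <;> ring

theorem heckeMatrix₁_isHeckeSet [NeZero N] {p : ℕ} (hp : 0 < p) :
    IsHeckeSet N (doubleCoset N p (heckeMatrix₁ n p)) :=
  doubleCoset_isHeckeSet hp fun i => by simp

theorem heckeMatrix₂_isHeckeSet [NeZero N] {p : ℕ} (hp : 0 < p) (j : ℕ) :
    IsHeckeSet N (doubleCoset N (p ^ 2) (heckeMatrix₂ n p j)) :=
  doubleCoset_isHeckeSet (pow_pos hp 2) fun i => by split_ifs <;> push_cast <;> ring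

end HeckeOperators

end SiegelHecke

end

/-! ### Assembly of the theorem. -/

open SiegelHecke in
theorem mainTheorem3 (n : ℕ) (hn : 2 ≤ n) (N : ℕ) (hN : 0 < N)
    {W : Type*} [NormedAddCommGroup W] [NormedSpace ℂ W] [FiniteDimensional ℂ W]
    (ρ : Representation ℂ (Matrix.GeneralLinearGroup (Fin n) ℂ) W) (hρ : ρ.IsIrreducible)
    (k : Fin n → ℤ) (hk : HasHighestWeight ρ k) (kn : ℤ) (hkn : kn = k ⟨n - 1, by omega⟩)
    (hkn0 : 0 ≤ kn)
    (W₀ : Submodule ℤ W) (hW₀ : IsIntegralForm ρ W₀)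
    (K : IntermediateField ℚ ℂ) (hK : FiniteDimensional ℚ K)
    (hKχ : ∀ (ψ : DirichletCharacter ℂ N) (a : ZMod N), ψ a ∈ K)
    (χ : Fin n → DirichletCharacter ℂ N) :
    -- the Hecke operators act on `M_ρ(Γ(N), χ)`
    (∀ p : ℕ, p.Prime → ¬ p ∣ N → ∀ f ∈ modularFormsChar ρ N χ,
      heckeT ρ k N p f ∈ modularFormsChar ρ N χ ∧
      (∀ δ : ℕ, 1 ≤ δ → heckeTPow ρ k N p δ f ∈ modularFormsChar ρ N χ) ∧
      ∀ j : ℕ, j < n → heckeTSq ρ k N p j f ∈ modularFormsChar ρ N χ) ∧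
    -- the normalized operators `T(p^δ)` preserve the integral structure
    (∀ p : ℕ, p.Prime → ¬ p ∣ N → ∀ δ : ℕ, 1 ≤ δ →
      ∀ f ∈ integralFormsChar ρ N χ W₀ (integersOf K),
        (((p : ℂ) ^ δ) ^ exponent₁ n kn) • heckeTPow ρ k N p δ f ∈
          integralFormsChar ρ N χ W₀ (integersOf K)) ∧
    -- the normalized operators `T_{j,n-j}(p²)` preserve the integral structure
    (∀ p : ℕ, p.Prime → ¬ p ∣ N → ∀ j : ℕ, j < n →
      ∀ f ∈ integralFormsChar ρ N χ W₀ (integersOf K),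
        ((p : ℂ) ^ exponent₂ n kn) • heckeTSq ρ k N p j f ∈
          integralFormsChar ρ N χ W₀ (integersOf K)) ∧
    -- every element of the integral Hecke algebra preserves the integral structure
    (∀ φ ∈ heckeAlgebra ρ k kn N χ, ∀ f : modularFormsChar ρ N χ,
      (f : UpperHalf n → W) ∈ integralFormsChar ρ N χ W₀ (integersOf K) →
        (φ f : UpperHalf n → W) ∈ integralFormsChar ρ N χ W₀ (integersOf K)) := by
  have : NeZero N := ⟨hN.ne'⟩
  obtain ⟨kn, rfl⟩ := Int.eq_ofNat_of_zero_le hkn0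
  have hl : ∀ i : Fin n, i ≤ ⟨n - 1, by omega⟩ := fun i => Fin.mk_le_mk.mpr (by omega)
  have hO : ∀ j (a : (ZMod N)ˣ), χ j a ∈ integersOf K := fun j a =>
    character_mem_integersOf hKχ (χ j) a
  have hcop : ∀ p : ℕ, p.Prime → ¬ p ∣ N → p.Coprime N := fun p hp hpN =>
    (Nat.Prime.coprime_iff_not_dvd hp).mpr hpN
  have hTSq : ∀ p : ℕ, p.Prime → ¬ p ∣ N → ∀ j : ℕ,
      ∀ f ∈ integralFormsChar ρ N χ W₀ (integersOf K),
        ((p : ℂ) ^ exponent₂ n kn) • heckeTSq ρ k N p j f ∈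
          integralFormsChar ρ N χ W₀ (integersOf K) := fun p hp hpN j f hf => by
    have : Fact p.Prime := ⟨hp⟩
    exact heckeOp_mem_integralFormsChar hρ hk ((hcop p hp hpN).pow_left 2) hl hkn.symm hW₀ hO
      (heckeMatrix₂_isHeckeSet hp.pos j) (integralSums_heckeMatrix₂ hpN j kn) hf
  have hT : ∀ p : ℕ, p.Prime → ¬ p ∣ N → ∀ f ∈ integralFormsChar ρ N χ W₀ (integersOf K),
        ((p : ℂ) ^ exponent₁ n kn) • heckeT ρ k N p f ∈
          integralFormsChar ρ N χ W₀ (integersOf K) := fun p hp hpN f hf => by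
    have : NeZero p := ⟨hp.ne_zero⟩
    exact heckeOp_mem_integralFormsChar hρ hk (hcop p hp hpN) hl hkn.symm hW₀ hO
      (heckeMatrix₁_isHeckeSet hp.pos) (integralSums_heckeMatrix₁ hp hpN (pow_one p).symm kn) hf
  refine ⟨fun p hp _ f hf => ⟨?_, fun δ _ => ?_, fun j _ => ?_⟩, fun p hp hpN δ hδ f hf => ?_,
    fun p hp hpN j _ => hTSq p hp hpN j, fun φ hφ => ?_⟩
  · exact heckeOp_mem_modularFormsChar hW₀ (heckeMatrix₁_isHeckeSet hp.pos) hf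
  · exact heckeOp_mem_modularFormsChar hW₀ congruenceSet_isHeckeSet hf
  · exact heckeOp_mem_modularFormsChar hW₀ (heckeMatrix₂_isHeckeSet hp.pos j) hf
  · have : Fact p.Prime := ⟨hp⟩
    exact heckeOp_mem_integralFormsChar hρ hk ((hcop p hp hpN).pow_left δ) hl hkn.symm hW₀ hO
      congruenceSet_isHeckeSet (integralSums_congruenceSet (by omega) kn) hf
  · induction hφ using Algebra.adjoin_induction with
    | mem φ hφ =>
      intro f hf
      rcases hφ with ⟨p, hp, hpN, e⟩ | ⟨p, hp, hpN, j, -, e⟩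
      · rw [e]; exact hT p hp hpN f hf
      · rw [e]; exact hTSq p hp hpN j f hf
    | algebraMap r =>
      intro f hf
      rw [Algebra.algebraMap_eq_smul_one, LinearMap.smul_apply, Module.End.one_apply]
      exact zsmul_mem hf r
    | add φ ψ _ _ hφ hψ =>
      intro f hf
      exact add_mem (hφ f hf) (hψ f hf)
    | mul φ ψ _ _ hφ hψ =>
      intro f hf
      exact hφ (ψ f) (hψ f hf)
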